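/- Let $M$ be a (finite-dimensional, Hausdorff, second countable) smooth manifold and let $(\mathfrak g,F,\chi)$ be a finite-dimensional real Lie quasi-bialgebra: $\mathfrak g$ is a Lie algebra, $F:\mathfrak g\to\wedge^2\mathfrak g$ is linear, $\chi\in\wedge^3\mathfrak g$, and the bilinear skew-symmetric bracket on $\mathfrak g\oplus\mathfrak g^*$ given, for $u,v\in\mathfrak g$ and $\mu,\nu\in\mathfrak g^*$, by $$[u,v]=[u,v]_{\mathfrak g},\qquad [v,\mu]=(i_\mu F(v),\ \mathrm{ad}^*_v\mu),\qquad [\mu,\nu]=(\chi(\mu,\nu,\cdot),\ F^*(\mu,\nu))$$ satisfies the Jacobi identity; here $i_\mu F(v)=F(v)(\mu,\cdot)$, $\mathrm{ad}_v^*\mu=-\mu\circ\mathrm{ad}_v$ and $F^*(\mu,\nu)(v)=F(v)(\mu,\nu)$. Let $\rho_M:\mathfrak g\to\mathfrak X(M)$ be an infinitesimal action (a Lie algebra homomorphism) and let $\pi\in\mathfrak X^2(M)$ be a bivector field, with $\pi^\sharp(\alpha)=\pi(\alpha,\cdot)$. Write $(\rho_M^*\alpha)(v)=\alpha(\rho_M(v))$.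 Consider the vector bundle $A=\mathfrak g\oplus T^*M$ with anchor $r(v,\alpha)=\rho_M(v)+\pi^\sharp(\alpha)$. There is exactly one $\mathbb R$-bilinear skew-symmetric bracket $[\cdot,\cdot]_A$ on $\Gamma(A)=C^\infty(M,\mathfrak g)\oplus\Omega^1(M)$ that satisfies the Leibniz rule $[a,fb]_A=f[a,b]_A+(\mathcal L_{r(a)}f)\,b$ and, for $u,v\in\mathfrak g$ (regarded as constant maps) and $\alpha,\beta\in\Omega^1(M)$, $$[(u,0),(v,0)]_A=([u,v],0),\qquad [(v,0),(0,\alpha)]_A=\bigl(-i_{\rho_M^*\alpha}F(v),\ \mathcal L_{\rho_M(v)}\alpha\bigr),$$ $$[(0,\alpha),(0,\beta)]_A=\bigl(\chi(\rho_M^*\alpha,\rho_M^*\beta,\cdot),\ \mathcal L_{\pi^\sharp(\alpha)}\beta-\mathcal L_{\pi^\sharp(\beta)}\alpha-d\,\pi(\alpha,\beta)\bigr).$$ Then $(A,r,[\cdot,\cdot]_A)$ is a Lie algebroid if and only if $(M,\pi)$ is a quasi-Poisson $\mathfrak g$-space, that is, $$\mathcal L_{\rho_M(v)}\pi=-\rho_M(F(v))\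 \text{ for all } v\in\mathfrak g,\qquad \tfrac12[\pi,\pi]=\rho_M(\chi),$$ where $[\cdot,\cdot]$ is the Schouten bracket, normalized so that $\tfrac12[\pi,\pi](df,dg,dh)=\{f,\{g,h\}\}+\{g,\{h,f\}\}+\{h,\{f,g\}\}$ with $\{f,g\}=\pi(df,dg)$. As a corollary, if $(M,\pi)$ is a quasi-Poisson $\mathfrak g$-space, then the generalized distribution $\{\rho_M(v)+\pi^\sharp(\alpha)\mid v\in\mathfrak g,\ \alpha\in T^*M\}\subseteq TM$ is integrable: through every point of $M$ there passes a connected, injectively immersed submanifold whose tangent space at each of its points is the distribution at that point. -/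

import Mathlib

open scoped Manifold ContDiff Bundle
open Bundle

noncomputable section

namespace QuasiPoisson

/-! ## Sections of a vector bundle as a module over the smooth functions -/

section Sections

variable {E : Type*} [NormedAddCommGroup E] [NormedSpace ℝ E]
  {M : Type*} [TopologicalSpace M] [ChartedSpace E M]
  {F : Type*} [NormedAddCommGroup F] [NormedSpace ℝ F]
  {V : M → Type*} [TopologicalSpace (TotalSpace F V)] [∀ x, TopologicalSpace (V x)]
  [FiberBundle F V] [∀ x, AddCommGroup (V x)] [∀ x, Module ℝ (V x)] [VectorBundle ℝ F V]

/-- Pointwise product of a smooth function and a smooth section. -/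
instance sectionSMul : SMul C^∞⟮𝓘(ℝ, E), M; ℝ⟯ Cₛ^∞⟮𝓘(ℝ, E); F, V⟯ :=
  ⟨fun f s => ⟨fun x => f x • s x, ContMDiff.smul_section f.contMDiff s.contMDiff⟩⟩

@[simp] theorem section_smul_apply (f : C^∞⟮𝓘(ℝ, E), M; ℝ⟯) (s : Cₛ^∞⟮𝓘(ℝ, E); F, V⟯) (x : M) :
    (f • s) x = f x • s x := rfl

instance sectionModule : Module C^∞⟮𝓘(ℝ, E), M; ℝ⟯ Cₛ^∞⟮𝓘(ℝ, E); F, V⟯ where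
  one_smul s := by ext x; exact one_smul ℝ (s x)
  mul_smul f g s := by ext x; exact mul_smul (f x) (g x) (s x)
  smul_zero f := by ext x; exact smul_zero (f x)
  smul_add f s t := by ext x; exact smul_add (f x) (s x) (t x)
  add_smul f g s := by ext x; exact add_smul (f x) (g x) (s x)
  zero_smul s := by ext x; exact zero_smul ℝ (s x)

end Sections

/-! ## Functions, vector fields, one-forms and bivector fields on a manifold -/

section Objects

variable (E : Type*) [NormedAddCommGroup E] [NormedSpace ℝ E]
  (M : Type*) [TopologicalSpace M] [ChartedSpace E M]

/-- The smooth real functions `C^∞(M)`. -/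
abbrev SmoothFun : Type _ := C^∞⟮𝓘(ℝ, E), M; ℝ⟯

/-- The cotangent space at `x`. -/
abbrev Cotangent (x : M) : Type _ := TangentSpace 𝓘(ℝ, E) x →L[ℝ] Bundle.Trivial M ℝ x

variable [IsManifold 𝓘(ℝ, E) ∞ M]

instance isManifold_one : IsManifold 𝓘(ℝ, E) 1 M := .of_le (n := ∞) (by simp)

instance isManifold_minSmoothness_two : IsManifold 𝓘(ℝ, E) (minSmoothness ℝ 2) M :=
  .of_le (n := ∞) (by simpa using (WithTop.coe_le_coe.2 le_top : ((2 : ℕ∞) : WithTop ℕ∞) ≤ ∞))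

instance isManifold_minSmoothness_three : IsManifold 𝓘(ℝ, E) (minSmoothness ℝ 3) M :=
  .of_le (n := ∞) (by simpa using (WithTop.coe_le_coe.2 le_top : ((3 : ℕ∞) : WithTop ℕ∞) ≤ ∞))

instance isManifold_infty_add_one : IsManifold 𝓘(ℝ, E) (((⊤ : ℕ∞) : WithTop ℕ∞) + 1) M :=
  ‹IsManifold 𝓘(ℝ, E) ∞ M›

/-- Smooth vector fields: smooth sections of the tangent bundle. -/
abbrev VField : Type _ := Cₛ^∞⟮𝓘(ℝ, E); E, (TangentSpace 𝓘(ℝ, E) : M → Type _)⟯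

/-- Smooth one-forms: smooth sections of the cotangent bundle. -/
abbrev OneForm : Type _ := Cₛ^∞⟮𝓘(ℝ, E); E →L[ℝ] ℝ, Cotangent E M⟯

/-- A smooth bivector field `π`, given by its contraction map `π^♯ : T^*M → TM`,
`π^♯(α) = π(α, ·)`: a smooth section of the bundle `Hom(T^*M, TM)` such that the bilinear form
`π(α, β) = β(π^♯(α))` is alternating. -/
structure Bivector where
  /-- the bundle map `π^♯` -/
  sharp : Cₛ^∞⟮𝓘(ℝ, E); (E →L[ℝ] ℝ) →L[ℝ] E,
    fun x : M => Cotangent E M x →L[ℝ] TangentSpace 𝓘(ℝ, E) x⟯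
  alternating : ∀ (x : M) (a : Cotangent E M x), a (sharp x a) = 0

end Objects

/-! ## Cartan calculus -/

section Calculus

variable {E : Type*} [NormedAddCommGroup E] [NormedSpace ℝ E]
  {M : Type*} [TopologicalSpace M] [ChartedSpace E M]

theorem contMDiffAt_of_trivial {f : M → ℝ} {x : M}
    (h : ContMDiffAt 𝓘(ℝ, E) (𝓘(ℝ, E).prod 𝓘(ℝ)) ∞
      (fun y => TotalSpace.mk' ℝ (E := Bundle.Trivial M ℝ) y (f y)) x) :
    ContMDiffAt 𝓘(ℝ, E) 𝓘(ℝ) ∞ f x := by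
  simp only [contMDiffAt_totalSpace] at h
  exact h.2

variable [IsManifold 𝓘(ℝ, E) ∞ M]

theorem contMDiffAt_eval {α : Π x : M, Cotangent E M x} {Y : Π x : M, TangentSpace 𝓘(ℝ, E) x}
    {x : M}
    (hα : ContMDiffAt 𝓘(ℝ, E) (𝓘(ℝ, E).prod 𝓘(ℝ, E →L[ℝ] ℝ)) ∞
      (fun y => TotalSpace.mk' (E →L[ℝ] ℝ) (E := Cotangent E M) y (α y)) x)
    (hY : CMDiffAt ∞ (T% Y) x) :
    ContMDiffAt 𝓘(ℝ, E) 𝓘(ℝ) ∞ (fun y => (α y (Y y) : ℝ)) x :=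
  contMDiffAt_of_trivial (ContMDiffAt.clm_bundle_apply hα hY)

theorem mdifferentiableAt_eval (α : OneForm E M) {Y : Π x : M, TangentSpace 𝓘(ℝ, E) x}
    {x : M} (hY : MDiffAt (T% Y) x) :
    MDifferentiableAt 𝓘(ℝ, E) 𝓘(ℝ) (fun y => (α y (Y y) : ℝ)) x := by
  have h := MDifferentiableAt.clm_bundle_apply (α.mdifferentiableAt (x := x)) hY
  rw [mdifferentiableAt_totalSpace] at h
  exact h.2

theorem contMDiffAt_mvfderiv {f : M → ℝ} {Y : Π x : M, TangentSpace 𝓘(ℝ, E) x} {x : M}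
    (hf : ContMDiffAt 𝓘(ℝ, E) 𝓘(ℝ) ∞ f x) (hY : CMDiffAt ∞ (T% Y) x) :
    ContMDiffAt 𝓘(ℝ, E) 𝓘(ℝ) ∞ (fun y => mvfderiv 𝓘(ℝ, E) f y (Y y)) x := by
  have h1 := hf.mfderiv_const (m := ∞) (by simp)
  have h2 := ContMDiffAt.clm_apply_of_inCoordinates (b₁ := fun y : M => y) (b₂ := f) (m₀ := x)
    (E₂ := TangentSpace 𝓘(ℝ)) (F₂ := ℝ) (ϕ := fun y => mfderiv 𝓘(ℝ, E) 𝓘(ℝ) f y) h1 hY hf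
  simp only [contMDiffAt_totalSpace] at h2
  simpa [mvfderiv] using! h2.2

/-- A field of covectors is smooth if it is smooth on all local smooth vector fields. -/
theorem contMDiffAt_cotangent [FiniteDimensional ℝ E] {α : Π x : M, Cotangent E M x} {x : M}
    (h : ∀ Y : Π x : M, TangentSpace 𝓘(ℝ, E) x, CMDiffAt ∞ (T% Y) x →
      ContMDiffAt 𝓘(ℝ, E) 𝓘(ℝ) ∞ (fun y => (α y (Y y) : ℝ)) x) :
    ContMDiffAt 𝓘(ℝ, E) (𝓘(ℝ, E).prod 𝓘(ℝ, E →L[ℝ] ℝ)) ∞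
      (fun y => TotalSpace.mk' (E →L[ℝ] ℝ) (E := Cotangent E M) y (α y)) x := by
  rw [contMDiffAt_hom_bundle]
  refine ⟨contMDiffAt_id, ?_⟩
  let b := Module.finBasis ℝ E
  let e := trivializationAt E (TangentSpace 𝓘(ℝ, E) : M → Type _) x
  have hx : x ∈ e.baseSet := FiberBundle.mem_baseSet_trivializationAt' x
  have key : ContMDiffAt 𝓘(ℝ, E) 𝓘(ℝ, E →L[ℝ] ℝ) ∞ (fun y => ∑ i,
      (α y (e.localFrame b i y) : ℝ) • (LinearMap.toContinuousLinearMap (b.coord i))) x := by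
    refine contMDiffAt_finsetSum fun i _ => ?_
    exact (h _ (contMDiffAt_localFrame_of_mem ∞ e b i hx)).smul contMDiffAt_const
  refine key.congr_of_eventuallyEq ?_
  filter_upwards [e.open_baseSet.mem_nhds hx] with y hy
  refine ContinuousLinearMap.coe_injective (b.ext fun i => ?_)
  have h1 : (e.symm y (b i)) = e.localFrame b i y := by
    simp [hy, Trivialization.basisAt, Trivialization.symm_apply]
  simp [ContinuousLinearMap.inCoordinates, Finsupp.single_apply]
  rw [← h1, ← e.symmL_apply (R := ℝ) hy]

/-- The function `α(X)`. -/
def pair (α : OneForm E M) (X : VField E M) : SmoothFun E M :=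
  ⟨fun x => (α x (X x) : ℝ), fun x => contMDiffAt_eval (α.contMDiff x) (X.contMDiff x)⟩

/-- The derivative `L_X f = df(X)` of a function along a vector field. -/
def lieFun (X : VField E M) (f : SmoothFun E M) : SmoothFun E M :=
  ⟨fun x => mvfderiv 𝓘(ℝ, E) f x (X x),
    fun x => contMDiffAt_mvfderiv (f.contMDiff x) (X.contMDiff x)⟩

/-- The vector field `π^♯(α)`. -/
def Bivector.sharpForm (P : Bivector E M) (α : OneForm E M) : VField E M :=
  ⟨fun x => P.sharp x (α x), ContMDiff.clm_bundle_apply P.sharp.contMDiff α.contMDiff⟩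

/-- The function `π(α, β) = β(π^♯(α))`. -/
def Bivector.eval (P : Bivector E M) (α β : OneForm E M) : SmoothFun E M :=
  pair β (P.sharpForm α)

variable [FiniteDimensional ℝ E]

/-- The Lie bracket of vector fields. -/
def lieField (X Y : VField E M) : VField E M :=
  ⟨VectorField.mlieBracket 𝓘(ℝ, E) X Y, by
    have : CompleteSpace E := FiniteDimensional.complete ℝ E
    exact ContDiff.mlieBracket_vectorField (m := ⊤) (n := ⊤) X.contMDiff Y.contMDiff (by simp)⟩

/-- The differential of a function. -/
def extd (f : SmoothFun E M) : OneForm E M :=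
  ⟨fun x => mvfderiv 𝓘(ℝ, E) f x,
    fun x => contMDiffAt_cotangent fun _ hY => contMDiffAt_mvfderiv (f.contMDiff x) hY⟩

/-- The expression `X(α(Y)) - α([X, Y])` at the point `x`. -/
def lieFormAux (X : VField E M) (α : OneForm E M) (x : M)
    (Y : Π x : M, TangentSpace 𝓘(ℝ, E) x) : ℝ :=
  mvfderiv 𝓘(ℝ, E) (fun y => (α y (Y y) : ℝ)) x (X x)
    - α x (VectorField.mlieBracket 𝓘(ℝ, E) X Y x)

theorem tensorialAt_lieFormAux (X : VField E M) (α : OneForm E M) (x : M) :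
    TensorialAt 𝓘(ℝ, E) E (lieFormAux X α x) x where
  smul {f Y} hf hY := by
    have : CompleteSpace E := FiniteDimensional.complete ℝ E
    have h := mdifferentiableAt_eval α hY
    have h2 := congrArg (fun L => L (X x)) (mvfderiv_mul hf h)
    have h3 := congrArg (α x) (VectorField.mlieBracket_smul_right (V := X) hf hY)
    have h4 : (fun y => (α y ((f • Y) y) : ℝ)) = f * fun y => (α y (Y y) : ℝ) := by
      funext y
      exact (α y).map_smul (f y) (Y y)
    simp only [lieFormAux, h4]
    rw [h2, h3, map_add, map_smul, map_smul]
    simp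
    ring
  add {Y Z} hY hZ := by
    have : CompleteSpace E := FiniteDimensional.complete ℝ E
    have h := mdifferentiableAt_eval α hY
    have h' := mdifferentiableAt_eval α hZ
    have h2 := congrArg (fun L => L (X x)) (mvfderiv_add h h')
    have h3 := congrArg (α x) (VectorField.mlieBracket_add_right (V := X) hY hZ)
    have h4 : (fun y => (α y ((Y + Z) y) : ℝ)) =
        (fun y => (α y (Y y) : ℝ)) + fun y => (α y (Z y) : ℝ) := by
      funext y
      exact (α y).map_add (Y y) (Z y)
    simp only [lieFormAux, h4]
    rw [h2, h3, map_add]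
    simp
    ring

/-- The Lie derivative `L_X α` of a one-form, characterized by
`(L_X α)(Y) = X(α(Y)) - α([X, Y])`. -/
def lieForm (X : VField E M) (α : OneForm E M) : OneForm E M :=
  ⟨fun x => TensorialAt.mkHom (lieFormAux X α x) x (tensorialAt_lieFormAux X α x), fun x => by
    refine contMDiffAt_cotangent fun Y hY => ?_
    have : CompleteSpace E := FiniteDimensional.complete ℝ E
    have h1 := contMDiffAt_mvfderiv (contMDiffAt_eval (α.contMDiff x) hY) (X.contMDiff x)
    have h2 := contMDiffAt_eval (α.contMDiff x) (ContMDiffAt.mlieBracket_vectorField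
      (m := ⊤) (n := ⊤) (X.contMDiff x) hY (by simp))
    refine (h1.sub h2).congr_of_eventuallyEq ?_
    have h3 : ∀ᶠ y in nhds x, CMDiffAt 1 (T% Y) y :=
      (contMDiffAt_iff_contMDiffAt_nhds (by simp)).1 (hY.of_le (by simp))
    filter_upwards [h3] with y hy
    exact TensorialAt.mkHom_apply (tensorialAt_lieFormAux X α y)
      (hy.mdifferentiableAt one_ne_zero)⟩

theorem pair_lieForm (X : VField E M) (α : OneForm E M) (Y : VField E M) :
    pair (lieForm X α) Y = lieFun X (pair α Y) - pair α (lieField X Y) := by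
  ext x
  exact TensorialAt.mkHom_apply (tensorialAt_lieFormAux X α x) Y.mdifferentiableAt

end Calculus

/-! ## Lie quasi-bialgebras

For a finite-dimensional Lie algebra `𝔤`, elements of `⋀^k 𝔤` are represented as alternating
`k`-linear forms on the dual `𝔤^*`. -/

section LieQuasiBialgebra

variable {𝔤 : Type*} [LieRing 𝔤] [LieAlgebra ℝ 𝔤] [FiniteDimensional ℝ 𝔤]

/-- The contraction `i_μ w ∈ 𝔤` of `w ∈ ⋀² 𝔤`: `ν(i_μ w) = w(μ, ν)`. -/
def contract₂ (w : (Module.Dual ℝ 𝔤) [⋀^Fin 2]→ₗ[ℝ] ℝ) (μ : Module.Dual ℝ 𝔤) : 𝔤 :=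
  (Module.evalEquiv ℝ 𝔤).symm (w.toMultilinearMap.toLinearMap ![μ, 0] 1)

/-- The element `w(μ, ν) ∈ 𝔤` for `w ∈ ⋀³ 𝔤`: `η(w(μ, ν)) = w(μ, ν, η)`. -/
def contract₃ (w : (Module.Dual ℝ 𝔤) [⋀^Fin 3]→ₗ[ℝ] ℝ) (μ ν : Module.Dual ℝ 𝔤) : 𝔤 :=
  (Module.evalEquiv ℝ 𝔤).symm (w.toMultilinearMap.toLinearMap ![μ, ν, 0] 2)

theorem apply_contract₂ (w : (Module.Dual ℝ 𝔤) [⋀^Fin 2]→ₗ[ℝ] ℝ) (μ ν : Module.Dual ℝ 𝔤) :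
    ν (contract₂ w μ) = w ![μ, ν] := by
  have h : Function.update ![μ, 0] 1 ν = ![μ, ν] := by
    ext i; fin_cases i <;> simp
  simp [contract₂, h]

theorem apply_contract₃ (w : (Module.Dual ℝ 𝔤) [⋀^Fin 3]→ₗ[ℝ] ℝ) (μ ν η : Module.Dual ℝ 𝔤) :
    η (contract₃ w μ ν) = w ![μ, ν, η] := by
  have h : Function.update ![μ, ν, 0] 2 η = ![μ, ν, η] := by
    ext i; fin_cases i <;> simp
  simp [contract₃, h]

/-- The coadjoint action `ad^*_v μ = -μ ∘ ad_v`. -/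
def coad (v : 𝔤) (μ : Module.Dual ℝ 𝔤) : Module.Dual ℝ 𝔤 :=
  -(μ ∘ₗ (LieAlgebra.ad ℝ 𝔤 v : 𝔤 →ₗ[ℝ] 𝔤))

/-- The dual `F^* : 𝔤^* ∧ 𝔤^* → 𝔤^*` of a cobracket, `F^*(μ, ν)(v) = F(v)(μ, ν)`. -/
def cobracketDual (F : 𝔤 →ₗ[ℝ] (Module.Dual ℝ 𝔤) [⋀^Fin 2]→ₗ[ℝ] ℝ) (μ ν : Module.Dual ℝ 𝔤) :
    Module.Dual ℝ 𝔤 where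
  toFun v := F v ![μ, ν]
  map_add' u v := by simp
  map_smul' c v := by simp

/-- The bracket on the double `𝔤 ⊕ 𝔤^*`, the bilinear skew-symmetric operation with
`[u, v] = [u, v]_𝔤`, `[v, μ] = (i_μ F(v), ad^*_v μ)` and `[μ, ν] = (χ(μ, ν), F^*(μ, ν))`. -/
def doubleBracket (F : 𝔤 →ₗ[ℝ] (Module.Dual ℝ 𝔤) [⋀^Fin 2]→ₗ[ℝ] ℝ)
    (χ : (Module.Dual ℝ 𝔤) [⋀^Fin 3]→ₗ[ℝ] ℝ) (a b : 𝔤 × Module.Dual ℝ 𝔤) :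
    𝔤 × Module.Dual ℝ 𝔤 :=
  (⁅a.1, b.1⁆ + contract₂ (F a.1) b.2 - contract₂ (F b.1) a.2 + contract₃ χ a.2 b.2,
    coad a.1 b.2 - coad b.1 a.2 + cobracketDual F a.2 b.2)

/-- `(𝔤, F, χ)` is a Lie quasi-bialgebra: the bracket on the double `𝔤 ⊕ 𝔤^*` is a Lie bracket. -/
structure IsLieQuasiBialgebra (F : 𝔤 →ₗ[ℝ] (Module.Dual ℝ 𝔤) [⋀^Fin 2]→ₗ[ℝ] ℝ)
    (χ : (Module.Dual ℝ 𝔤) [⋀^Fin 3]→ₗ[ℝ] ℝ) : Prop where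
  skew : ∀ a, doubleBracket F χ a a = 0
  jacobi : ∀ a b c, doubleBracket F χ a (doubleBracket F χ b c) =
    doubleBracket F χ (doubleBracket F χ a b) c + doubleBracket F χ b (doubleBracket F χ a c)

end LieQuasiBialgebra

/-! ## Smooth maps with values in a finite-dimensional vector space -/

section SmoothMaps

variable (E : Type*) [NormedAddCommGroup E] [NormedSpace ℝ E]
  (M : Type*) [TopologicalSpace M] [ChartedSpace E M]
  (𝔤 : Type*) [AddCommGroup 𝔤] [Module ℝ 𝔤]

/-- The space `C^∞(M, 𝔤)` of smooth maps to a finite-dimensional vector space `𝔤`: the maps all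
of whose components (compositions with linear functionals) are smooth. -/
def smoothMaps : Submodule ℝ (M → 𝔤) where
  carrier := {v | ∀ μ : Module.Dual ℝ 𝔤, ContMDiff 𝓘(ℝ, E) 𝓘(ℝ) ∞ fun x => μ (v x)}
  zero_mem' μ := by simpa using contMDiff_const
  add_mem' hu hv μ := by simpa [Pi.add_def] using (hu μ).add (hv μ)
  smul_mem' c v hv μ := by simpa [Pi.mul_def] using (contMDiff_const (c := c)).mul (hv μ)

/-- The space `C^∞(M, 𝔤)`. -/
abbrev SmoothMap : Type _ := smoothMaps E M 𝔤

variable {E M 𝔤}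

/-- Pointwise product of a smooth function and a smooth map to `𝔤`. -/
instance smoothMapSMul : SMul (SmoothFun E M) (SmoothMap E M 𝔤) :=
  ⟨fun f v => ⟨fun x => f x • v.1 x, fun μ => by
    simpa [Pi.mul_def] using f.contMDiff.mul (v.2 μ)⟩⟩

@[simp] theorem smoothMap_smul_apply (f : SmoothFun E M) (v : SmoothMap E M 𝔤) (x : M) :
    (f • v).1 x = f x • v.1 x := rfl

instance smoothMapModule : Module (SmoothFun E M) (SmoothMap E M 𝔤) where
  one_smul v := Subtype.ext (funext fun x => one_smul ℝ (v.1 x))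
  mul_smul f g v := Subtype.ext (funext fun x => mul_smul (f x) (g x) (v.1 x))
  smul_zero f := Subtype.ext (funext fun x => smul_zero (f x))
  smul_add f u v := Subtype.ext (funext fun x => smul_add (f x) (u.1 x) (v.1 x))
  add_smul f g v := Subtype.ext (funext fun x => add_smul (f x) (g x) (v.1 x))
  zero_smul v := Subtype.ext (funext fun x => zero_smul ℝ (v.1 x))

variable (E M) in
/-- An element of `𝔤` as a constant map `M → 𝔤`. -/
def constMap (v : 𝔤) : SmoothMap E M 𝔤 := ⟨fun _ => v, fun _ => contMDiff_const⟩

end SmoothMaps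

/-! ## Quasi-Poisson spaces and the bracket on `𝔤 ⊕ T^*M` -/

section Main

variable {E : Type*} [NormedAddCommGroup E] [NormedSpace ℝ E] [FiniteDimensional ℝ E]
  {M : Type*} [TopologicalSpace M] [ChartedSpace E M] [IsManifold 𝓘(ℝ, E) ∞ M]
  {𝔤 : Type*} [LieRing 𝔤] [LieAlgebra ℝ 𝔤] [FiniteDimensional ℝ 𝔤]

/-- `ρ` is an infinitesimal action of `𝔤` on `M`: a homomorphism of Lie algebras from `𝔤` to the
vector fields. -/
def IsInfinitesimalAction (ρ : 𝔤 →ₗ[ℝ] VField E M) : Prop :=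
  ∀ u v : 𝔤, ρ ⁅u, v⁆ = lieField (ρ u) (ρ v)

/-- The Lie derivative of a bivector field,
`(L_X π)(α, β) = X(π(α, β)) - π(L_X α, β) - π(α, L_X β)`. -/
def lieBivector (X : VField E M) (P : Bivector E M) (α β : OneForm E M) : SmoothFun E M :=
  lieFun X (P.eval α β) - P.eval (lieForm X α) β - P.eval α (lieForm X β)

/-- The bracket of functions `{f, g} = π(df, dg)` of a bivector field. -/
def Bivector.bracket (P : Bivector E M) (f g : SmoothFun E M) : SmoothFun E M :=
  P.eval (extd f) (extd g)

/-- The Schouten bracket `[P, Q]` of two bivector fields, as a skew-symmetric triderivation of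
`C^∞(M)`, that is, through its values `[P, Q](df, dg, dh)` on exact one-forms (which determine
the trivector field `[P, Q]`). The sign is that of the extension of the Lie bracket of vector
fields with `[P, X ∧ Y] = [P, X] ∧ Y - X ∧ [P, Y]` and `[P, X] = -L_X P`. -/
def schouten (P Q : Bivector E M) (f g h : SmoothFun E M) : SmoothFun E M :=
  (P.bracket f (Q.bracket g h) + P.bracket g (Q.bracket h f) + P.bracket h (Q.bracket f g)) +
  (Q.bracket f (P.bracket g h) + Q.bracket g (P.bracket h f) + Q.bracket h (P.bracket f g))

/-- The dual `ρ^* : T^*M → 𝔤^*` of the action, `(ρ^* a)(v) = a(ρ(v))`. -/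
def pull (ρ : 𝔤 →ₗ[ℝ] VField E M) (x : M) (a : Cotangent E M x) : Module.Dual ℝ 𝔤 where
  toFun v := a (ρ v x)
  map_add' u v := by simp
  map_smul' c v := by simp

/-- `(M, π)` is a quasi-Poisson `𝔤`-space: `L_{ρ(v)} π = -ρ(F(v))` for all `v` and
`[π, π] / 2 = ρ(χ)`, where `ρ(F(v))(α, β) = F(v)(ρ^* α, ρ^* β)` and
`ρ(χ)(α, β, γ) = χ(ρ^* α, ρ^* β, ρ^* γ)`. -/
structure IsQuasiPoisson (F : 𝔤 →ₗ[ℝ] (Module.Dual ℝ 𝔤) [⋀^Fin 2]→ₗ[ℝ] ℝ)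
    (χ : (Module.Dual ℝ 𝔤) [⋀^Fin 3]→ₗ[ℝ] ℝ)
    (ρ : 𝔤 →ₗ[ℝ] VField E M) (P : Bivector E M) : Prop where
  lie_bivector : ∀ (v : 𝔤) (α β : OneForm E M) (x : M),
    lieBivector (ρ v) P α β x = -F v ![pull ρ x (α x), pull ρ x (β x)]
  schouten_self : ∀ (f g h : SmoothFun E M) (x : M),
    (1 / 2 : ℝ) * schouten P P f g h x =
      χ ![pull ρ x (extd f x), pull ρ x (extd g x), pull ρ x (extd h x)]

/-- The vector field `x ↦ ρ(v(x))_x` of a map `v : M → 𝔤`. -/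
def actionMap (ρ : 𝔤 →ₗ[ℝ] VField E M) (v : SmoothMap E M 𝔤) : VField E M :=
  ⟨fun x => ρ (v.1 x) x, by
    let b := Module.finBasis ℝ 𝔤
    have h : ∀ x, ρ (v.1 x) x = ∑ i, (b.coord i (v.1 x)) • ρ (b i) x := fun x => by
      have h1 := congrArg (fun w => ContMDiffSection.coeAddHom 𝓘(ℝ, E) E ∞
        (TangentSpace 𝓘(ℝ, E) : M → Type _) w x) (congrArg ρ (b.sum_repr (v.1 x)))
      simp only [map_sum, map_smul, Finset.sum_apply, ContMDiffSection.coeAddHom_apply,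
        ContMDiffSection.coe_smul, Pi.smul_apply] at h1
      exact h1.symm
    simp only [h]
    exact ContMDiff.sum_section fun i _ => ContMDiff.smul_section (v.2 (b.coord i))
      (ρ (b i)).contMDiff⟩

/-- The anchor `r(v, α) = ρ(v) + π^♯(α)` on sections of `𝔤 ⊕ T^*M`. -/
def anchor (ρ : 𝔤 →ₗ[ℝ] VField E M) (P : Bivector E M) :
    (SmoothMap E M 𝔤 × OneForm E M) →ₗ[SmoothFun E M] VField E M where
  toFun a := actionMap ρ a.1 + P.sharpForm a.2
  map_add' a b := by
    ext x
    simp [actionMap, Bivector.sharpForm]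
    abel
  map_smul' f a := by
    ext x
    simp [actionMap, Bivector.sharpForm]

/-- The bracket of one-forms `[α, β]_π = L_{π^♯(α)} β - L_{π^♯(β)} α - d(π(α, β))`. -/
def formBracket (P : Bivector E M) (α β : OneForm E M) : OneForm E M :=
  lieForm (P.sharpForm α) β - lieForm (P.sharpForm β) α - extd (P.eval α β)

/-- `br` is the bracket on `Γ(𝔤 ⊕ T^*M) = C^∞(M, 𝔤) × Ω¹(M)` given by the stated formulas on
constant maps to `𝔤` and on one-forms, and extended by bilinearity, skew-symmetry and the Leibniz
rule. -/
structure IsQuasiPoissonBracket (F : 𝔤 →ₗ[ℝ] (Module.Dual ℝ 𝔤) [⋀^Fin 2]→ₗ[ℝ] ℝ)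
    (χ : (Module.Dual ℝ 𝔤) [⋀^Fin 3]→ₗ[ℝ] ℝ)
    (ρ : 𝔤 →ₗ[ℝ] VField E M) (P : Bivector E M)
    (br : (SmoothMap E M 𝔤 × OneForm E M) →ₗ[ℝ] (SmoothMap E M 𝔤 × OneForm E M) →ₗ[ℝ]
      (SmoothMap E M 𝔤 × OneForm E M)) : Prop where
  skew : ∀ a, br a a = 0
  leibniz : ∀ a b (f : SmoothFun E M), br a (f • b) = f • br a b + lieFun (anchor ρ P a) f • b
  const_const : ∀ u v : 𝔤, br (constMap E M u, 0) (constMap E M v, 0) = (constMap E M ⁅u, v⁆, 0)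
  const_form_fst : ∀ (v : 𝔤) (α : OneForm E M) (x : M),
    (br (constMap E M v, 0) (0, α)).1.1 x = -contract₂ (F v) (pull ρ x (α x))
  const_form_snd : ∀ (v : 𝔤) (α : OneForm E M),
    (br (constMap E M v, 0) (0, α)).2 = lieForm (ρ v) α
  form_form_fst : ∀ (α β : OneForm E M) (x : M),
    (br (0, α) (0, β)).1.1 x = contract₃ χ (pull ρ x (α x)) (pull ρ x (β x))
  form_form_snd : ∀ α β : OneForm E M, (br (0, α) (0, β)).2 = formBracket P α β

/-- A Lie algebroid structure on a vector bundle over `M`, in terms of the `C^∞(M)`-module `Γ` of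
its sections: the anchor `r` is `C^∞(M)`-linear (that is, induced by a bundle map to `TM`), and the
`ℝ`-bilinear bracket is skew-symmetric and satisfies the Jacobi identity and the Leibniz rule.
(That the anchor intertwines the brackets is a consequence for the sections of a vector bundle of
positive rank.) -/
structure IsLieAlgebroid {Γ : Type*} [AddCommGroup Γ] [Module ℝ Γ] [Module (SmoothFun E M) Γ]
    (r : Γ →ₗ[SmoothFun E M] VField E M) (br : Γ →ₗ[ℝ] Γ →ₗ[ℝ] Γ) : Prop where
  skew : ∀ a, br a a = 0
  jacobi : ∀ a b c, br a (br b c) = br (br a b) c + br b (br a c)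
  leibniz : ∀ a b (f : SmoothFun E M), br a (f • b) = f • br a b + lieFun (r a) f • b

/-- The generalized distribution `x ↦ {ρ(v)_x + π^♯(a) | v ∈ 𝔤, a ∈ T_x^*M} ⊆ T_xM`. -/
def distribution (ρ : 𝔤 →ₗ[ℝ] VField E M) (P : Bivector E M) (x : M) :
    Submodule ℝ (TangentSpace 𝓘(ℝ, E) x) where
  carrier := {w | ∃ (v : 𝔤) (a : Cotangent E M x), w = ρ v x + P.sharp x a}
  zero_mem' := ⟨0, 0, by simp⟩
  add_mem' := by
    rintro _ _ ⟨u, a, rfl⟩ ⟨v, b, rfl⟩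
    exact ⟨u + v, a + b, by simp; abel⟩
  smul_mem' := by
    rintro c _ ⟨u, a, rfl⟩
    exact ⟨c • u, c • a, by simp⟩

/-- A generalized distribution (of possibly varying rank) is integrable if every point lies in an
integral manifold: a connected injectively immersed manifold `ι : N → M` whose tangent spaces are
`D` at each of its points. -/
def IsIntegrable (D : ∀ x : M, Submodule ℝ (TangentSpace 𝓘(ℝ, E) x)) : Prop :=
  ∀ x : M, ∃ (k : ℕ) (N : Type) (_ : TopologicalSpace N)
    (_ : ChartedSpace (EuclideanSpace ℝ (Fin k)) N) (ι : N → M),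
    IsManifold (𝓡 k) ∞ N ∧ T2Space N ∧ SecondCountableTopology N ∧ ConnectedSpace N ∧
    ContMDiff (𝓡 k) 𝓘(ℝ, E) ∞ ι ∧ Function.Injective ι ∧ x ∈ Set.range ι ∧
    ∀ y : N, Function.Injective (mfderiv (𝓡 k) 𝓘(ℝ, E) ι y) ∧
      LinearMap.range (mfderiv (𝓡 k) 𝓘(ℝ, E) ι y).toLinearMap = D (ι y)

end Main

end QuasiPoisson

end

open QuasiPoisson

noncomputable section

namespace QuasiPoisson

/-! ### Radial equations and the total differential equation Dh = X(h). -/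

section LocalIntegral

open Set Metric Filter Topology
open scoped NNReal

variable {E : Type*} [NormedAddCommGroup E] [NormedSpace ℝ E]
  {V : Type*} [NormedAddCommGroup V] [NormedSpace ℝ V]

/-! The bracket has an explicit formula. Send a section a = (v, α) to the map `toDouble` a = (v,
-ρ^*α) with values in the double 𝔡 = 𝔤 ⊕ 𝔤^*. The 𝔤-component of [a, b] is L_{r(a)} b₁ - L_{r(b)} a₁
plus the 𝔤-component of the pointwise bracket in 𝔡. The form component is the Koszul bracket of π
together with the action of 𝔤 by Lie derivatives, extended linearly over functions. Uniqueness
follows from the Leibniz rule and skewness, since constant maps and one-forms generate all sections.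

The link with quasi-Poisson geometry is the defect D(a, b) = r[a, b] - [r(a), r(b)]. It is tensorial
and skew, hence determined by its values on constants and exact forms. On two constants it vanishes
because ρ is an action; its values on (v, α) and on (df, dg) are the differences between the two
sides of the two quasi-Poisson equations (`pair_anchorDefect_const_form`,
`lieFun_anchorDefect_extd_extd`). So π is quasi-Poisson exactly when D = 0. The Jacobi identity
forces D = 0: comparing it for c and f c gives D(a, b)(f) c = 0, and c = df paired with D(a, b)
gives D(a, b)(f)² = 0.

Conversely, if D = 0 then the jacobiator is tensorial. Its 𝔤-component vanishes because a ↦ (r(a),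
`toDouble` a) preserves brackets into the semidirect product of vector fields with C^∞(M, 𝔡), where
Jacobi holds because 𝔡 is a Lie algebra (`toDouble_sectionBracketₗ`, `mapBracket_jacobi`). Its form
component is checked on constants and exact forms, where it amounts to a derivative of one of the
quasi-Poisson equations along an arbitrary vector field.

For integrability, D = 0 makes the distribution in a chart the range of a smooth R(z) : A → E whose
fields close under brackets with continuous structure functions. The rank may jump, so the frame is
split at the base point: fields X_u projecting to constants under a linear map p, and fields Y_a in
the kernel of p that vanish at the base point. Brackets of these fields lie in the range of R and in
ker p, hence in the span of Y. Therefore Y obeys a linear equation along the curves z' = X(z)u and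
stays zero there; where Y = 0 the X_u commute and span the distribution. The time-one map of these
radial curves solves Dh = X(h), so it parametrizes a leaf (`exists_isSplitFrame`,
`IsSplitFrame.exists_leaf`). -/

theorem exists_radial_solution [CompleteSpace E] {X : E → V →L[ℝ] E} {C K : ℝ≥0}
    (hC : ∀ z, ‖X z‖ ≤ C) (hK : LipschitzWith K X) (z₀ : E) (u : V) :
    ∃ z : ℝ → E, z 0 = z₀ ∧
      ∀ t ∈ Icc (0 : ℝ) 1, HasDerivWithinAt z (X (z t) u) (Icc 0 1) t := by
  -- Speed at most C‖u‖ over unit time moves a point by at most C‖u‖, so the ball of exactly that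
  -- radius meets the Picard–Lindelöf condition up to time 1.
  have h : IsPicardLindelof (fun _ : ℝ => fun z => X z u) (tmin := 0) (tmax := 1)
      ⟨0, by simp⟩ z₀ (C * ‖u‖₊) 0 (C * ‖u‖₊) (K * ‖u‖₊) := by
    refine ⟨fun t _ => ?_, fun _ _ => continuousOn_const, fun t _ z _ => ?_, by simp⟩
    · refine (LipschitzWith.of_dist_le_mul fun a b => ?_).lipschitzOnWith
      rw [dist_eq_norm, ← sub_apply]
      refine (ContinuousLinearMap.le_opNorm _ _).trans ?_
      have := hK.dist_le_mul a b
      rw [dist_eq_norm] at this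
      calc _ ≤ (K * dist a b) * ‖u‖ := by gcongr
        _ = _ := by push_cast; ring
    · refine (ContinuousLinearMap.le_opNorm _ _).trans ?_
      push_cast
      gcongr
      exact hC z
  exact h.exists_eq_forall_mem_Icc_hasDerivWithinAt₀

/-- The Grönwall estimates are formulated with right derivatives on the half-open interval. -/
theorem hasDerivWithinAt_Ici {z z' : ℝ → E}
    (h : ∀ t ∈ Icc (0 : ℝ) 1, HasDerivWithinAt z (z' t) (Icc 0 1) t) :
    ∀ t ∈ Ico (0 : ℝ) 1, HasDerivWithinAt z (z' t) (Ici t) t := fun t ht =>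
  (h t (Ico_subset_Icc_self ht)).mono_of_mem_nhdsWithin
    (mem_of_superset (Icc_mem_nhdsGE ht.2) (Icc_subset_Icc_left ht.1))

theorem dist_radial_solution_le {X : E → V →L[ℝ] E} {C : ℝ} (hC : ∀ z, ‖X z‖ ≤ C)
    {u : V} {z : ℝ → E}
    (hz : ∀ t ∈ Icc (0 : ℝ) 1, HasDerivWithinAt z (X (z t) u) (Icc 0 1) t)
    {t : ℝ} (ht : t ∈ Icc (0 : ℝ) 1) : dist (z t) (z 0) ≤ C * ‖u‖ := by
  have h := (convex_Icc (0 : ℝ) 1).norm_image_sub_le_of_norm_hasDerivWithin_le hz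
    (fun t _ => ((X (z t)).le_opNorm u).trans
      (mul_le_mul_of_nonneg_right (hC (z t)) (norm_nonneg u))) (left_mem_Icc.2 zero_le_one) ht
  rw [dist_eq_norm]
  refine h.trans ?_
  rw [sub_zero, Real.norm_of_nonneg ht.1]
  exact mul_le_of_le_one_right (mul_nonneg (le_trans (norm_nonneg (X 0)) (hC 0)) (norm_nonneg _)) ht.2

/-- The time-one map of the radial equation `z' = X(z) u` solves `Dh = X(h)` at `u` if the
mixed derivatives are symmetric along the solution with direction `u`. -/
theorem hasFDerivAt_radial {X : E → V →L[ℝ] E} (hX : Differentiable ℝ X)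
    {C K L : ℝ} (hC : ∀ z, ‖X z‖ ≤ C) (hK : ∀ z, ‖fderiv ℝ X z‖ ≤ K)
    (hL : ∀ a b, ‖fderiv ℝ X a - fderiv ℝ X b‖ ≤ L * ‖a - b‖) {z₀ : E} {z : V → ℝ → E}
    (hz0 : ∀ u, z u 0 = z₀)
    (hz : ∀ u, ∀ t ∈ Icc (0 : ℝ) 1, HasDerivWithinAt (z u) (X (z u t) u) (Icc 0 1) t)
    {u : V} (hflat : ∀ t ∈ Icc (0 : ℝ) 1, ∀ d, fderiv ℝ X (z u t) (X (z u t) u) d =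
      fderiv ℝ X (z u t) (X (z u t) d) u) :
    HasFDerivAt (fun u => z u 1) (X (z u 1)) u := by
  have hC0 : 0 ≤ C := (norm_nonneg _).trans (hC 0)
  have hK0 : 0 ≤ K := le_trans (norm_nonneg (fderiv ℝ X 0)) (hK 0)
  have hXL : ∀ a b, ‖X a - X b‖ ≤ K * ‖a - b‖ := fun a b =>
    convex_univ.norm_image_sub_le_of_norm_fderiv_le (fun x _ => hX x)
      (fun x _ => hK x) (mem_univ b) (mem_univ a)
  -- Second-order Taylor estimate. The absolute value is needed because `hL` does not determine the
  -- sign of L when E is a point.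
  have hT : ∀ a k, ‖X (a + k) - X a - fderiv ℝ X a k‖ ≤ |L| * ‖k‖ ^ 2 := fun a k => by
    have := (convex_segment a (a + k)).norm_image_sub_le_of_norm_hasFDerivWithin_le'
      (f := X) (f' := fderiv ℝ X) (φ := fderiv ℝ X a) (C := |L| * ‖k‖) (x := a) (y := a + k)
      (fun x _ => (hX x).hasFDerivAt.hasFDerivWithinAt) (fun x hx => ?_)
      (left_mem_segment ..) (right_mem_segment ..)
    · simpa [pow_two, mul_assoc] using this
    · refine (hL _ _).trans (mul_le_mul (le_abs_self L) ?_ (norm_nonneg _) (abs_nonneg _))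
      rw [segment_eq_image'] at hx
      obtain ⟨θ, hθ, rfl⟩ := hx
      simp only [add_sub_cancel_left, norm_smul, Real.norm_of_nonneg hθ.1]
      exact mul_le_of_le_one_left (norm_nonneg _) hθ.2
  -- The extra 1 keeps the Lipschitz constant nonzero, which selects the exponential branch of
  -- `gronwallBound`.
  set K' : ℝ≥0 := ⟨K * (‖u‖ + 1) + 1, by positivity⟩
  have hK' : (K' : ℝ) = K * (‖u‖ + 1) + 1 := rfl
  have hK'pos : (K' : ℝ) ≠ 0 := by rw [hK']; positivity
  set B : ℝ := |L| * C ^ 2 * (‖u‖ + 1) + K * C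
  have key : ∀ d : V, ‖d‖ ≤ 1 → ‖z (u + d) 1 - z u 1 - X (z u 1) d‖ ≤
      B * ((Real.exp K' - 1) / K') * ‖d‖ ^ 2 := fun d hd => by
    have hud : ‖u + d‖ ≤ ‖u‖ + 1 := (norm_add_le _ _).trans (by gcongr)
    -- The curve z_u + t X(z_u) d is the expected first variation; it is compared with the exact
    -- solution in direction u + d.
    have hy : ∀ t ∈ Icc (0 : ℝ) 1, HasDerivWithinAt (fun t => z u t + t • X (z u t) d)
        (X (z u t) u + (t • fderiv ℝ X (z u t) (X (z u t) u) d + (1 : ℝ) • X (z u t) d))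
        (Icc 0 1) t := fun t ht => by
      have h1 := hz u t ht
      have h2 := ((hX (z u t)).hasFDerivAt.comp_hasDerivWithinAt t h1)
      have h3 := h2.clm_apply (hasDerivWithinAt_const t (Icc 0 1) d)
      simp only [map_zero, add_zero, Function.comp_apply] at h3
      exact h1.add ((hasDerivWithinAt_id t _).smul h3)
    have := dist_le_of_approx_trajectories_ODE (v := fun _ a => X a (u + d)) (K := K')
      (a := 0) (b := 1) (εf := B * ‖d‖ ^ 2) (εg := 0) (δ := 0)
      (fun _ => LipschitzWith.of_dist_le_mul fun a b => ?_)
      (fun t ht => (hy t ht).continuousWithinAt) (hasDerivWithinAt_Ici hy) ?_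
      (fun t ht => (hz (u + d) t ht).continuousWithinAt) (hasDerivWithinAt_Ici (hz (u + d)))
      (by simp) (by simp [hz0]) 1 (by simp)
    · rw [gronwallBound_of_K_ne_0 hK'pos, dist_comm, dist_eq_norm] at this
      simp only [one_smul, sub_zero, mul_one, add_zero, zero_mul, zero_add] at this
      rw [sub_sub]
      refine this.trans (le_of_eq ?_)
      ring
    · rw [dist_eq_norm, ← sub_apply, dist_eq_norm]
      refine (ContinuousLinearMap.le_opNorm _ _).trans ?_
      calc _ ≤ (K * ‖a - b‖) * (‖u‖ + 1) := by gcongr; exact hXL a b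
        _ ≤ K' * ‖a - b‖ := by rw [hK']; nlinarith [norm_nonneg (a - b)]
    · intro t ht
      have ht' := Ico_subset_Icc_self ht
      -- Symmetry replaces DX(Xu)d by DX(Xd)u, which cancels the term of first order in d. What
      -- remains is a Taylor remainder and t DX(Xd)d, both O(‖d‖²).
      have e : X (z u t + t • X (z u t) d) (u + d) - (X (z u t) u +
          (t • fderiv ℝ X (z u t) (X (z u t) u) d + (1 : ℝ) • X (z u t) d)) =
          (X (z u t + t • X (z u t) d) - X (z u t) - fderiv ℝ X (z u t) (t • X (z u t) d)) (u + d)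
          + t • fderiv ℝ X (z u t) (X (z u t) d) d := by
        rw [hflat t ht' d]
        simp only [sub_apply, map_add, map_smul,
          smul_apply, one_smul]
        abel
      rw [dist_comm, dist_eq_norm, e]
      have ht1 : ‖t‖ ≤ 1 := by rw [Real.norm_of_nonneg ht.1]; exact ht.2.le
      have hXd : ‖X (z u t) d‖ ≤ C * ‖d‖ :=
        ((X (z u t)).le_opNorm d).trans (by gcongr; exact hC _)
      have htX : ‖t • X (z u t) d‖ ≤ C * ‖d‖ := by
        rw [norm_smul]
        exact (mul_le_of_le_one_left (norm_nonneg _) ht1).trans hXd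
      have h1 : ‖(X (z u t + t • X (z u t) d) - X (z u t) -
          fderiv ℝ X (z u t) (t • X (z u t) d)) (u + d)‖ ≤ |L| * (C * ‖d‖) ^ 2 * (‖u‖ + 1) := by
        refine (ContinuousLinearMap.le_opNorm _ _).trans ?_
        gcongr
        exact (hT _ _).trans (by gcongr)
      have h2 : ‖t • fderiv ℝ X (z u t) (X (z u t) d) d‖ ≤ K * (C * ‖d‖) * ‖d‖ := by
        rw [norm_smul]
        refine (mul_le_of_le_one_left (norm_nonneg _) ht1).trans ?_
        refine (ContinuousLinearMap.le_opNorm _ _).trans ?_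
        gcongr
        refine (ContinuousLinearMap.le_opNorm _ _).trans ?_
        gcongr
        exact hK _
      refine (norm_add_le _ _).trans ((add_le_add h1 h2).trans (le_of_eq ?_))
      simp only [B]; ring
  rw [hasFDerivAt_iff_isLittleO_nhds_zero]
  have hO : (fun d => z (u + d) 1 - z u 1 - X (z u 1) d) =O[𝓝 0] fun d : V => ‖d‖ ^ 2 := by
    refine Asymptotics.IsBigO.of_bound (B * ((Real.exp K' - 1) / K')) ?_
    filter_upwards [closedBall_mem_nhds (0 : V) one_pos] with d hd
    simpa using key d (by simpa using hd)
  refine hO.trans_isLittleO ?_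
  exact Asymptotics.isLittleO_norm_pow_id one_lt_two

/-- A solution of `Dh = X(h)` with smooth right-hand side is smooth. -/
theorem contDiffOn_of_hasFDerivAt {X : E → V →L[ℝ] E} (hX : ContDiff ℝ ∞ X) {U : Set V}
    (hU : IsOpen U) {h : V → E} (hh : ∀ u ∈ U, HasFDerivAt h (X (h u)) u) :
    ContDiffOn ℝ ∞ h U := by
  rw [contDiffOn_infty]
  intro n
  -- Bootstrap: if h is C^n then so is Dh = X ∘ h, hence h is C^(n+1).
  induction n with
  | zero => exact contDiffOn_zero.2 fun u hu => (hh u hu).continuousAt.continuousWithinAt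
  | succ n ih =>
    push_cast
    rw [contDiffOn_succ_iff_fderiv_of_isOpen hU]
    refine ⟨fun u hu => (hh u hu).differentiableAt.differentiableWithinAt, by simp, ?_⟩
    have h1 : ContDiffOn ℝ n (fun u => X (h u)) U :=
      (hX.of_le (by exact_mod_cast le_top)).comp_contDiffOn ih
    exact h1.congr fun u hu => (hh u hu).fderiv

end LocalIntegral

/-! ### Splitting an involutive family of varying rank, and its local leaf. -/

section LocalLeaf

open Set Metric Filter Topology
open scoped NNReal

variable {E : Type*} [NormedAddCommGroup E] [NormedSpace ℝ E]
  {V : Type*} [NormedAddCommGroup V] [NormedSpace ℝ V]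
  {A : Type*} [NormedAddCommGroup A] [NormedSpace ℝ A]

/-- A locally finitely generated involutive family `R`, in a form adapted to a splitting: the
fields `X v` are sections of a linear map `p`, the fields `Y a` are in the kernel of `p`, and both
commute modulo the span of the `Y a`. -/
structure IsSplitFrame (N : Set E) (R : E → A →L[ℝ] E) (p : E →L[ℝ] V) (X : E → V →L[ℝ] E)
    (Y : E → A →L[ℝ] E) (e : E → V →L[ℝ] A →L[ℝ] A) : Prop where
  smooth_X : ContDiffOn ℝ ∞ X N
  smooth_Y : ContDiffOn ℝ ∞ Y N
  continuous_e : ContinuousOn e N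
  proj_X : ∀ z ∈ N, ∀ v, p (X z v) = v
  comm_X : ∀ z ∈ N, Y z = 0 → ∀ u v, fderiv ℝ X z (X z u) v = fderiv ℝ X z (X z v) u
  comm_Y : ∀ z ∈ N, ∀ u a, fderiv ℝ Y z (X z u) a = fderiv ℝ X z (Y z a) u + Y z (e z u a)
  range_X : ∀ z ∈ N, Y z = 0 → LinearMap.range (X z).toLinearMap = LinearMap.range (R z).toLinearMap

theorem fderiv_clm_comp_apply {F : Type*} [NormedAddCommGroup F] [NormedSpace ℝ F]
    {R : E → A →L[ℝ] F} {σ : E → V →L[ℝ] A} {z : E} (hR : DifferentiableAt ℝ R z)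
    (hσ : DifferentiableAt ℝ σ z) (w : E) (v : V) :
    fderiv ℝ (fun z => R z ∘L σ z) z w v = fderiv ℝ R z w (σ z v) + R z (fderiv ℝ σ z w v) := by
  rw [(hR.hasFDerivAt.clm_comp hσ.hasFDerivAt).fderiv]
  simp [add_comm]

/-- Applied to X and Y, whose projections under p are constant: their derivatives, and so their
brackets, lie in ker p. -/
theorem clm_fderiv_apply_eq_zero {F G : Type*} [NormedAddCommGroup F] [NormedSpace ℝ F]
    [NormedAddCommGroup G] [NormedSpace ℝ G] {p : F →L[ℝ] G} {X : E → V →L[ℝ] F} {z : E}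
    (hX : DifferentiableAt ℝ X z) {L : V →L[ℝ] G} (h : ∀ᶠ y in 𝓝 z, p ∘L X y = L) (w : E)
    (v : V) : p (fderiv ℝ X z w v) = 0 := by
  have h1 : HasFDerivAt (fun y => p (X y v)) (p ∘L (fderiv ℝ X z).flip v) z :=
    p.hasFDerivAt.comp z ((ContinuousLinearMap.apply ℝ F v).hasFDerivAt.comp z hX.hasFDerivAt)
  have h2 : HasFDerivAt (fun y => p (X y v)) (0 : E →L[ℝ] G) z :=
    (hasFDerivAt_const (L v) z).congr_of_eventuallyEq
      (by filter_upwards [h] with y hy using DFunLike.congr_fun hy v)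
  exact DFunLike.congr_fun (h1.unique h2) w

omit [NormedSpace ℝ E] in
theorem continuousOn_clm_flip {F G H : Type*} [NormedAddCommGroup F] [NormedSpace ℝ F]
    [NormedAddCommGroup G] [NormedSpace ℝ G] [NormedAddCommGroup H] [NormedSpace ℝ H]
    {f : E → F →L[ℝ] G →L[ℝ] H} {N : Set E} (hf : ContinuousOn f N) :
    ContinuousOn (fun z => (f z).flip) N :=
  (ContinuousLinearMap.flipₗᵢ ℝ F G H).continuous.comp_continuousOn hf

set_option synthInstance.maxHeartbeats 200000 in
/-- The splitting of an involutive family by a section `s` and a projection `p` onto its span at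
the base point. -/
theorem exists_isSplitFrame [CompleteSpace V]
    {U : Set E} (hU : IsOpen U) {z₀ : E} (hz₀ : z₀ ∈ U) {R : E → A →L[ℝ] E}
    (hR : ContDiffOn ℝ ∞ R U) {c : E → A →L[ℝ] A →L[ℝ] A} (hc : ContinuousOn c U)
    (hRc : ∀ z ∈ U, ∀ a b, fderiv ℝ R z (R z a) b - fderiv ℝ R z (R z b) a = R z (c z a b))
    {s : V →L[ℝ] A} {p : E →L[ℝ] V} (hps : ∀ v, p (R z₀ (s v)) = v)
    (hsp : ∀ a, R z₀ (s (p (R z₀ a))) = R z₀ a) :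
    ∃ (N : Set E) (X : E → V →L[ℝ] E)
      (Y : E → A →L[ℝ] E) (e : E → V →L[ℝ] A →L[ℝ] A),
      IsOpen N ∧ z₀ ∈ N ∧ N ⊆ U ∧ Y z₀ = 0 ∧ IsSplitFrame N R p X Y e := by
  -- This is the identity at the base point, so it is invertible on a neighbourhood, and its inverse
  -- normalizes s to give p ∘ X = id there.
  let G : E → V →L[ℝ] V := fun z => p ∘L R z ∘L s
  have hG : ContDiffOn ℝ ∞ G U := contDiffOn_const.clm_comp (hR.clm_comp contDiffOn_const)
  have hG0 : G z₀ = 1 := by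
    ext v
    simp [G, hps]
  let N : Set E := U ∩ G ⁻¹' {g | IsUnit g}
  have hN : IsOpen N := hG.continuousOn.isOpen_inter_preimage hU
    (Units.isOpen (R := V →L[ℝ] V))
  have hNU : N ⊆ U := inter_subset_left
  let σ : E → V →L[ℝ] A := fun z => s ∘L Ring.inverse (G z)
  have hσ : ContDiffOn ℝ ∞ σ N := by
    refine contDiffOn_const.clm_comp fun z hz => ?_
    obtain ⟨g, hg⟩ : IsUnit (G z) := hz.2
    have h1 : ContDiffAt ℝ ∞ Ring.inverse (G z) := hg ▸ contDiffAt_ringInverse (R := V →L[ℝ] V) ℝ g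
    exact h1.comp_contDiffWithinAt z ((hG z hz.1).mono hNU)
  have hRN := hR.mono hNU
  let X : E → V →L[ℝ] E := fun z => R z ∘L σ z
  have hX : ContDiffOn ℝ ∞ X N := hRN.clm_comp hσ
  let τ : E → A →L[ℝ] A := fun z => ContinuousLinearMap.id ℝ A - σ z ∘L p ∘L R z
  have hτ : ContDiffOn ℝ ∞ τ N :=
    contDiffOn_const.sub (hσ.clm_comp (contDiffOn_const.clm_comp hRN))
  let Y : E → A →L[ℝ] E := fun z => R z ∘L τ z
  have hY : ContDiffOn ℝ ∞ Y N := hRN.clm_comp hτ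
  have hpX : ∀ z ∈ N, p ∘L X z = ContinuousLinearMap.id ℝ V := fun z hz =>
    Ring.mul_inverse_cancel (G z) hz.2
  have hpX' : ∀ z ∈ N, ∀ v, p (X z v) = v := fun z hz v => DFunLike.congr_fun (hpX z hz) v
  have hYR : ∀ z a, Y z a = R z a - X z (p (R z a)) := fun z a => by simp [Y, τ, X]
  have hpY : ∀ z ∈ N, p ∘L Y z = 0 := fun z hz => by
    ext1 a
    simp [hYR, hpX' z hz]
  have hd : ∀ z ∈ N, DifferentiableAt ℝ R z ∧ DifferentiableAt ℝ σ z ∧ DifferentiableAt ℝ τ z ∧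
      DifferentiableAt ℝ X z ∧ DifferentiableAt ℝ Y z := fun z hz => by
    have hz' := hN.mem_nhds hz
    refine ⟨?_, ?_, ?_, ?_, ?_⟩
    exacts [(hRN.contDiffAt hz').differentiableAt (by simp),
      (hσ.contDiffAt hz').differentiableAt (by simp),
      (hτ.contDiffAt hz').differentiableAt (by simp),
      (hX.contDiffAt hz').differentiableAt (by simp),
      (hY.contDiffAt hz').differentiableAt (by simp)]
  have hDX : ∀ z ∈ N, ∀ w v, fderiv ℝ X z w v = fderiv ℝ R z w (σ z v) + R z (fderiv ℝ σ z w v) :=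
    fun z hz => fderiv_clm_comp_apply (hd z hz).1 (hd z hz).2.1
  have hDY : ∀ z ∈ N, ∀ w a, fderiv ℝ Y z w a = fderiv ℝ R z w (τ z a) + R z (fderiv ℝ τ z w a) :=
    fun z hz => fderiv_clm_comp_apply (hd z hz).1 (hd z hz).2.2.1
  have hpDX : ∀ z ∈ N, ∀ w v, p (fderiv ℝ X z w v) = 0 := fun z hz =>
    clm_fderiv_apply_eq_zero (hd z hz).2.2.2.1 (mem_of_superset (hN.mem_nhds hz) hpX)
  have hpDY : ∀ z ∈ N, ∀ w v, p (fderiv ℝ Y z w v) = 0 := fun z hz =>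
    clm_fderiv_apply_eq_zero (hd z hz).2.2.2.2 (mem_of_superset (hN.mem_nhds hz) hpY)
  -- A vector in the range of R killed by p equals the corresponding Y. Applied to brackets, this
  -- puts them in the span of Y, whence `comm_X` and `comm_Y`.
  have hRY : ∀ z a, p (R z a) = 0 → R z a = Y z a := fun z a h => by simp [hYR, h]
  have hRc' : ∀ z ∈ N, ∀ a b, fderiv ℝ R z (R z a) b = fderiv ℝ R z (R z b) a + R z (c z a b) :=
    fun z hz a b => by rw [← hRc z hz.1]; abel
  -- With X = R ∘ σ and Y = R ∘ τ, the product rule writes DY(Xu)a - DX(Ya)u as R applied to c(σu,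
  -- τa) + Dτ(Xu)a - Dσ(Ya)u. This argument of R is the coefficient e(u)a.
  refine ⟨N, X, Y, fun z => ((c z ∘L σ z).flip ∘L τ z).flip + (fderiv ℝ τ z ∘L X z)
    - (fderiv ℝ σ z ∘L Y z).flip, hN, ⟨hz₀, ?_⟩, hNU, ?_, hX, hY, ?_, hpX', ?_, ?_, ?_⟩
  · simp [hG0]
  · ext a
    have h1 : ∀ v, X z₀ v = R z₀ (s v) := fun v => by simp [X, σ, hG0]
    rw [hYR, h1, hsp, sub_self, zero_apply]
  · have h1 := hτ.continuousOn_fderiv_of_isOpen hN (by simp)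
    have h2 := hσ.continuousOn_fderiv_of_isOpen hN (by simp)
    have h3 := hc.mono hNU
    have h4 := hτ.continuousOn
    have h5 := hσ.continuousOn
    have h6 := continuousOn_clm_flip ((continuousOn_clm_flip (h3.clm_comp h5)).clm_comp h4)
    exact (h6.add (h1.clm_comp hX.continuousOn)).sub
      (continuousOn_clm_flip (h2.clm_comp hY.continuousOn))
  · intro z hz hYz u v
    have h1 : fderiv ℝ X z (X z u) v - fderiv ℝ X z (X z v) u =
        R z (c z (σ z u) (σ z v) + fderiv ℝ σ z (X z u) v - fderiv ℝ σ z (X z v) u) := by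
      rw [hDX z hz, hDX z hz, map_sub, map_add]
      have := hRc' z hz (σ z u) (σ z v)
      simp only [X, ContinuousLinearMap.comp_apply] at this ⊢
      rw [this]
      abel
    have h2 := congrArg p h1
    rw [map_sub, hpDX z hz, hpDX z hz, sub_zero] at h2
    rw [← sub_eq_zero, h1, hRY z _ h2.symm, hYz, zero_apply]
  · intro z hz u a
    have h1 : fderiv ℝ Y z (X z u) a - fderiv ℝ X z (Y z a) u =
        R z (c z (σ z u) (τ z a) + fderiv ℝ τ z (X z u) a - fderiv ℝ σ z (Y z a) u) := by
      rw [hDX z hz, hDY z hz, map_sub, map_add]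
      have := hRc' z hz (σ z u) (τ z a)
      simp only [X, Y, ContinuousLinearMap.comp_apply] at this ⊢
      rw [this]
      abel
    have h2 := congrArg p h1
    rw [map_sub, hpDX z hz, hpDY z hz, sub_zero] at h2
    rw [← sub_eq_iff_eq_add', h1, hRY z _ h2.symm]
    simp
  · intro z hz hYz
    refine le_antisymm ?_ ?_
    · rintro _ ⟨v, rfl⟩
      exact ⟨σ z v, rfl⟩
    · rintro _ ⟨a, rfl⟩
      refine ⟨p (R z a), ?_⟩
      have := hYR z a
      rw [hYz, zero_apply] at this
      exact (sub_eq_zero.1 this.symm).symm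

theorem exists_bounds_of_hasCompactSupport {F : Type*} [NormedAddCommGroup F] [NormedSpace ℝ F]
    {f : E → F} (hf : ContDiff ℝ ∞ f) (hcs : HasCompactSupport f) :
    ∃ C K L : ℝ, Differentiable ℝ f ∧ (∀ z, ‖f z‖ ≤ C) ∧ (∀ z, ‖fderiv ℝ f z‖ ≤ K) ∧
      ∀ a b, ‖fderiv ℝ f a - fderiv ℝ f b‖ ≤ L * ‖a - b‖ := by
  obtain ⟨C, hC⟩ := hf.continuous.bounded_above_of_compact_support hcs
  have hd : ContDiff ℝ ∞ (fderiv ℝ f) := hf.fderiv_right (by simp)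
  obtain ⟨K, hK⟩ := hd.continuous.bounded_above_of_compact_support (hcs.fderiv ℝ)
  obtain ⟨L, hL⟩ := (hd.continuous_fderiv (by simp)).bounded_above_of_compact_support
    ((hcs.fderiv ℝ).fderiv ℝ)
  exact ⟨C, K, L, hf.differentiable (by simp), hC, hK, fun a b =>
    convex_univ.norm_image_sub_le_of_norm_fderiv_le
      (fun x _ => hd.differentiable (by simp) x) (fun x _ => hL x) (mem_univ b) (mem_univ a)⟩

/-- The leaf of a split frame through a common zero of the fields `Y a`. -/
theorem IsSplitFrame.exists_leaf [FiniteDimensional ℝ E] {N : Set E} {R : E → A →L[ℝ] E}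
    {p : E →L[ℝ] V} {X : E → V →L[ℝ] E} {Y : E → A →L[ℝ] E} {e : E → V →L[ℝ] A →L[ℝ] A}
    (h : IsSplitFrame N R p X Y e) (hN : IsOpen N) {z₀ : E} (hz₀ : z₀ ∈ N) (hY₀ : Y z₀ = 0) :
    ∃ r > 0, ∃ f : V → E, f 0 = z₀ ∧ ContDiffOn ℝ ∞ f (ball 0 r) ∧ InjOn f (ball 0 r) ∧
      ∀ v ∈ ball (0 : V) r, f v ∈ N ∧ ∃ L : V →L[ℝ] E, HasFDerivAt f L v ∧
        Function.Injective L ∧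
        LinearMap.range L.toLinearMap = LinearMap.range (R (f v)).toLinearMap := by
  have : CompleteSpace E := FiniteDimensional.complete ℝ E
  obtain ⟨ρ, hρ, hρN⟩ := nhds_basis_closedBall.mem_iff.1 (hN.mem_nhds hz₀)
  -- Cutting X off makes it bounded with bounded derivatives, so the radial solutions exist up to
  -- time 1; X is unchanged on the ball of radius ρ / 2.
  let χ : ContDiffBump z₀ := ⟨ρ / 2, ρ, by positivity, by linarith⟩
  let X' : E → V →L[ℝ] E := fun z => χ z • X z
  have hXX' : ∀ z ∈ ball z₀ (ρ / 2), X' =ᶠ[𝓝 z] X := fun z hz => by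
    filter_upwards [isOpen_ball.mem_nhds hz] with y hy
    simp [X', χ.one_of_mem_closedBall (ball_subset_closedBall hy)]
  have hX' : ContDiff ℝ ∞ X' := by
    rw [contDiff_iff_contDiffAt]
    intro z
    by_cases hz : z ∈ closedBall z₀ ρ
    · exact χ.contDiffAt.smul (h.smooth_X.contDiffAt (hN.mem_nhds (hρN hz)))
    · refine (contDiffAt_const (c := (0 : V →L[ℝ] E))).congr_of_eventuallyEq ?_
      filter_upwards [isClosed_closedBall.isOpen_compl.mem_nhds hz] with y hy
      have : χ y = 0 := χ.zero_of_le_dist (not_le.1 (fun h' => hy h')).le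
      simp [X', this]
  have hcs : HasCompactSupport X' := χ.hasCompactSupport.smul_right
  obtain ⟨C, K, L, hX'diff, hC, hK, hL'⟩ := exists_bounds_of_hasCompactSupport hX' hcs
  have hC0 : 0 ≤ C := le_trans (norm_nonneg (X' 0)) (hC 0)
  have hK0 : 0 ≤ K := le_trans (norm_nonneg (fderiv ℝ X' 0)) (hK 0)
  have hKL : LipschitzWith ⟨K, hK0⟩ X' :=
    lipschitzWith_of_nnnorm_fderiv_le hX'diff fun z => hK z
  choose z hz0 hz using fun u : V => exists_radial_solution (C := ⟨C, hC0⟩) hC hKL z₀ u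
  obtain ⟨r, hr, hrC⟩ : ∃ r > 0, C * r < ρ / 2 := by
    -- With ‖u‖ < r the displacement up to time 1 stays below ρ / 2, so the cutoff is never felt; C
    -- + 1 avoids dividing by zero.
    refine ⟨ρ / 2 / (C + 1), by positivity, ?_⟩
    rw [mul_div_assoc', div_lt_iff₀ (by positivity)]
    nlinarith
  have hzb : ∀ u ∈ ball (0 : V) r, ∀ t ∈ Icc (0 : ℝ) 1, z u t ∈ ball z₀ (ρ / 2) := fun u hu t ht => by
    rw [mem_ball, ← hz0 u]
    refine (dist_radial_solution_le hC (hz u) ht).trans_lt (lt_of_le_of_lt ?_ hrC)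
    gcongr
    exact (mem_ball_zero_iff.1 hu).le
  have hbN : ball z₀ (ρ / 2) ⊆ N :=
    (ball_subset_closedBall.trans (closedBall_subset_closedBall (by linarith))).trans hρN
  have hYz : ∀ u ∈ ball (0 : V) r, ∀ t ∈ Icc (0 : ℝ) 1, Y (z u t) = 0 := fun u hu => by
    have hcont : ContinuousOn (z u) (Icc 0 1) := fun t ht => (hz u t ht).continuousWithinAt
    have hmaps : MapsTo (z u) (Icc 0 1) N := fun t ht => hbN (hzb u hu t ht)
    have h1 : ContinuousOn (fun t => e (z u t) u) (Icc 0 1) :=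
      (h.continuous_e.comp hcont hmaps).clm_apply continuousOn_const
    obtain ⟨D, hD⟩ := isCompact_Icc.exists_bound_of_continuousOn h1
    have hder : ∀ t ∈ Icc (0 : ℝ) 1, HasDerivWithinAt (fun t => Y (z u t))
        (fderiv ℝ Y (z u t) (X (z u t) u)) (Icc 0 1) t := fun t ht => by
      have h2 := ((h.smooth_Y.contDiffAt (hN.mem_nhds (hmaps ht))).differentiableAt
        (by simp)).hasFDerivAt
      have h3 := hz u t ht
      rw [(hXX' _ (hzb u hu t ht)).eq_of_nhds] at h3
      exact h2.comp_hasDerivWithinAt t h3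
    -- By `comm_Y` the derivative of Y along the curve is linear in Y, with coefficient bounded by
    -- K‖u‖ + D. Grönwall and Y(z₀) = 0 give Y = 0 along the whole curve.
    refine eq_zero_of_abs_deriv_le_mul_abs_self_of_eq_zero_right (K := K * ‖u‖ + D)
      (fun t ht => (hder t ht).continuousWithinAt) (hasDerivWithinAt_Ici hder)
      (by simp [hz0, hY₀]) ?_
    intro t ht
    have ht' := Ico_subset_Icc_self ht
    have hD0 : 0 ≤ D := (norm_nonneg _).trans (hD t ht')
    refine ContinuousLinearMap.opNorm_le_bound _ (by positivity) fun a => ?_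
    rw [h.comm_Y _ (hmaps ht'), ← (hXX' _ (hzb u hu t ht')).fderiv_eq]
    have h4 : ‖fderiv ℝ X' (z u t) (Y (z u t) a) u‖ ≤ K * (‖Y (z u t)‖ * ‖a‖) * ‖u‖ := by
      refine (ContinuousLinearMap.le_opNorm _ _).trans ?_
      gcongr
      refine (ContinuousLinearMap.le_opNorm _ _).trans ?_
      gcongr
      · exact hK _
      · exact ContinuousLinearMap.le_opNorm _ _
    have h5 : ‖Y (z u t) (e (z u t) u a)‖ ≤ ‖Y (z u t)‖ * (D * ‖a‖) := by
      refine (ContinuousLinearMap.le_opNorm _ _).trans ?_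
      gcongr
      refine (ContinuousLinearMap.le_opNorm _ _).trans ?_
      gcongr
      exact hD t ht'
    refine (norm_add_le _ _).trans ((add_le_add h4 h5).trans (le_of_eq ?_))
    ring
  have h1mem : (1 : ℝ) ∈ Icc (0 : ℝ) 1 := right_mem_Icc.2 zero_le_one
  have hder' : ∀ u ∈ ball (0 : V) r, HasFDerivAt (fun u => z u 1) (X' (z u 1)) u := fun u hu => by
    refine hasFDerivAt_radial hX'diff hC hK hL' hz0 hz fun t ht d => ?_
    have hb := hzb u hu t ht
    rw [(hXX' _ hb).fderiv_eq, (hXX' _ hb).eq_of_nhds]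
    exact h.comm_X _ (hbN hb) (hYz u hu t ht) u d
  have hder : ∀ u ∈ ball (0 : V) r, HasFDerivAt (fun u => z u 1) (X (z u 1)) u := fun u hu => by
    rw [← (hXX' _ (hzb u hu 1 h1mem)).eq_of_nhds]
    exact hder' u hu
  -- Since p ∘ X = id, the map u ↦ p(f(u)) - u has zero derivative and is constant on the ball, so f
  -- is injective.
  have hp1 : ∀ u ∈ ball (0 : V) r, HasFDerivAt (fun u => p (z u 1) - u) 0 u := fun u hu => by
    have h2 := (p.hasFDerivAt.comp u (hder u hu)).sub (hasFDerivAt_id u)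
    refine HasFDerivAt.congr_fderiv (f' := p ∘L X (z u 1) - ContinuousLinearMap.id ℝ V) h2 ?_
    refine ContinuousLinearMap.ext fun v => ?_
    exact sub_eq_zero.2 (h.proj_X _ (hbN (hzb u hu 1 h1mem)) v)
  refine ⟨r, hr, fun u => z u 1, ?_, contDiffOn_of_hasFDerivAt hX' isOpen_ball hder', ?_, ?_⟩
  · have := dist_radial_solution_le hC (hz 0) h1mem
    rw [norm_zero, mul_zero, hz0] at this
    exact dist_le_zero.1 this
  · intro u hu v hv huv
    have h3 : p (z u 1) - u = p (z v 1) - v := (convex_ball (0 : V) r).is_const_of_fderivWithin_eq_zero (𝕜 := ℝ)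
      (f := fun u => p (z u 1) - u)
      (fun w hw => (hp1 w hw).differentiableAt.differentiableWithinAt)
      (fun w hw => ((hp1 w hw).hasFDerivWithinAt).fderivWithin (isOpen_ball.uniqueDiffWithinAt hw))
      hu hv
    have huv' : z u 1 = z v 1 := huv
    rw [huv'] at h3
    exact sub_right_injective h3
  · intro u hu
    have hb := hbN (hzb u hu 1 h1mem)
    refine ⟨hb, X (z u 1), hder u hu, ?_, h.range_X _ hb (hYz u hu 1 h1mem)⟩
    exact Function.LeftInverse.injective (g := p) (h.proj_X _ hb)

end LocalLeaf

/-! ### Vector fields and covectors in charts; bump functions and coordinates. -/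

section ChartRepresentation

open Set Filter Topology VectorField

variable {E : Type*} [NormedAddCommGroup E] [NormedSpace ℝ E]
  {M : Type*} [TopologicalSpace M] [ChartedSpace E M] [IsManifold 𝓘(ℝ, E) ∞ M]

omit [IsManifold 𝓘(ℝ, E) ∞ M] in
theorem section_sum_apply {F : Type*} [NormedAddCommGroup F] [NormedSpace ℝ F]
    {V : M → Type*} [TopologicalSpace (TotalSpace F V)] [∀ x, TopologicalSpace (V x)]
    [FiberBundle F V] [∀ x, AddCommGroup (V x)] [∀ x, Module ℝ (V x)] [VectorBundle ℝ F V]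
    {ι : Type*} (s : Finset ι) (t : ι → Cₛ^∞⟮𝓘(ℝ, E); F, V⟯) (x : M) :
    (∑ i ∈ s, t i) x = ∑ i ∈ s, t i x :=
  (congrFun (map_sum (ContMDiffSection.coeAddHom 𝓘(ℝ, E) F ∞ V) t s) x).trans
    (Finset.sum_apply x s _)

/-- The representation of a vector field in the preferred chart at `x₀`. -/
def chartVec (x₀ : M) (X : Π x : M, TangentSpace 𝓘(ℝ, E) x) : E → E :=
  mpullback 𝓘(ℝ, E) 𝓘(ℝ, E) (extChartAt 𝓘(ℝ, E) x₀).symm X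

variable {x₀ : M} {z : E}

theorem contMDiffAt_extChartAt_symm (hz : z ∈ (extChartAt 𝓘(ℝ, E) x₀).target) :
    ContMDiffAt 𝓘(ℝ, E) 𝓘(ℝ, E) ∞ (extChartAt 𝓘(ℝ, E) x₀).symm z :=
  (contMDiffOn_extChartAt_symm x₀).contMDiffAt ((isOpen_extChartAt_target x₀).mem_nhds hz)

theorem isInvertible_mfderiv_extChartAt_symm (hz : z ∈ (extChartAt 𝓘(ℝ, E) x₀).target) :
    (mfderiv 𝓘(ℝ, E) 𝓘(ℝ, E) (extChartAt 𝓘(ℝ, E) x₀).symm z).IsInvertible := by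
  have h := isInvertible_mfderivWithin_extChartAt_symm hz
  simpa using h

theorem contDiffAt_comp_extChartAt_symm {F : Type*} [NormedAddCommGroup F] [NormedSpace ℝ F]
    {f : M → F} (hf : ContMDiff 𝓘(ℝ, E) 𝓘(ℝ, F) ∞ f)
    (hz : z ∈ (extChartAt 𝓘(ℝ, E) x₀).target) :
    ContDiffAt ℝ ∞ (f ∘ (extChartAt 𝓘(ℝ, E) x₀).symm) z :=
  (hf.contMDiffAt.comp z (contMDiffAt_extChartAt_symm hz)).contDiffAt

/-- Reduces the derivative of a function along a vector field to an ordinary Fréchet derivative in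
the chart. -/
theorem mvfderiv_extChartAt_symm {f : M → ℝ} (hz : z ∈ (extChartAt 𝓘(ℝ, E) x₀).target)
    (hf : MDifferentiableAt 𝓘(ℝ, E) 𝓘(ℝ) f ((extChartAt 𝓘(ℝ, E) x₀).symm z))
    (X : Π x : M, TangentSpace 𝓘(ℝ, E) x) :
    mvfderiv 𝓘(ℝ, E) f ((extChartAt 𝓘(ℝ, E) x₀).symm z) (X ((extChartAt 𝓘(ℝ, E) x₀).symm z)) =
      fderiv ℝ (f ∘ (extChartAt 𝓘(ℝ, E) x₀).symm) z (chartVec x₀ X z) := by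
  set w : E := chartVec x₀ X z with hw
  have h1 := mvfderiv_comp_apply z hf
    ((contMDiffAt_extChartAt_symm hz).mdifferentiableAt (by simp)) w
  have h2 : mfderiv 𝓘(ℝ, E) 𝓘(ℝ, E) (extChartAt 𝓘(ℝ, E) x₀).symm z w =
      X ((extChartAt 𝓘(ℝ, E) x₀).symm z) :=
    (isInvertible_mfderiv_extChartAt_symm hz).self_apply_inverse _
  rw [h2] at h1
  rw [← h1]
  have : mvfderiv 𝓘(ℝ, E) (f ∘ (extChartAt 𝓘(ℝ, E) x₀).symm) z =
      fderiv ℝ (f ∘ (extChartAt 𝓘(ℝ, E) x₀).symm) z := mfderiv_eq_fderiv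
  rw [this]
  rfl

variable [FiniteDimensional ℝ E]

theorem contDiffAt_chartVec (X : VField E M) (hz : z ∈ (extChartAt 𝓘(ℝ, E) x₀).target) :
    ContDiffAt ℝ ∞ (chartVec x₀ X) z := by
  have : CompleteSpace E := FiniteDimensional.complete ℝ E
  have h := ContMDiffAt.mpullback_vectorField_preimage (m := ∞) (n := ∞) (X.contMDiff _)
    (contMDiffAt_extChartAt_symm hz) (isInvertible_mfderiv_extChartAt_symm hz) (by simp)
  exact contMDiffAt_vectorSpace_iff_contDiffAt.1 h

theorem chartVec_lieField (X Y : VField E M) (hz : z ∈ (extChartAt 𝓘(ℝ, E) x₀).target) :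
    chartVec x₀ (lieField X Y) z =
      fderiv ℝ (chartVec x₀ Y) z (chartVec x₀ X z) - fderiv ℝ (chartVec x₀ X) z (chartVec x₀ Y z) := by
  have : CompleteSpace E := FiniteDimensional.complete ℝ E
  have h := mpullback_mlieBracket (n := ∞) (X.mdifferentiableAt) (Y.mdifferentiableAt)
    (contMDiffAt_extChartAt_symm hz) (by simpa using (WithTop.coe_le_coe.2 le_top : ((2 : ℕ∞) : WithTop ℕ∞) ≤ ∞))
  have h2 : ∀ V W : Π x : E, TangentSpace 𝓘(ℝ, E) x,
      mlieBracket 𝓘(ℝ, E) V W = lieBracket ℝ (E := E) V W := fun V W =>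
    mlieBracketWithin_univ.symm.trans
      (mlieBracketWithin_eq_lieBracketWithin.trans lieBracketWithin_univ)
  exact h.trans (congrFun (h2 (chartVec x₀ X) (chartVec x₀ Y)) z)

/-- In a chart, both iterated derivatives contain the second derivative of f on the same pair of
vectors; its symmetry cancels these terms and leaves Df on the bracket. -/
theorem lieFun_lieField (X Y : VField E M) (f : SmoothFun E M) :
    lieFun (lieField X Y) f = lieFun X (lieFun Y f) - lieFun Y (lieFun X f) := by
  ext x
  set φ := extChartAt 𝓘(ℝ, E) x
  have hz : φ x ∈ φ.target := mem_extChartAt_target x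
  have hx : φ.symm (φ x) = x := extChartAt_to_inv x
  have key : ∀ (W : VField E M) (g : SmoothFun E M), ∀ z ∈ φ.target, lieFun W g (φ.symm z) =
      fderiv ℝ (g ∘ φ.symm) z (chartVec x W z) := fun W g z hz =>
    mvfderiv_extChartAt_symm hz (g.contMDiff.mdifferentiable (by simp) _) W
  have hf : ContDiffAt ℝ ∞ (f ∘ φ.symm) (φ x) := contDiffAt_comp_extChartAt_symm f.contMDiff hz
  have hf1 : DifferentiableAt ℝ (fderiv ℝ (f ∘ φ.symm)) (φ x) :=
    (hf.fderiv_right (m := ∞) (by simp)).differentiableAt (by simp)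
  have key2 : ∀ W W' : VField E M, lieFun W' (lieFun W f) (φ.symm (φ x)) =
      fderiv ℝ (fderiv ℝ (f ∘ φ.symm)) (φ x) (chartVec x W' (φ x)) (chartVec x W (φ x)) +
      fderiv ℝ (f ∘ φ.symm) (φ x) (fderiv ℝ (chartVec x W) (φ x) (chartVec x W' (φ x))) :=
    fun W W' => by
      rw [key _ _ _ hz]
      have h1 : (lieFun W f) ∘ φ.symm =ᶠ[𝓝 (φ x)]
          fun z => fderiv ℝ (f ∘ φ.symm) z (chartVec x W z) := by
        filter_upwards [(isOpen_extChartAt_target x).mem_nhds hz] with z hz using key W f z hz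
      rw [h1.fderiv_eq, fderiv_clm_apply hf1
        ((contDiffAt_chartVec W hz).differentiableAt (by simp))]
      simp [add_comm]
  have h2 : IsSymmSndFDerivAt ℝ (f ∘ φ.symm) (φ x) :=
    hf.isSymmSndFDerivAt (by simpa using (WithTop.coe_le_coe.2 le_top : ((2 : ℕ∞) : WithTop ℕ∞) ≤ ∞))
  change lieFun (lieField X Y) f x = lieFun X (lieFun Y f) x - lieFun Y (lieFun X f) x
  rw [← hx, key2, key2, key _ _ _ hz, chartVec_lieField X Y hz, map_sub, h2]
  abel

omit [FiniteDimensional ℝ E] in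
theorem chartVec_eq_mfderiv (X : Π x : M, TangentSpace 𝓘(ℝ, E) x)
    (hz : z ∈ (extChartAt 𝓘(ℝ, E) x₀).target) :
    chartVec x₀ X z = mfderiv 𝓘(ℝ, E) 𝓘(ℝ, E) (extChartAt 𝓘(ℝ, E) x₀)
      ((extChartAt 𝓘(ℝ, E) x₀).symm z) (X ((extChartAt 𝓘(ℝ, E) x₀).symm z)) := by
  set w : E := chartVec x₀ X z
  have h1 := mfderiv_extChartAt_comp_mfderivWithin_extChartAt_symm hz
  have h2 : mfderiv 𝓘(ℝ, E) 𝓘(ℝ, E) (extChartAt 𝓘(ℝ, E) x₀).symm z w =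
      X ((extChartAt 𝓘(ℝ, E) x₀).symm z) :=
    (isInvertible_mfderiv_extChartAt_symm hz).self_apply_inverse _
  rw [ModelWithCorners.range_eq_univ, mfderivWithin_univ] at h1
  have h3 := DFunLike.congr_fun h1 w
  exact h3.symm.trans (congrArg (mfderiv 𝓘(ℝ, E) 𝓘(ℝ, E) (extChartAt 𝓘(ℝ, E) x₀)
    ((extChartAt 𝓘(ℝ, E) x₀).symm z)) h2)

variable [T2Space M]

omit [IsManifold 𝓘(ℝ, E) ∞ M] in
theorem exists_smoothBumpFunction {x₀ : M} {s : Set M} (hs : s ∈ 𝓝 x₀) :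
    ∃ f : SmoothBumpFunction 𝓘(ℝ, E) x₀, tsupport f ⊆ s := by
  obtain ⟨f, hf⟩ := (SmoothBumpFunction.nhds_basis_support (I := 𝓘(ℝ, E)) hs).ex_mem
  exact ⟨f, hf⟩

/-- A bump function at `x₀`. -/
def bump (x₀ : M) : SmoothBumpFunction 𝓘(ℝ, E) x₀ :=
  (exists_smoothBumpFunction (E := E) Filter.univ_mem).choose

/-- A globally defined function that agrees near `x₀` with the coordinate `l` of the chart. -/
def bumpCoord (x₀ : M) (l : E →L[ℝ] ℝ) : SmoothFun E M :=
  ⟨fun x => bump (E := E) x₀ x • l (extChartAt 𝓘(ℝ, E) x₀ x),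
    (bump (E := E) x₀).contMDiff_smul (l.contMDiff.comp_contMDiffOn contMDiffOn_extChartAt)⟩

variable (E) in
/-- The neighbourhood of `x₀` on which `bumpCoord x₀ l` is a coordinate. -/
def coordDomain (x₀ : M) : Set M :=
  (extChartAt 𝓘(ℝ, E) x₀).source ∩ {y | ∀ᶠ y' in 𝓝 y, bump (E := E) x₀ y' = 1}

omit [IsManifold 𝓘(ℝ, E) ∞ M] in
theorem isOpen_coordDomain (x₀ : M) : IsOpen (coordDomain E x₀) :=
  (isOpen_extChartAt_source x₀).inter isOpen_setOfPred_eventually_nhds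

omit [IsManifold 𝓘(ℝ, E) ∞ M] in
theorem mem_coordDomain (x₀ : M) : x₀ ∈ coordDomain E x₀ :=
  ⟨mem_extChartAt_source x₀, (bump x₀).eventuallyEq_one⟩

theorem extd_bumpCoord {x₀ y : M} (hy : y ∈ coordDomain E x₀) (l : E →L[ℝ] ℝ)
    (v : TangentSpace 𝓘(ℝ, E) y) :
    (extd (bumpCoord x₀ l) y v : ℝ) =
      l (mfderiv 𝓘(ℝ, E) 𝓘(ℝ, E) (extChartAt 𝓘(ℝ, E) x₀) y v) := by
  have h1 : bumpCoord x₀ l =ᶠ[𝓝 y] l ∘ extChartAt 𝓘(ℝ, E) x₀ := by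
    filter_upwards [hy.2] with y' hy'
    change bump (E := E) x₀ y' • l (extChartAt 𝓘(ℝ, E) x₀ y') = _
    rw [hy', one_smul]
    rfl
  have hys : y ∈ (chartAt E x₀).source := by simpa using hy.1
  have h2 := mfderiv_comp y l.mdifferentiableAt (mdifferentiableAt_extChartAt (I := 𝓘(ℝ, E)) hys)
  have h3 : mfderiv 𝓘(ℝ, E) 𝓘(ℝ) (bumpCoord x₀ l) y = _ := h1.mfderiv_eq.trans h2
  rw [l.mfderiv_eq] at h3
  exact DFunLike.congr_fun h3 v

/-- Vector fields are determined by their action on functions. -/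
theorem vfield_ext {X Y : VField E M} (h : ∀ f, lieFun X f = lieFun Y f) : X = Y := by
  ext x
  have hx := mem_coordDomain (E := E) x
  refine (isInvertible_mfderiv_extChartAt (mem_extChartAt_source (I := 𝓘(ℝ, E)) x)).injective ?_
  -- Linear functionals of the chart, extended to M by bump functions, separate the tangent vectors
  -- at x.
  refine (SeparatingDual.eq_iff_forall_dual_eq (R := ℝ) (V := E)).2 fun l => ?_
  have h1 : ∀ W : VField E M, lieFun W (bumpCoord x l) x = _ := fun W => extd_bumpCoord hx l (W x)
  exact (h1 X).symm.trans ((DFunLike.congr_fun (h _) x).trans (h1 Y))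

/-- A local smooth extension of v is multiplied by a bump function equal to 1 at x. -/
theorem exists_vfield_eq (x : M) (v : TangentSpace 𝓘(ℝ, E) x) : ∃ X : VField E M, X x = v := by
  obtain ⟨s, hs, hsm⟩ := FiberBundle.exists_contMDiffOn_extend (I := 𝓘(ℝ, E)) (k := ∞) E v
  obtain ⟨f, hf⟩ := exists_smoothBumpFunction (E := E) (interior_mem_nhds.2 hs)
  refine ⟨⟨_, ContMDiffOn.smul_section_of_tsupport f.contMDiff.contMDiffOn isOpen_interior hf
    (hsm.mono interior_subset)⟩, ?_⟩
  change f x • FiberBundle.extend E v x = v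
  rw [f.eq_one, one_smul, FiberBundle.extend_apply_self]

/-- One-forms are determined by their values on vector fields. -/
theorem oneForm_ext {α β : OneForm E M} (h : ∀ X, pair α X = pair β X) : α = β := by
  ext x v
  obtain ⟨X, rfl⟩ := exists_vfield_eq x v
  exact DFunLike.congr_fun (h X) x

/-- Locally, every one-form is a combination of differentials of functions. -/
theorem exists_smul_mem_span_extd (α : OneForm E M) (x : M) :
    ∃ ψ : SmoothFun E M, ψ x = 1 ∧
      ψ • α ∈ Submodule.span (SmoothFun E M) (Set.range (extd (E := E) (M := M))) := by
  have : CompleteSpace E := FiniteDimensional.complete ℝ E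
  obtain ⟨f, hf⟩ := exists_smoothBumpFunction (E := E)
    ((isOpen_coordDomain x).mem_nhds (mem_coordDomain (E := E) x))
  let b := Module.finBasis ℝ E
  let e : Fin (Module.finrank ℝ E) → Π y : M, TangentSpace 𝓘(ℝ, E) y := fun i =>
    mpullback 𝓘(ℝ, E) 𝓘(ℝ, E) (extChartAt 𝓘(ℝ, E) x) fun _ => b i
  have he : ∀ i, ContMDiffOn 𝓘(ℝ, E) 𝓘(ℝ, E).tangent ∞ (T% (e i)) (coordDomain E x) :=
    fun i y hy => by
      refine ContMDiffAt.contMDiffWithinAt (ContMDiffAt.mpullback_vectorField_preimage (n := ∞)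
        (contMDiffAt_vectorSpace_iff_contDiffAt.2 contDiffAt_const)
        (contMDiffAt_extChartAt' (by simpa using hy.1))
        (isInvertible_mfderiv_extChartAt hy.1) (by simp))
  let W : Fin (Module.finrank ℝ E) → VField E M := fun i =>
    ⟨_, ContMDiffOn.smul_section_of_tsupport f.contMDiff.contMDiffOn
      (isOpen_coordDomain x) hf (he i)⟩
  let l : Fin (Module.finrank ℝ E) → E →L[ℝ] ℝ := fun i => (b.coord i).toContinuousLinearMap
  let ψ : SmoothFun E M := ⟨f, f.contMDiff⟩
  refine ⟨ψ, f.eq_one, ?_⟩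
  -- On the coordinate domain this is α = ∑ α(e_i) dx_i multiplied by ψ. Outside it ψ vanishes, so
  -- both sides are zero although the differentials on the right need not be.
  have key : ψ • α = ∑ i, pair α (W i) • extd (bumpCoord x (l i)) := by
    ext y v
    rw [section_smul_apply, section_sum_apply]
    change f y • α y v = (∑ i, (α y (f y • e i y) : ℝ) • extd (bumpCoord x (l i)) y) v
    rw [sum_apply]
    by_cases hy : y ∈ coordDomain E x
    · have hD := isInvertible_mfderiv_extChartAt hy.1
      have he' : ∀ i, mfderiv 𝓘(ℝ, E) 𝓘(ℝ, E) (extChartAt 𝓘(ℝ, E) x) y (e i y) = b i :=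
        fun i => hD.self_apply_inverse (b i)
      have h1 : v = ∑ i, l i (mfderiv 𝓘(ℝ, E) 𝓘(ℝ, E) (extChartAt 𝓘(ℝ, E) x) y v) • e i y := by
        refine hD.injective ?_
        simp only [map_sum, map_smul, he']
        exact (b.sum_repr _).symm
      conv_lhs => rw [h1]
      simp only [map_sum, map_smul, smul_apply, extd_bumpCoord hy, smul_eq_mul]
      rw [Finset.mul_sum]
      exact Finset.sum_congr rfl fun i _ => by ring
    · have : f y = 0 := image_eq_zero_of_notMem_tsupport fun h => hy (hf h)
      simp [this]
  rw [key]
  exact Submodule.sum_mem _ fun i _ => Submodule.smul_mem _ _ (Submodule.subset_span ⟨_, rfl⟩)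

end ChartRepresentation

/-! ### Cartan calculus and the Koszul bracket of one-forms. -/

section CartanRules

variable {E : Type*} [NormedAddCommGroup E] [NormedSpace ℝ E]
  {M : Type*} [TopologicalSpace M] [ChartedSpace E M] [IsManifold 𝓘(ℝ, E) ∞ M]

/-- The constant function. -/
abbrev constFun (c : ℝ) : SmoothFun E M := algebraMap ℝ (SmoothFun E M) c

omit [IsManifold 𝓘(ℝ, E) ∞ M] in
theorem mdifferentiableAt_smoothFun (f : SmoothFun E M) (x : M) :
    MDifferentiableAt 𝓘(ℝ, E) 𝓘(ℝ) f x := f.contMDiff.mdifferentiable (by simp) x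

theorem lieFun_add_left (X Y : VField E M) (f : SmoothFun E M) :
    lieFun (X + Y) f = lieFun X f + lieFun Y f := by
  ext x
  exact map_add (mvfderiv 𝓘(ℝ, E) f x) (X x) (Y x)

theorem lieFun_smul_left (g : SmoothFun E M) (X : VField E M) (f : SmoothFun E M) :
    lieFun (g • X) f = g * lieFun X f := by
  ext x
  exact map_smul (mvfderiv 𝓘(ℝ, E) f x) (g x) (X x)

theorem lieFun_add (X : VField E M) (f g : SmoothFun E M) :
    lieFun X (f + g) = lieFun X f + lieFun X g := by
  ext x
  exact congrArg (fun L => L (X x)) (mvfderiv_add (mdifferentiableAt_smoothFun f x)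
    (mdifferentiableAt_smoothFun g x))

theorem lieFun_mul (X : VField E M) (f g : SmoothFun E M) :
    lieFun X (f * g) = f * lieFun X g + lieFun X f * g := by
  ext x
  refine (congrArg (fun L => L (X x)) (mvfderiv_mul (mdifferentiableAt_smoothFun f x)
    (mdifferentiableAt_smoothFun g x))).trans ?_
  change f x * lieFun X g x + g x * lieFun X f x = f x * lieFun X g x + lieFun X f x * g x
  ring

theorem lieFun_const (X : VField E M) (c : ℝ) : lieFun X (constFun c) = 0 := by
  ext x
  exact congrArg (fun L => L (X x)) (mvfderiv_const (I := 𝓘(ℝ, E)) (M := M) c (x := x))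

/-- The derivative along a vector field as a linear map on functions. -/
def lieFunₗ (X : VField E M) : SmoothFun E M →ₗ[ℝ] SmoothFun E M where
  toFun := lieFun X
  map_add' := lieFun_add X
  map_smul' c f := by
    rw [Algebra.smul_def, lieFun_mul, lieFun_const, zero_mul, add_zero, RingHom.id_apply,
      Algebra.smul_def]

theorem lieFun_sub (X : VField E M) (f g : SmoothFun E M) :
    lieFun X (f - g) = lieFun X f - lieFun X g := map_sub (lieFunₗ X) f g

theorem lieFun_neg (X : VField E M) (f : SmoothFun E M) :
    lieFun X (-f) = -lieFun X f := map_neg (lieFunₗ X) f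

theorem lieFun_zero (X : VField E M) : lieFun X 0 = 0 := map_zero (lieFunₗ X)

theorem lieFun_sum (X : VField E M) {ι : Type*} (s : Finset ι) (f : ι → SmoothFun E M) :
    lieFun X (∑ i ∈ s, f i) = ∑ i ∈ s, lieFun X (f i) := map_sum (lieFunₗ X) f s

theorem lieFun_real_smul (X : VField E M) (c : ℝ) (f : SmoothFun E M) :
    lieFun X (c • f) = c • lieFun X f := map_smul (lieFunₗ X) c f

theorem lieFun_sub_left (X Y : VField E M) (f : SmoothFun E M) :
    lieFun (X - Y) f = lieFun X f - lieFun Y f := by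
  rw [eq_sub_iff_add_eq, ← lieFun_add_left, sub_add_cancel]

theorem lieFun_zero_left (f : SmoothFun E M) : lieFun (0 : VField E M) f = 0 := by
  simpa using lieFun_sub_left 0 0 f

theorem pair_add_left (α β : OneForm E M) (X : VField E M) :
    pair (α + β) X = pair α X + pair β X := rfl

theorem pair_sub_left (α β : OneForm E M) (X : VField E M) :
    pair (α - β) X = pair α X - pair β X := rfl

theorem pair_smul_left (f : SmoothFun E M) (α : OneForm E M) (X : VField E M) :
    pair (f • α) X = f * pair α X := rfl

theorem pair_zero_left (X : VField E M) : pair (0 : OneForm E M) X = 0 := rfl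

theorem pair_add_right (α : OneForm E M) (X Y : VField E M) :
    pair α (X + Y) = pair α X + pair α Y := by
  ext x
  exact map_add (α x) (X x) (Y x)

theorem pair_smul_right (f : SmoothFun E M) (α : OneForm E M) (X : VField E M) :
    pair α (f • X) = f * pair α X := by
  ext x
  exact map_smul (α x) (f x) (X x)

theorem pair_sub_right (α : OneForm E M) (X Y : VField E M) :
    pair α (X - Y) = pair α X - pair α Y := by
  rw [eq_sub_iff_add_eq, ← pair_add_right, sub_add_cancel]

theorem pair_sum_left {ι : Type*} (s : Finset ι) (α : ι → OneForm E M) (X : VField E M) :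
    pair (∑ i ∈ s, α i) X = ∑ i ∈ s, pair (α i) X :=
  map_sum (⟨⟨fun α => pair α X, pair_zero_left X⟩, fun α β => pair_add_left α β X⟩ :
    OneForm E M →+ SmoothFun E M) α s

namespace Bivector

variable (P : Bivector E M)

theorem sharpForm_add (α β : OneForm E M) :
    P.sharpForm (α + β) = P.sharpForm α + P.sharpForm β := by
  ext x
  exact map_add (P.sharp x) (α x) (β x)

theorem sharpForm_smul (f : SmoothFun E M) (α : OneForm E M) :
    P.sharpForm (f • α) = f • P.sharpForm α := by
  ext x
  exact map_smul (P.sharp x) (f x) (α x)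

theorem pair_sharpForm_self (α : OneForm E M) : pair α (P.sharpForm α) = 0 := by
  ext x
  exact P.alternating x (α x)

theorem pair_sharpForm_swap (α β : OneForm E M) :
    pair α (P.sharpForm β) = -pair β (P.sharpForm α) := by
  have h := P.pair_sharpForm_self (α + β)
  rw [sharpForm_add, pair_add_left, pair_add_right, pair_add_right, pair_sharpForm_self,
    pair_sharpForm_self, zero_add, add_zero] at h
  exact eq_neg_of_add_eq_zero_left h

end Bivector

variable [FiniteDimensional ℝ E]

theorem pair_extd (f : SmoothFun E M) (X : VField E M) : pair (extd f) X = lieFun X f := rfl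

theorem Bivector.bracket_eq (P : Bivector E M) (f g : SmoothFun E M) :
    P.bracket f g = lieFun (P.sharpForm (extd f)) g := rfl

theorem Bivector.bracket_swap (P : Bivector E M) (f g : SmoothFun E M) :
    P.bracket g f = -P.bracket f g := P.pair_sharpForm_swap _ _

variable [T2Space M]

theorem extd_add (f g : SmoothFun E M) : extd (f + g) = extd f + extd g :=
  oneForm_ext fun X => by simp only [pair_extd, pair_add_left, lieFun_add]

theorem extd_mul (f g : SmoothFun E M) : extd (f * g) = f • extd g + g • extd f :=
  oneForm_ext fun X => by
    simp only [pair_extd, pair_add_left, pair_smul_left, lieFun_mul, mul_comm]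

theorem extd_sub (f g : SmoothFun E M) : extd (f - g) = extd f - extd g := by
  rw [eq_sub_iff_add_eq, ← extd_add, sub_add_cancel]

theorem extd_neg (f : SmoothFun E M) : extd (-f) = -extd f := by
  have h := extd_sub 0 f
  rw [zero_sub] at h
  rw [h]
  have h0 := extd_sub f f
  simp only [sub_self] at h0
  rw [h0, zero_sub]

theorem lieField_add_right (X Y Z : VField E M) :
    lieField X (Y + Z) = lieField X Y + lieField X Z :=
  vfield_ext fun f => by
    simp only [lieFun_lieField, lieFun_add_left, lieFun_add]; abel

theorem lieField_swap (X Y : VField E M) : lieField X Y = -lieField Y X := by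
  refine eq_neg_of_add_eq_zero_left (vfield_ext fun f => ?_)
  simp only [lieFun_lieField, lieFun_add_left, lieFun_zero_left]
  abel

theorem lieField_smul_right (X Y : VField E M) (f : SmoothFun E M) :
    lieField X (f • Y) = f • lieField X Y + lieFun X f • Y :=
  vfield_ext fun g => by
    simp only [lieFun_lieField, lieFun_add_left, lieFun_smul_left, lieFun_mul]; ring

theorem lieField_add_left (X Y Z : VField E M) :
    lieField (X + Y) Z = lieField X Z + lieField Y Z :=
  vfield_ext fun f => by
    simp only [lieFun_lieField, lieFun_add_left, lieFun_add]; abel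

theorem lieField_smul_left (X Y : VField E M) (f : SmoothFun E M) :
    lieField (f • X) Y = f • lieField X Y - lieFun Y f • X :=
  vfield_ext fun g => by
    simp only [lieFun_lieField, lieFun_sub_left, lieFun_smul_left, lieFun_mul]; ring

theorem lieForm_add (X : VField E M) (α β : OneForm E M) :
    lieForm X (α + β) = lieForm X α + lieForm X β :=
  oneForm_ext fun Y => by
    simp only [pair_lieForm, pair_add_left, lieFun_add]; abel

theorem lieForm_add_left (X Y : VField E M) (α : OneForm E M) :
    lieForm (X + Y) α = lieForm X α + lieForm Y α :=
  oneForm_ext fun Z => by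
    simp only [pair_lieForm, pair_add_left, lieFun_add_left, lieField_add_left, pair_add_right]
    abel

theorem lieForm_smul (X : VField E M) (f : SmoothFun E M) (α : OneForm E M) :
    lieForm X (f • α) = f • lieForm X α + lieFun X f • α :=
  oneForm_ext fun Y => by
    simp only [pair_lieForm, pair_add_left, pair_smul_left, lieFun_mul]; ring

theorem lieForm_smul_left (f : SmoothFun E M) (X : VField E M) (α : OneForm E M) :
    lieForm (f • X) α = f • lieForm X α + pair α X • extd f :=
  oneForm_ext fun Y => by
    simp only [pair_lieForm, pair_add_left, pair_smul_left, lieFun_smul_left, lieField_smul_left,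
      pair_sub_right, pair_smul_right, pair_extd]
    ring

theorem lieForm_extd (X : VField E M) (f : SmoothFun E M) :
    lieForm X (extd f) = extd (lieFun X f) :=
  oneForm_ext fun Y => by
    simp only [pair_lieForm, pair_extd, lieFun_lieField]; abel

theorem lieForm_zero (X : VField E M) : lieForm X 0 = 0 := by
  simpa using lieForm_add X 0 0

theorem formBracket_self (P : Bivector E M) (α : OneForm E M) : formBracket P α α = 0 := by
  have h : P.eval α α = 0 := P.pair_sharpForm_self α
  have h0 := extd_sub (0 : SmoothFun E M) 0
  simp only [sub_self] at h0
  rw [formBracket, h, h0, sub_self, sub_zero]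

theorem formBracket_add (P : Bivector E M) (α β γ : OneForm E M) :
    formBracket P α (β + γ) = formBracket P α β + formBracket P α γ := by
  have h : P.eval α (β + γ) = P.eval α β + P.eval α γ := rfl
  simp only [formBracket, h, extd_add, P.sharpForm_add, lieForm_add, lieForm_add_left]
  abel

theorem formBracket_add_left (P : Bivector E M) (α β γ : OneForm E M) :
    formBracket P (α + β) γ = formBracket P α γ + formBracket P β γ := by
  have h : P.eval (α + β) γ = P.eval α γ + P.eval β γ := by
    simp only [Bivector.eval, P.sharpForm_add, pair_add_right]
  simp only [formBracket, h, extd_add, P.sharpForm_add, lieForm_add, lieForm_add_left]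
  abel

/-- The term π(α, β) df from d(f π(α, β)) cancels the one from L_{f π^♯(β)} α, because α(π^♯(β)) =
-π(α, β). -/
theorem formBracket_smul (P : Bivector E M) (α β : OneForm E M) (f : SmoothFun E M) :
    formBracket P α (f • β) = f • formBracket P α β + lieFun (P.sharpForm α) f • β := by
  have h : P.eval α (f • β) = f * P.eval α β := rfl
  have h2 : pair α (P.sharpForm β) = -P.eval α β := P.pair_sharpForm_swap _ _
  simp only [formBracket, h, extd_mul, P.sharpForm_smul, lieForm_smul, lieForm_smul_left, h2]
  module

/-- The two Lie derivatives are d{f, g} and d{g, f} = -d{f, g}; their difference counts d{f, g}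
twice and the last term removes one copy. -/
theorem formBracket_extd (P : Bivector E M) (f g : SmoothFun E M) :
    formBracket P (extd f) (extd g) = extd (P.bracket f g) := by
  have h : P.eval (extd f) (extd g) = P.bracket f g := rfl
  rw [formBracket, lieForm_extd, lieForm_extd, h, ← P.bracket_eq, ← P.bracket_eq,
    P.bracket_swap f g, extd_neg]
  abel

end CartanRules

/-! ### Derivatives of maps to a finite-dimensional vector space. -/

section SmoothMapCalculus

variable {E : Type*} [NormedAddCommGroup E] [NormedSpace ℝ E]
  {M : Type*} [TopologicalSpace M] [ChartedSpace E M]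
  {W W₁ W₂ W₃ : Type*} [AddCommGroup W] [Module ℝ W] [FiniteDimensional ℝ W]
  [AddCommGroup W₁] [Module ℝ W₁] [FiniteDimensional ℝ W₁]
  [AddCommGroup W₂] [Module ℝ W₂] [FiniteDimensional ℝ W₂]
  [AddCommGroup W₃] [Module ℝ W₃] [FiniteDimensional ℝ W₃]

omit [FiniteDimensional ℝ W] in
theorem smoothFun_sum_apply {ι : Type*} (s : Finset ι) (f : ι → SmoothFun E M) (x : M) :
    (∑ i ∈ s, f i) x = ∑ i ∈ s, f i x :=
  (congrFun (map_sum ContMDiffMap.coeFnRingHom f s) x).trans (Finset.sum_apply x s _)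

/-- The component of a smooth map along a linear functional. -/
def comp (μ : Module.Dual ℝ W) (v : SmoothMap E M W) : SmoothFun E M := ⟨fun x => μ (v.1 x), v.2 μ⟩

omit [FiniteDimensional ℝ W] in
@[simp] theorem comp_apply (μ : Module.Dual ℝ W) (v : SmoothMap E M W) (x : M) :
    comp μ v x = μ (v.1 x) := rfl

theorem smoothMap_ext {v w : SmoothMap E M W} (h : ∀ μ, comp μ v = comp μ w) : v = w := by
  refine Subtype.ext (funext fun x => ?_)
  refine (Module.forall_dual_apply_eq_zero_iff ℝ (v.1 x - w.1 x)).1 (fun μ => ?_) |> sub_eq_zero.1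
  rw [map_sub, sub_eq_zero]
  exact DFunLike.congr_fun (h μ) x

theorem comp_eq_sum (μ : Module.Dual ℝ W) (v : SmoothMap E M W) :
    comp μ v = ∑ i, μ (Module.finBasis ℝ W i) • comp ((Module.finBasis ℝ W).coord i) v := by
  ext x
  simp only [smoothFun_sum_apply, comp_apply, ContMDiffMap.coe_smul, Pi.smul_apply, smul_eq_mul,
    Module.Basis.coord_apply]
  conv_lhs => rw [← (Module.finBasis ℝ W).sum_repr (v.1 x), map_sum]
  simp only [map_smul, smul_eq_mul, mul_comm]

omit [FiniteDimensional ℝ W₃] in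
-- Expansion in bases turns each component into a finite sum of products of smooth functions, which
-- yields the smoothness of `bilin` and its product rule.
theorem apply_bilin_eq_sum (B : W₁ →ₗ[ℝ] W₂ →ₗ[ℝ] W₃) (v : SmoothMap E M W₁)
    (w : SmoothMap E M W₂) (μ : Module.Dual ℝ W₃) (x : M) : μ (B (v.1 x) (w.1 x)) =
      (∑ i, ∑ j, μ (B (Module.finBasis ℝ W₁ i) (Module.finBasis ℝ W₂ j)) •
        (comp ((Module.finBasis ℝ W₁).coord i) v * comp ((Module.finBasis ℝ W₂).coord j) w)) x := by
  simp only [smoothFun_sum_apply, comp_apply, ContMDiffMap.coe_smul, Pi.smul_apply,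
    smul_eq_mul, Module.Basis.coord_apply, ContMDiffMap.coe_mul, Pi.mul_apply]
  conv_lhs => rw [← (Module.finBasis ℝ W₁).sum_repr (v.1 x),
    ← (Module.finBasis ℝ W₂).sum_repr (w.1 x)]
  simp only [map_sum, map_smul, LinearMap.sum_apply, LinearMap.smul_apply, smul_eq_mul,
    Finset.mul_sum]
  rw [Finset.sum_comm]
  exact Finset.sum_congr rfl fun i _ => Finset.sum_congr rfl fun j _ => by ring

/-- The pointwise image of two smooth maps under a bilinear map. -/
def bilin (B : W₁ →ₗ[ℝ] W₂ →ₗ[ℝ] W₃) (v : SmoothMap E M W₁) (w : SmoothMap E M W₂) :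
    SmoothMap E M W₃ :=
  ⟨fun x => B (v.1 x) (w.1 x), fun μ => by
    simp only [apply_bilin_eq_sum]
    exact ContMDiffMap.contMDiff _⟩

omit [FiniteDimensional ℝ W₃] in
theorem comp_bilin (B : W₁ →ₗ[ℝ] W₂ →ₗ[ℝ] W₃) (v : SmoothMap E M W₁) (w : SmoothMap E M W₂)
    (μ : Module.Dual ℝ W₃) : comp μ (bilin B v w) = ∑ i, ∑ j,
      μ (B (Module.finBasis ℝ W₁ i) (Module.finBasis ℝ W₂ j)) •
        (comp ((Module.finBasis ℝ W₁).coord i) v * comp ((Module.finBasis ℝ W₂).coord j) w) := by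
  ext x
  exact apply_bilin_eq_sum B v w μ x

/-- The pointwise image of a smooth map under a linear map. -/
def postcomp (L : W₁ →ₗ[ℝ] W₂) (v : SmoothMap E M W₁) : SmoothMap E M W₂ :=
  ⟨fun x => L (v.1 x), fun μ => v.2 (μ ∘ₗ L)⟩

variable [IsManifold 𝓘(ℝ, E) ∞ M]

/-- The derivative of a smooth map along a vector field. -/
def lieMap (X : VField E M) (v : SmoothMap E M W) : SmoothMap E M W :=
  ∑ i, lieFun X (comp ((Module.finBasis ℝ W).coord i) v) • constMap E M (Module.finBasis ℝ W i)

/-- This shows that `lieMap` does not depend on the basis in its definition, and reduces its rules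
to those for functions. -/
theorem comp_lieMap (X : VField E M) (v : SmoothMap E M W) (μ : Module.Dual ℝ W) :
    comp μ (lieMap X v) = lieFun X (comp μ v) := by
  rw [comp_eq_sum μ v, lieFun_sum]
  ext x
  simp only [lieMap, comp_apply, smoothFun_sum_apply, Finset.sum_apply, lieFun_real_smul,
    ContMDiffMap.coe_smul, Pi.smul_apply, AddSubmonoidClass.coe_finsetSum,
    smoothMap_smul_apply, map_sum, map_smul, smul_eq_mul]
  exact Finset.sum_congr rfl fun i _ => mul_comm _ _

theorem lieMap_add (X : VField E M) (v w : SmoothMap E M W) :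
    lieMap X (v + w) = lieMap X v + lieMap X w :=
  smoothMap_ext fun μ => by
    have h : ∀ v w : SmoothMap E M W, comp μ (v + w) = comp μ v + comp μ w := fun v w => by
      ext x
      exact map_add μ (v.1 x) (w.1 x)
    rw [h, comp_lieMap, comp_lieMap, comp_lieMap, h, lieFun_add]

omit [FiniteDimensional ℝ W] [IsManifold 𝓘(ℝ, E) ∞ M] in
theorem comp_add (μ : Module.Dual ℝ W) (v w : SmoothMap E M W) :
    comp μ (v + w) = comp μ v + comp μ w := by
  ext x
  exact map_add μ (v.1 x) (w.1 x)

omit [FiniteDimensional ℝ W] [IsManifold 𝓘(ℝ, E) ∞ M] in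
theorem comp_sub (μ : Module.Dual ℝ W) (v w : SmoothMap E M W) :
    comp μ (v - w) = comp μ v - comp μ w := by
  ext x
  exact map_sub μ (v.1 x) (w.1 x)

omit [FiniteDimensional ℝ W] [IsManifold 𝓘(ℝ, E) ∞ M] in
theorem comp_smul (μ : Module.Dual ℝ W) (f : SmoothFun E M) (v : SmoothMap E M W) :
    comp μ (f • v) = f * comp μ v := by
  ext x
  exact map_smul μ (f x) (v.1 x)

theorem lieMap_bilin (B : W₁ →ₗ[ℝ] W₂ →ₗ[ℝ] W₃) (X : VField E M) (v : SmoothMap E M W₁)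
    (w : SmoothMap E M W₂) :
    lieMap X (bilin B v w) = bilin B (lieMap X v) w + bilin B v (lieMap X w) :=
  smoothMap_ext fun μ => by
    simp only [comp_add, comp_lieMap, comp_bilin, lieFun_sum, lieFun_real_smul, lieFun_mul,
      ← Finset.sum_add_distrib, ← smul_add]
    refine Finset.sum_congr rfl fun i _ => Finset.sum_congr rfl fun j _ => ?_
    rw [add_comm]

theorem lieMap_postcomp (L : W₁ →ₗ[ℝ] W₂) (X : VField E M) (v : SmoothMap E M W₁) :
    lieMap X (postcomp L v) = postcomp L (lieMap X v) :=
  smoothMap_ext fun μ => by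
    have h : ∀ v : SmoothMap E M W₁, comp μ (postcomp L v) = comp (μ ∘ₗ L) v := fun _ => rfl
    rw [comp_lieMap, h, h, comp_lieMap]

theorem lieMap_smul (X : VField E M) (f : SmoothFun E M) (v : SmoothMap E M W) :
    lieMap X (f • v) = f • lieMap X v + lieFun X f • v :=
  smoothMap_ext fun μ => by
    simp only [comp_add, comp_smul, comp_lieMap, lieFun_mul]

theorem lieMap_add_left (X Y : VField E M) (v : SmoothMap E M W) :
    lieMap (X + Y) v = lieMap X v + lieMap Y v :=
  smoothMap_ext fun μ => by
    simp only [comp_add, comp_lieMap, lieFun_add_left]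

theorem lieMap_smul_left (f : SmoothFun E M) (X : VField E M) (v : SmoothMap E M W) :
    lieMap (f • X) v = f • lieMap X v :=
  smoothMap_ext fun μ => by
    simp only [comp_smul, comp_lieMap, lieFun_smul_left]

theorem lieMap_const (X : VField E M) (w : W) : lieMap X (constMap E M w) = 0 :=
  smoothMap_ext fun μ => by
    have h : ∀ w : W, comp μ (constMap E M w) = constFun (μ w) := fun w => rfl
    have h0 : comp μ (0 : SmoothMap E M W) = 0 := by
      ext x
      exact map_zero μ
    rw [comp_lieMap, h, lieFun_const, h0]

theorem lieMap_lieField [FiniteDimensional ℝ E] (X Y : VField E M) (v : SmoothMap E M W) :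
    lieMap (lieField X Y) v = lieMap X (lieMap Y v) - lieMap Y (lieMap X v) :=
  smoothMap_ext fun μ => by
    simp only [comp_sub, comp_lieMap, lieFun_lieField]

theorem lieMap_sub (X : VField E M) (v w : SmoothMap E M W) :
    lieMap X (v - w) = lieMap X v - lieMap X w := by
  rw [eq_sub_iff_add_eq, ← lieMap_add, sub_add_cancel]

end SmoothMapCalculus

/-! ### The double, the map from sections to it, and the bracket formula. -/

section Bracket

theorem oneForm_smul_add {E : Type*} [NormedAddCommGroup E] [NormedSpace ℝ E]
    {M : Type*} [TopologicalSpace M] [ChartedSpace E M] [IsManifold 𝓘(ℝ, E) ∞ M]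
    (f : SmoothFun E M) (α β : OneForm E M) : f • (α + β) = f • α + f • β := smul_add f α β

theorem oneForm_smul_zero {E : Type*} [NormedAddCommGroup E] [NormedSpace ℝ E]
    {M : Type*} [TopologicalSpace M] [ChartedSpace E M] [IsManifold 𝓘(ℝ, E) ∞ M]
    (f : SmoothFun E M) : f • (0 : OneForm E M) = 0 := by ext x; exact smul_zero (f x)

theorem oneForm_add_smul {E : Type*} [NormedAddCommGroup E] [NormedSpace ℝ E]
    {M : Type*} [TopologicalSpace M] [ChartedSpace E M] [IsManifold 𝓘(ℝ, E) ∞ M]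
    (f g : SmoothFun E M) (α : OneForm E M) : (f + g) • α = f • α + g • α := add_smul f g α

theorem oneForm_mul_smul {E : Type*} [NormedAddCommGroup E] [NormedSpace ℝ E]
    {M : Type*} [TopologicalSpace M] [ChartedSpace E M] [IsManifold 𝓘(ℝ, E) ∞ M]
    (f g : SmoothFun E M) (α : OneForm E M) : (f * g) • α = f • g • α := mul_smul f g α

set_option linter.unusedSectionVars false

variable {E : Type*} [NormedAddCommGroup E] [NormedSpace ℝ E] [FiniteDimensional ℝ E]
  {M : Type*} [TopologicalSpace M] [ChartedSpace E M] [IsManifold 𝓘(ℝ, E) ∞ M]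
  {𝔤 : Type*} [LieRing 𝔤] [LieAlgebra ℝ 𝔤] [FiniteDimensional ℝ 𝔤]
  (F : 𝔤 →ₗ[ℝ] (Module.Dual ℝ 𝔤) [⋀^Fin 2]→ₗ[ℝ] ℝ)
  (χ : (Module.Dual ℝ 𝔤) [⋀^Fin 3]→ₗ[ℝ] ℝ)
  (ρ : 𝔤 →ₗ[ℝ] VField E M) (P : Bivector E M)

theorem eq_of_forall_dual {u v : 𝔤} (h : ∀ μ : Module.Dual ℝ 𝔤, μ u = μ v) : u = v :=
  sub_eq_zero.1 ((Module.forall_dual_apply_eq_zero_iff ℝ (u - v)).1 fun μ => by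
    rw [map_sub, h, sub_self])

theorem map_vec2_add (w : (Module.Dual ℝ 𝔤) [⋀^Fin 2]→ₗ[ℝ] ℝ) (μ μ' ν : Module.Dual ℝ 𝔤) :
    w ![μ + μ', ν] = w ![μ, ν] + w ![μ', ν] := w.map_vecCons_add ![ν] μ μ'

theorem map_vec2_smul (w : (Module.Dual ℝ 𝔤) [⋀^Fin 2]→ₗ[ℝ] ℝ) (c : ℝ) (μ ν : Module.Dual ℝ 𝔤) :
    w ![c • μ, ν] = c * w ![μ, ν] := w.map_vecCons_smul ![ν] c μ

theorem map_vec2_swap (w : (Module.Dual ℝ 𝔤) [⋀^Fin 2]→ₗ[ℝ] ℝ) (μ ν : Module.Dual ℝ 𝔤) :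
    w ![ν, μ] = -w ![μ, ν] := by
  have h := w.map_swap ![μ, ν] (i := 0) (j := 1) (by simp)
  rw [← h]
  congr 1
  ext i; fin_cases i <;> simp

theorem map_vec3_add (w : (Module.Dual ℝ 𝔤) [⋀^Fin 3]→ₗ[ℝ] ℝ) (μ μ' ν η : Module.Dual ℝ 𝔤) :
    w ![μ + μ', ν, η] = w ![μ, ν, η] + w ![μ', ν, η] := w.map_vecCons_add ![ν, η] μ μ'

theorem map_vec3_smul (w : (Module.Dual ℝ 𝔤) [⋀^Fin 3]→ₗ[ℝ] ℝ) (c : ℝ)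
    (μ ν η : Module.Dual ℝ 𝔤) :
    w ![c • μ, ν, η] = c * w ![μ, ν, η] := w.map_vecCons_smul ![ν, η] c μ

theorem map_vec3_swap (w : (Module.Dual ℝ 𝔤) [⋀^Fin 3]→ₗ[ℝ] ℝ) (μ ν η : Module.Dual ℝ 𝔤) :
    w ![ν, μ, η] = -w ![μ, ν, η] := by
  have h := w.map_swap ![μ, ν, η] (i := 0) (j := 1) (by simp)
  rw [← h]
  congr 1
  ext i; fin_cases i <;> simp [Equiv.swap_apply_def]

theorem map_vec3_rotate (w : (Module.Dual ℝ 𝔤) [⋀^Fin 3]→ₗ[ℝ] ℝ) (μ ν η : Module.Dual ℝ 𝔤) :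
    w ![ν, η, μ] = w ![μ, ν, η] := by
  have h := w.map_swap ![μ, ν, η] (i := 0) (j := 2) (by simp)
  have h' : (![μ, ν, η] ∘ Equiv.swap 0 2 : Fin 3 → Module.Dual ℝ 𝔤) = ![η, ν, μ] := by
    ext i; fin_cases i <;> simp [Equiv.swap_apply_def]
  rw [h', map_vec3_swap] at h
  exact neg_injective h

/-- `contract₂` as a bilinear map. -/
def contract₂ₗ : 𝔤 →ₗ[ℝ] Module.Dual ℝ 𝔤 →ₗ[ℝ] 𝔤 :=
  LinearMap.mk₂ ℝ (fun u μ => contract₂ (F u) μ)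
    (fun _ _ _ => eq_of_forall_dual fun ν => by simp [apply_contract₂])
    (fun _ _ _ => eq_of_forall_dual fun ν => by simp [apply_contract₂])
    (fun _ _ _ => eq_of_forall_dual fun ν => by simp [apply_contract₂, map_vec2_add])
    (fun _ _ _ => eq_of_forall_dual fun ν => by simp [apply_contract₂, map_vec2_smul])

/-- `contract₃` as a bilinear map. -/
def contract₃ₗ : Module.Dual ℝ 𝔤 →ₗ[ℝ] Module.Dual ℝ 𝔤 →ₗ[ℝ] 𝔤 :=
  LinearMap.mk₂ ℝ (contract₃ χ)
    (fun _ _ _ => eq_of_forall_dual fun ν => by simp [apply_contract₃, map_vec3_add])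
    (fun _ _ _ => eq_of_forall_dual fun ν => by simp [apply_contract₃, map_vec3_smul])
    (fun μ _ _ => eq_of_forall_dual fun ν => by
      simp only [apply_contract₃, map_add]
      rw [map_vec3_swap, map_vec3_add, map_vec3_swap χ μ, map_vec3_swap χ μ]; ring)
    (fun c μ _ => eq_of_forall_dual fun ν => by
      simp only [apply_contract₃, map_smul, smul_eq_mul]
      rw [map_vec3_swap, map_vec3_smul, map_vec3_swap χ μ]; ring)

theorem contract₃_swap (μ ν : Module.Dual ℝ 𝔤) : contract₃ χ ν μ = -contract₃ χ μ ν :=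
  eq_of_forall_dual fun η => by rw [map_neg, apply_contract₃, apply_contract₃, map_vec3_swap]

theorem cobracketDual_swap (μ ν : Module.Dual ℝ 𝔤) :
    cobracketDual F ν μ = -cobracketDual F μ ν :=
  LinearMap.ext fun v => map_vec2_swap (F v) μ ν

theorem doubleBracket_swap (a b : 𝔤 × Module.Dual ℝ 𝔤) :
    doubleBracket F χ b a = -doubleBracket F χ a b := by
  refine Prod.ext ?_ ?_
  · simp only [doubleBracket, Prod.fst_neg, contract₃_swap χ a.2 b.2]
    rw [← lie_skew]
    abel
  · simp only [doubleBracket, Prod.snd_neg, cobracketDual_swap F a.2 b.2]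
    abel

theorem doubleBracket_add_left (a a' b : 𝔤 × Module.Dual ℝ 𝔤) :
    doubleBracket F χ (a + a') b = doubleBracket F χ a b + doubleBracket F χ a' b := by
  refine Prod.ext ?_ (LinearMap.ext fun w => ?_)
  · change ⁅a.1 + a'.1, b.1⁆ + contract₂ₗ F (a.1 + a'.1) b.2 - contract₂ₗ F b.1 (a.2 + a'.2) +
      contract₃ₗ χ (a.2 + a'.2) b.2 = (⁅a.1, b.1⁆ + contract₂ₗ F a.1 b.2 - contract₂ₗ F b.1 a.2 +
      contract₃ₗ χ a.2 b.2) + (⁅a'.1, b.1⁆ + contract₂ₗ F a'.1 b.2 - contract₂ₗ F b.1 a'.2 +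
      contract₃ₗ χ a'.2 b.2)
    simp only [map_add, LinearMap.add_apply, add_lie]
    abel
  · simp [doubleBracket, coad, cobracketDual, map_vec2_add]
    ring

theorem doubleBracket_smul_left (c : ℝ) (a b : 𝔤 × Module.Dual ℝ 𝔤) :
    doubleBracket F χ (c • a) b = c • doubleBracket F χ a b := by
  refine Prod.ext ?_ (LinearMap.ext fun w => ?_)
  · change ⁅c • a.1, b.1⁆ + contract₂ₗ F (c • a.1) b.2 - contract₂ₗ F b.1 (c • a.2) +
      contract₃ₗ χ (c • a.2) b.2 = c • (⁅a.1, b.1⁆ + contract₂ₗ F a.1 b.2 - contract₂ₗ F b.1 a.2 +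
      contract₃ₗ χ a.2 b.2)
    simp only [map_smul, LinearMap.smul_apply, smul_lie]
    module
  · simp [doubleBracket, coad, cobracketDual, map_vec2_smul]

/-- The bracket of the double as a bilinear map. -/
def doubleₗ : (𝔤 × Module.Dual ℝ 𝔤) →ₗ[ℝ] (𝔤 × Module.Dual ℝ 𝔤) →ₗ[ℝ] 𝔤 × Module.Dual ℝ 𝔤 :=
  LinearMap.mk₂ ℝ (doubleBracket F χ) (doubleBracket_add_left F χ) (doubleBracket_smul_left F χ)
    (fun a b c => by
      rw [doubleBracket_swap, doubleBracket_add_left, neg_add, ← doubleBracket_swap,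
        ← doubleBracket_swap])
    (fun c a b => by
      rw [doubleBracket_swap, doubleBracket_smul_left, doubleBracket_swap F χ b a]
      exact (smul_neg c _).symm)

/-- The smooth map `ρ^* α : M → 𝔤^*`. -/
def pullMap (α : OneForm E M) : SmoothMap E M (Module.Dual ℝ 𝔤) :=
  ⟨fun x => pull ρ x (α x), fun η => by
    have h : ∀ x, η (pull ρ x (α x)) = pair α (ρ ((Module.evalEquiv ℝ 𝔤).symm η)) x := fun x => by
      obtain ⟨v, rfl⟩ := (Module.evalEquiv ℝ 𝔤).surjective η
      rw [LinearEquiv.symm_apply_apply]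
      rfl
    simp only [h]
    exact ContMDiffMap.contMDiff _⟩

theorem comp_eval_pullMap (α : OneForm E M) (v : 𝔤) :
    comp (Module.Dual.eval ℝ 𝔤 v) (pullMap ρ α) = pair α (ρ v) := rfl

/-- The map `M → 𝔤 ⊕ 𝔤^*` of a section of `𝔤 ⊕ T^*M`, with a sign on the second component. -/
def toDouble (a : SmoothMap E M 𝔤 × OneForm E M) : SmoothMap E M (𝔤 × Module.Dual ℝ 𝔤) :=
  -- The sign turns i_μ F(v) in the double into the term -i_{ρ^*α} F(v) of the bracket, and drops
  -- out of χ(ρ^*α, ρ^*β).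
  postcomp (LinearMap.inl ℝ _ _) a.1 - postcomp (LinearMap.inr ℝ _ _) (pullMap ρ a.2)

theorem toDouble_apply (a : SmoothMap E M 𝔤 × OneForm E M) (x : M) :
    (toDouble ρ a).1 x = (a.1.1 x, -pull ρ x (a.2 x)) := by
  refine Prod.ext ?_ ?_
  · change a.1.1 x - 0 = a.1.1 x
    rw [sub_zero]
  · change 0 - pull ρ x (a.2 x) = -pull ρ x (a.2 x)
    rw [zero_sub]

theorem toDouble_add (a b : SmoothMap E M 𝔤 × OneForm E M) :
    toDouble ρ (a + b) = toDouble ρ a + toDouble ρ b := by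
  refine Subtype.ext (funext fun x => ?_)
  change (toDouble ρ (a + b)).1 x = (toDouble ρ a).1 x + (toDouble ρ b).1 x
  simp only [toDouble_apply]
  change (_, -(pull ρ x (a.2 x) + pull ρ x (b.2 x))) = _
  rw [neg_add]
  rfl

theorem toDouble_smul (f : SmoothFun E M) (a : SmoothMap E M 𝔤 × OneForm E M) :
    toDouble ρ (f • a) = f • toDouble ρ a := by
  refine Subtype.ext (funext fun x => ?_)
  change (toDouble ρ (f • a)).1 x = f x • (toDouble ρ a).1 x
  simp only [toDouble_apply]
  change (_, -(f x • pull ρ x (a.2 x))) = _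
  exact Prod.ext rfl (smul_neg (f x) _).symm

/-- The action of a map `u : M → 𝔤` on one-forms, extending the Lie derivatives along `ρ`
linearly over the functions. -/
def actForm (u : SmoothMap E M 𝔤) (β : OneForm E M) : OneForm E M :=
  ∑ i, comp ((Module.finBasis ℝ 𝔤).coord i) u • lieForm (ρ (Module.finBasis ℝ 𝔤 i)) β

theorem actForm_add_left (u v : SmoothMap E M 𝔤) (β : OneForm E M) :
    actForm ρ (u + v) β = actForm ρ u β + actForm ρ v β := by
  simp only [actForm, comp_add, oneForm_add_smul, Finset.sum_add_distrib]

theorem actForm_smul_left (f : SmoothFun E M) (u : SmoothMap E M 𝔤) (β : OneForm E M) :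
    actForm ρ (f • u) β = f • actForm ρ u β := by
  simp only [actForm, comp_smul, oneForm_mul_smul, Finset.smul_sum]

theorem sum_comp_smul (u : SmoothMap E M 𝔤) :
    ∑ i, comp ((Module.finBasis ℝ 𝔤).coord i) u • constMap E M (Module.finBasis ℝ 𝔤 i) = u := by
  refine Subtype.ext (funext fun x => ?_)
  simp only [AddSubmonoidClass.coe_finsetSum, Finset.sum_apply, smoothMap_smul_apply, comp_apply]
  exact (Module.finBasis ℝ 𝔤).sum_repr (u.1 x)

theorem actionMap_constMap (v : 𝔤) : actionMap ρ (constMap E M v) = ρ v := by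
  ext x
  rfl

theorem actionMap_add (u v : SmoothMap E M 𝔤) :
    actionMap ρ (u + v) = actionMap ρ u + actionMap ρ v := by
  ext x
  change ρ (u.1 x + v.1 x) x = ρ (u.1 x) x + ρ (v.1 x) x
  rw [map_add]
  rfl

theorem actionMap_smul (f : SmoothFun E M) (u : SmoothMap E M 𝔤) :
    actionMap ρ (f • u) = f • actionMap ρ u := by
  ext x
  change ρ (f x • u.1 x) x = f x • ρ (u.1 x) x
  rw [map_smul]
  rfl

/-- The action on maps to `𝔤` as a linear map over the functions. -/
def actionMapₗ : SmoothMap E M 𝔤 →ₗ[SmoothFun E M] VField E M where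
  toFun := actionMap ρ
  map_add' := actionMap_add ρ
  map_smul' := actionMap_smul ρ

theorem sum_comp_smul_vfield (u : SmoothMap E M 𝔤) :
    ∑ i, comp ((Module.finBasis ℝ 𝔤).coord i) u • ρ (Module.finBasis ℝ 𝔤 i) = actionMap ρ u := by
  have h := congrArg (actionMapₗ ρ) (sum_comp_smul u)
  simp only [map_sum, map_smul] at h
  simp only [← actionMap_constMap ρ]
  exact h

theorem anchor_eq (a : SmoothMap E M 𝔤 × OneForm E M) :
    anchor ρ P a = actionMap ρ a.1 + P.sharpForm a.2 := rfl

theorem anchor_const (v : 𝔤) : anchor ρ P (constMap E M v, 0) = ρ v := by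
  ext x
  change ρ v x + P.sharp x 0 = ρ v x
  rw [map_zero, add_zero]

theorem anchor_form (α : OneForm E M) : anchor ρ P (0, α) = P.sharpForm α := by
  ext x
  change ρ 0 x + P.sharp x (α x) = P.sharp x (α x)
  rw [map_zero]
  exact zero_add _

theorem lieFun_sum_left {ι : Type*} (s : Finset ι) (X : ι → VField E M) (f : SmoothFun E M) :
    lieFun (∑ i ∈ s, X i) f = ∑ i ∈ s, lieFun (X i) f :=
  map_sum (⟨⟨fun X => lieFun X f, lieFun_zero_left f⟩, fun X Y => lieFun_add_left X Y f⟩ :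
    VField E M →+ SmoothFun E M) X s

variable [T2Space M]

theorem actForm_add (u : SmoothMap E M 𝔤) (β γ : OneForm E M) :
    actForm ρ u (β + γ) = actForm ρ u β + actForm ρ u γ := by
  simp only [actForm, lieForm_add, oneForm_smul_add, Finset.sum_add_distrib]

theorem actForm_smul (u : SmoothMap E M 𝔤) (f : SmoothFun E M) (β : OneForm E M) :
    actForm ρ u (f • β) = f • actForm ρ u β + lieFun (actionMap ρ u) f • β := by
  rw [← sum_comp_smul_vfield ρ u, lieFun_sum_left, actForm, actForm, Finset.smul_sum]
  have h := Finset.sum_smul (s := Finset.univ) (f := fun i => lieFun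
    (comp ((Module.finBasis ℝ 𝔤).coord i) u • ρ (Module.finBasis ℝ 𝔤 i)) f) (x := β)
  refine Eq.trans ?_ (congrArg _ h.symm)
  rw [← Finset.sum_add_distrib]
  refine Finset.sum_congr rfl fun i _ => ?_
  rw [lieForm_smul, lieFun_smul_left]
  module

/-- Function coefficients pull out of L_X only up to a multiple of their differential. Here they are
constant, so the basis expansion recombines. -/
theorem actForm_const (v : 𝔤) (β : OneForm E M) : actForm ρ (constMap E M v) β = lieForm (ρ v) β := by
  refine oneForm_ext fun Y => ?_
  rw [actForm, pair_sum_left]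
  have h1 := sum_comp_smul_vfield ρ (constMap E M v)
  rw [actionMap_constMap] at h1
  have h2 : ∀ i, comp ((Module.finBasis ℝ 𝔤).coord i) (constMap E M v) =
      constFun ((Module.finBasis ℝ 𝔤).coord i v) := fun i => rfl
  simp only [h2] at h1 ⊢
  have h3 : ∀ (c : ℝ) (X : VField E M), lieForm ((constFun c : SmoothFun E M) • X) β =
      (constFun c : SmoothFun E M) • lieForm X β := fun c X => by
    have : extd (constFun c : SmoothFun E M) = 0 :=
      oneForm_ext fun X => by rw [pair_extd, lieFun_const, pair_zero_left]
    rw [lieForm_smul_left, this, oneForm_smul_zero, add_zero]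
  rw [← pair_sum_left]
  simp only [← h3]
  have h4 := map_sum (⟨⟨fun X => lieForm X β, by simpa using lieForm_add_left 0 0 β⟩,
    fun X Y => lieForm_add_left X Y β⟩ : VField E M →+ OneForm E M)
    (fun i => (constFun ((Module.finBasis ℝ 𝔤).coord i v) : SmoothFun E M) •
      ρ (Module.finBasis ℝ 𝔤 i)) Finset.univ
  exact congrArg (fun γ => pair γ Y) (h4.symm.trans (congrArg (fun X => lieForm X β) h1))

/-- The bracket on sections of `𝔤 ⊕ T^*M`. -/
def sectionBracket (a b : SmoothMap E M 𝔤 × OneForm E M) : SmoothMap E M 𝔤 × OneForm E M :=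
  -- The derivative terms are those forced by the Leibniz rule and vanish on constants. The rest of
  -- the 𝔤-component is tensorial.
  (lieMap (anchor ρ P a) b.1 - lieMap (anchor ρ P b) a.1 +
      postcomp (LinearMap.fst ℝ _ _) (bilin (doubleₗ F χ) (toDouble ρ a) (toDouble ρ b)),
    actForm ρ a.1 b.2 - actForm ρ b.1 a.2 + formBracket P a.2 b.2)

end Bracket

/-! ### Linearity over functions of pointwise operations. -/

section PointwiseBilinear

variable {E : Type*} [NormedAddCommGroup E] [NormedSpace ℝ E]
  {M : Type*} [TopologicalSpace M] [ChartedSpace E M]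
  {W₁ W₂ W₃ : Type*} [AddCommGroup W₁] [Module ℝ W₁] [FiniteDimensional ℝ W₁]
  [AddCommGroup W₂] [Module ℝ W₂] [FiniteDimensional ℝ W₂]
  [AddCommGroup W₃] [Module ℝ W₃]

theorem bilin_add (B : W₁ →ₗ[ℝ] W₂ →ₗ[ℝ] W₃) (v : SmoothMap E M W₁) (w w' : SmoothMap E M W₂) :
    bilin B v (w + w') = bilin B v w + bilin B v w' :=
  Subtype.ext (funext fun x => map_add (B (v.1 x)) (w.1 x) (w'.1 x))

theorem bilin_smul (B : W₁ →ₗ[ℝ] W₂ →ₗ[ℝ] W₃) (f : SmoothFun E M) (v : SmoothMap E M W₁)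
    (w : SmoothMap E M W₂) : bilin B v (f • w) = f • bilin B v w :=
  Subtype.ext (funext fun x => map_smul (B (v.1 x)) (f x) (w.1 x))

omit [FiniteDimensional ℝ W₁] [FiniteDimensional ℝ W₂] in
theorem postcomp_add (L : W₁ →ₗ[ℝ] W₂) (v w : SmoothMap E M W₁) :
    postcomp L (v + w) = postcomp L v + postcomp L w :=
  Subtype.ext (funext fun x => map_add L (v.1 x) (w.1 x))

omit [FiniteDimensional ℝ W₁] [FiniteDimensional ℝ W₂] in
theorem postcomp_smul (L : W₁ →ₗ[ℝ] W₂) (f : SmoothFun E M) (v : SmoothMap E M W₁) :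
    postcomp L (f • v) = f • postcomp L v :=
  Subtype.ext (funext fun x => map_smul L (f x) (v.1 x))

omit [FiniteDimensional ℝ W₁] [FiniteDimensional ℝ W₂] in
theorem postcomp_neg (L : W₁ →ₗ[ℝ] W₂) (v : SmoothMap E M W₁) :
    postcomp L (-v) = -postcomp L v :=
  Subtype.ext (funext fun x => map_neg L (v.1 x))

end PointwiseBilinear

/-! ### Existence and uniqueness of the bracket. -/

section BracketRules

set_option linter.unusedSectionVars false

variable {E : Type*} [NormedAddCommGroup E] [NormedSpace ℝ E] [FiniteDimensional ℝ E]
  {M : Type*} [TopologicalSpace M] [ChartedSpace E M] [IsManifold 𝓘(ℝ, E) ∞ M]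
  {𝔤 : Type*} [LieRing 𝔤] [LieAlgebra ℝ 𝔤] [FiniteDimensional ℝ 𝔤]
  (F : 𝔤 →ₗ[ℝ] (Module.Dual ℝ 𝔤) [⋀^Fin 2]→ₗ[ℝ] ℝ)
  (χ : (Module.Dual ℝ 𝔤) [⋀^Fin 3]→ₗ[ℝ] ℝ)
  (ρ : 𝔤 →ₗ[ℝ] VField E M) (P : Bivector E M)

theorem bilin_double_swap (s t : SmoothMap E M (𝔤 × Module.Dual ℝ 𝔤)) :
    bilin (doubleₗ F χ) t s = -bilin (doubleₗ F χ) s t :=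
  Subtype.ext (funext fun x => doubleBracket_swap F χ (s.1 x) (t.1 x))

theorem constFun_smul_section (c : ℝ) (a : SmoothMap E M 𝔤 × OneForm E M) :
    (constFun c : SmoothFun E M) • a = c • a := rfl

theorem section_zero_smul (a : SmoothMap E M 𝔤 × OneForm E M) : (0 : SmoothFun E M) • a = 0 :=
  Prod.ext (zero_smul (SmoothFun E M) a.1) (ContMDiffSection.ext fun x => zero_smul ℝ (a.2 x))

theorem eq_zero_of_eq_neg {W : Type*} [AddCommGroup W] [Module ℝ W] {x : W} (h : x = -x) :
    x = 0 := by
  have h2 : (2 : ℝ) • x = 0 := by rw [two_smul, ← eq_neg_iff_add_eq_zero]; exact h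
  exact (smul_eq_zero.1 h2).resolve_left two_ne_zero

theorem neg_smul_of_eq_neg {W : Type*} [AddCommGroup W] [Module ℝ W] (c : ℝ) {x y : W}
    (h : y = -x) : -(c • x) = c • y := by
  rw [h, smul_neg]

theorem lieMap_zero_map (X : VField E M) : lieMap X (0 : SmoothMap E M 𝔤) = 0 := by
  simpa using lieMap_sub X (0 : SmoothMap E M 𝔤) 0

theorem toDouble_const (v : 𝔤) : toDouble ρ (constMap E M v, 0) = constMap E M (v, 0) := by
  refine Subtype.ext (funext fun x => (toDouble_apply ρ _ x).trans ?_)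
  exact Prod.ext rfl neg_zero

theorem toDouble_form_apply (α : OneForm E M) (x : M) :
    (toDouble ρ (0, α)).1 x = (0, -pull ρ x (α x)) := toDouble_apply ρ _ x

theorem doubleBracket_const_const (u v : 𝔤) :
    doubleBracket F χ (u, 0) (v, 0) = (⁅u, v⁆, 0) := by
  refine Prod.ext ?_ ?_
  · change ⁅u, v⁆ + contract₂ₗ F u 0 - contract₂ₗ F v 0 + contract₃ₗ χ 0 0 = ⁅u, v⁆
    simp only [map_zero, add_zero, sub_zero]
  · ext w
    simp [doubleBracket, coad, cobracketDual]
    exact (F w).map_coord_zero 0 rfl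

theorem doubleBracket_const_form (u : 𝔤) (μ : Module.Dual ℝ 𝔤) :
    doubleBracket F χ (u, 0) (0, μ) = (contract₂ (F u) μ, coad u μ) := by
  refine Prod.ext ?_ ?_
  · change ⁅u, (0 : 𝔤)⁆ + contract₂ₗ F u μ - contract₂ₗ F 0 0 + contract₃ₗ χ 0 μ = contract₂ₗ F u μ
    simp only [map_zero, LinearMap.zero_apply, add_zero, sub_zero, lie_zero, zero_add]
  · ext w
    simp [doubleBracket, coad, cobracketDual]
    exact (F w).map_coord_zero 0 rfl

theorem doubleBracket_form_form (μ ν : Module.Dual ℝ 𝔤) :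
    doubleBracket F χ (0, μ) (0, ν) = (contract₃ χ μ ν, cobracketDual F μ ν) := by
  refine Prod.ext ?_ ?_
  · change ⁅(0 : 𝔤), (0 : 𝔤)⁆ + contract₂ₗ F 0 ν - contract₂ₗ F 0 μ + contract₃ₗ χ μ ν =
      contract₃ₗ χ μ ν
    simp only [map_zero, LinearMap.zero_apply, add_zero, sub_zero, lie_zero, zero_add]
  · ext w
    simp [doubleBracket, coad]

variable [T2Space M]

theorem formBracket_swap (α β : OneForm E M) : formBracket P β α = -formBracket P α β := by
  have h := formBracket_self P (α + β)
  rw [formBracket_add, formBracket_add_left, formBracket_add_left, formBracket_self,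
    formBracket_self, zero_add, add_zero] at h
  exact eq_neg_of_add_eq_zero_left h

theorem sectionBracket_swap (a b : SmoothMap E M 𝔤 × OneForm E M) :
    sectionBracket F χ ρ P b a = -sectionBracket F χ ρ P a b := by
  refine Prod.ext ?_ ?_
  · simp only [sectionBracket, Prod.fst_neg]
    rw [bilin_double_swap F χ (toDouble ρ a), postcomp_neg]
    abel
  · simp only [sectionBracket, Prod.snd_neg]
    rw [formBracket_swap P a.2]
    abel

theorem sectionBracket_add (a b c : SmoothMap E M 𝔤 × OneForm E M) :
    sectionBracket F χ ρ P a (b + c) = sectionBracket F χ ρ P a b + sectionBracket F χ ρ P a c := by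
  refine Prod.ext ?_ ?_
  · simp only [sectionBracket, Prod.fst_add, map_add, lieMap_add, lieMap_add_left, toDouble_add,
      bilin_add, postcomp_add]
    abel
  · simp only [sectionBracket, Prod.snd_add, Prod.fst_add, actForm_add, actForm_add_left,
      formBracket_add]
    abel

theorem sectionBracket_leibniz (a b : SmoothMap E M 𝔤 × OneForm E M) (f : SmoothFun E M) :
    sectionBracket F χ ρ P a (f • b) =
      f • sectionBracket F χ ρ P a b + lieFun (anchor ρ P a) f • b := by
  refine Prod.ext ?_ ?_
  · simp only [sectionBracket, Prod.fst_add, Prod.smul_fst, map_smul, lieMap_smul,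
      lieMap_smul_left, toDouble_smul, bilin_smul, postcomp_smul]
    module
  · simp only [sectionBracket, Prod.snd_add, Prod.smul_snd, Prod.smul_fst, actForm_smul,
      actForm_smul_left, formBracket_smul, anchor_eq, lieFun_add_left, oneForm_add_smul]
    module

/-- The Leibniz rule for a constant function, whose derivative vanishes. -/
theorem sectionBracket_real_smul (c : ℝ) (a b : SmoothMap E M 𝔤 × OneForm E M) :
    sectionBracket F χ ρ P a (c • b) = c • sectionBracket F χ ρ P a b := by
  rw [← constFun_smul_section, sectionBracket_leibniz, lieFun_const, ← constFun_smul_section]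
  rw [section_zero_smul, add_zero]

theorem sectionBracket_real_smul_left (c : ℝ) (a b : SmoothMap E M 𝔤 × OneForm E M) :
    sectionBracket F χ ρ P (c • a) b = c • sectionBracket F χ ρ P a b := by
  rw [sectionBracket_swap, sectionBracket_real_smul]
  exact neg_smul_of_eq_neg c (sectionBracket_swap F χ ρ P b a)

/-- The bracket on sections of `𝔤 ⊕ T^*M` as a bilinear map. -/
def sectionBracketₗ : (SmoothMap E M 𝔤 × OneForm E M) →ₗ[ℝ] (SmoothMap E M 𝔤 × OneForm E M) →ₗ[ℝ]
    (SmoothMap E M 𝔤 × OneForm E M) :=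
  LinearMap.mk₂ ℝ (sectionBracket F χ ρ P)
    (fun a b c => by
      rw [sectionBracket_swap, sectionBracket_add, neg_add, ← sectionBracket_swap,
        ← sectionBracket_swap])
    (sectionBracket_real_smul_left F χ ρ P) (sectionBracket_add F χ ρ P) (sectionBracket_real_smul F χ ρ P)

theorem isQuasiPoissonBracket_sectionBracketₗ :
    IsQuasiPoissonBracket F χ ρ P (sectionBracketₗ F χ ρ P) where
  skew a := eq_zero_of_eq_neg (sectionBracket_swap F χ ρ P a a)
  leibniz := sectionBracket_leibniz F χ ρ P
  const_const u v := by
    change sectionBracket F χ ρ P _ _ = _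
    refine Prod.ext ?_ ?_
    · simp only [sectionBracket, lieMap_const, toDouble_const, sub_zero, zero_add]
      exact Subtype.ext (funext fun x => congrArg Prod.fst (doubleBracket_const_const F χ u v))
    · simp only [sectionBracket, actForm_const, lieForm_zero, formBracket_self, sub_zero, add_zero]
  const_form_fst v α x := by
    change (sectionBracket F χ ρ P _ _).1.1 x = _
    simp only [sectionBracket, lieMap_const, lieMap_zero_map, toDouble_const, sub_zero, zero_add]
    change (doubleBracket F χ (v, 0) ((toDouble ρ (0, α)).1 x)).1 = _
    rw [toDouble_form_apply, doubleBracket_const_form]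
    exact map_neg (contract₂ₗ F v) _
  const_form_snd v α := by
    change (sectionBracket F χ ρ P _ _).2 = _
    have h1 : actForm ρ (0 : SmoothMap E M 𝔤) (0 : OneForm E M) = 0 := by
      simpa using actForm_add_left ρ 0 0 (0 : OneForm E M)
    have h2 : formBracket P 0 α = 0 := by simpa using formBracket_add_left P 0 0 α
    simp only [sectionBracket, actForm_const, h1, h2, sub_zero, add_zero]
  form_form_fst α β x := by
    change (sectionBracket F χ ρ P _ _).1.1 x = _
    simp only [sectionBracket, lieMap_zero_map, sub_zero, zero_add]
    change (doubleBracket F χ ((toDouble ρ (0, α)).1 x) ((toDouble ρ (0, β)).1 x)).1 = _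
    rw [toDouble_form_apply, toDouble_form_apply, doubleBracket_form_form]
    change contract₃ₗ χ _ _ = contract₃ₗ χ _ _
    simp only [map_neg, LinearMap.neg_apply, neg_neg]
  form_form_snd α β := by
    change (sectionBracket F χ ρ P _ _).2 = _
    have h1 : ∀ β : OneForm E M, actForm ρ (0 : SmoothMap E M 𝔤) β = 0 := fun β => by
      simpa using actForm_add_left ρ 0 0 β
    simp only [sectionBracket, h1, sub_zero, zero_add]

variable {F χ ρ P}

theorem IsQuasiPoissonBracket.swap {br : (SmoothMap E M 𝔤 × OneForm E M) →ₗ[ℝ]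
    (SmoothMap E M 𝔤 × OneForm E M) →ₗ[ℝ] (SmoothMap E M 𝔤 × OneForm E M)}
    (h : IsQuasiPoissonBracket F χ ρ P br) (a b) : br b a = -br a b := by
  have h1 := h.skew (a + b)
  rw [map_add, map_add, LinearMap.add_apply, LinearMap.add_apply, h.skew, h.skew, zero_add,
    add_zero] at h1
  exact eq_neg_of_add_eq_zero_left h1

theorem section_decomp (a : SmoothMap E M 𝔤 × OneForm E M) :
    a = ∑ i, comp ((Module.finBasis ℝ 𝔤).coord i) a.1 •
      ((constMap E M (Module.finBasis ℝ 𝔤 i), 0) : SmoothMap E M 𝔤 × OneForm E M) + (0, a.2) := by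
  refine Prod.ext ?_ ?_
  · simp only [Prod.fst_add, Prod.fst_sum, Prod.smul_fst, add_zero]
    exact (sum_comp_smul a.1).symm
  · simp only [Prod.snd_add, Prod.snd_sum, Prod.smul_snd, oneForm_smul_zero, Finset.sum_const_zero,
      zero_add]

/-- A basis of 𝔤 writes every section as a combination of constant maps with function coefficients
plus a one-form, so additivity and function multiples suffice. -/
theorem section_induction {p : SmoothMap E M 𝔤 × OneForm E M → Prop}
    (hadd : ∀ a b, p a → p b → p (a + b)) (hsmul : ∀ (f : SmoothFun E M) a, p a → p (f • a))
    (hconst : ∀ v, p (constMap E M v, 0)) (hform : ∀ α, p (0, α)) (a) : p a := by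
  rw [section_decomp a]
  refine hadd _ _ ?_ (hform _)
  refine Finset.sum_induction _ p hadd ?_ fun i _ => hsmul _ _ (hconst _)
  exact hform 0

/-- Agreement in the second slot propagates from generators by the Leibniz rule, and skewness moves
it to the first slot. -/
theorem IsQuasiPoissonBracket.unique {br br' : (SmoothMap E M 𝔤 × OneForm E M) →ₗ[ℝ]
    (SmoothMap E M 𝔤 × OneForm E M) →ₗ[ℝ] (SmoothMap E M 𝔤 × OneForm E M)}
    (h : IsQuasiPoissonBracket F χ ρ P br) (h' : IsQuasiPoissonBracket F χ ρ P br') :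
    br' = br := by
  have hsmul : ∀ a b (f : SmoothFun E M), br' a b = br a b → br' a (f • b) = br a (f • b) :=
    fun a b f e => by rw [h.leibniz, h'.leibniz, e]
  have hsymm : ∀ a b, br' a b = br a b → br' b a = br b a := fun a b e => by
    rw [h.swap a b, h'.swap a b, e]
  have hcf : ∀ v α, br' (constMap E M v, 0) (0, α) = br (constMap E M v, 0) (0, α) := fun v α =>
    Prod.ext (Subtype.ext (funext fun x => by rw [h.const_form_fst, h'.const_form_fst]))
      (by rw [h.const_form_snd, h'.const_form_snd])
  have key : ∀ a, (∀ v, br' a (constMap E M v, 0) = br a (constMap E M v, 0)) →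
      (∀ α, br' a (0, α) = br a (0, α)) → ∀ b, br' a b = br a b := fun a h1 h2 b =>
    section_induction (p := fun b => br' a b = br a b)
      (fun b c hb hc => by rw [map_add, map_add, hb, hc]) (fun f b hb => hsmul a b f hb) h1 h2 b
  have hc : ∀ v b, br' (constMap E M v, 0) b = br (constMap E M v, 0) b := fun v =>
    key _ (fun u => by rw [h.const_const, h'.const_const]) (hcf v)
  have hf : ∀ α b, br' (0, α) b = br (0, α) b := fun α =>
    key _ (fun u => hsymm _ _ (hcf u α)) fun β =>
      Prod.ext (Subtype.ext (funext fun x => by rw [h.form_form_fst, h'.form_form_fst]))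
        (by rw [h.form_form_snd, h'.form_form_snd])
  refine LinearMap.ext fun a => LinearMap.ext fun b => ?_
  exact key a (fun v => hsymm _ _ (hc v a)) (fun α => hsymm _ _ (hf α a)) b

end BracketRules

/-! ### The anchor defect and the quasi-Poisson equations. -/

section Anchor

set_option linter.unusedSectionVars false

variable {E : Type*} [NormedAddCommGroup E] [NormedSpace ℝ E] [FiniteDimensional ℝ E]
  {M : Type*} [TopologicalSpace M] [ChartedSpace E M] [IsManifold 𝓘(ℝ, E) ∞ M] [T2Space M]
  {𝔤 : Type*} [LieRing 𝔤] [LieAlgebra ℝ 𝔤] [FiniteDimensional ℝ 𝔤]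
  {F : 𝔤 →ₗ[ℝ] (Module.Dual ℝ 𝔤) [⋀^Fin 2]→ₗ[ℝ] ℝ}
  {χ : (Module.Dual ℝ 𝔤) [⋀^Fin 3]→ₗ[ℝ] ℝ}
  {ρ : 𝔤 →ₗ[ℝ] VField E M} {P : Bivector E M}

/-- A tensorial map on sections of `𝔤 ⊕ T^*M` vanishes if it vanishes on constant maps and on exact
one-forms. -/
theorem eq_zero_of_const_of_extd {F' : Type*} [NormedAddCommGroup F'] [NormedSpace ℝ F']
    {V : M → Type*} [TopologicalSpace (TotalSpace F' V)] [∀ x, TopologicalSpace (V x)]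
    [FiberBundle F' V] [∀ x, AddCommGroup (V x)] [∀ x, Module ℝ (V x)] [VectorBundle ℝ F' V]
    {T : SmoothMap E M 𝔤 × OneForm E M → Cₛ^∞⟮𝓘(ℝ, E); F', V⟯}
    (hadd : ∀ a b, T (a + b) = T a + T b) (hsmul : ∀ (f : SmoothFun E M) a, T (f • a) = f • T a)
    (hconst : ∀ v, T (constMap E M v, 0) = 0) (hextd : ∀ f, T (0, extd f) = 0) (a) : T a = 0 := by
  have h0 : ∀ (f : SmoothFun E M), f • (0 : Cₛ^∞⟮𝓘(ℝ, E); F', V⟯) = 0 := fun f =>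
    ContMDiffSection.ext fun x => smul_zero (f x)
  refine section_induction (p := fun a => T a = 0) (fun a b ha hb => by rw [hadd, ha, hb, add_zero])
    (fun f a ha => by rw [hsmul, ha, h0]) hconst (fun α => ?_) a
  ext x
  -- Exact forms generate only locally: T kills ψ • α, and since T is tensorial with ψ(x) = 1,
  -- evaluation at x gives the claim for α.
  obtain ⟨ψ, hψ, hspan⟩ := exists_smul_mem_span_extd α x
  have key : T (0, ψ • α) = 0 := by
    refine Submodule.span_induction (p := fun β _ => T (0, β) = 0) ?_ ?_ ?_ ?_ hspan
    · rintro _ ⟨f, rfl⟩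
      exact hextd f
    · exact hconst 0
    · intro β γ _ _ hβ hγ
      have := hadd (0, β) (0, γ)
      rw [hβ, hγ, add_zero, Prod.mk_add_mk, add_zero] at this
      exact this
    · intro f β _ hβ
      have := hsmul f (0, β)
      rw [hβ, h0, Prod.smul_mk, smul_zero] at this
      exact this
  have h1 : T (0, ψ • α) = ψ • T (0, α) := by
    rw [← hsmul, Prod.smul_mk, smul_zero]
  have h2 : (T (0, ψ • α)) x = ψ x • T (0, α) x := by rw [h1]; rfl
  rw [key, hψ, one_smul] at h2
  exact h2.symm

variable (F χ ρ P) in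
/-- The failure of the anchor to intertwine the brackets. -/
def anchorDefect (a b : SmoothMap E M 𝔤 × OneForm E M) : VField E M :=
  anchor ρ P (sectionBracketₗ F χ ρ P a b) - lieField (anchor ρ P a) (anchor ρ P b)

theorem sectionBracketₗ_swap (a b : SmoothMap E M 𝔤 × OneForm E M) :
    sectionBracketₗ F χ ρ P b a = -sectionBracketₗ F χ ρ P a b := sectionBracket_swap F χ ρ P a b

theorem sectionBracketₗ_leibniz (a b : SmoothMap E M 𝔤 × OneForm E M) (f : SmoothFun E M) :
    sectionBracketₗ F χ ρ P a (f • b) =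
      f • sectionBracketₗ F χ ρ P a b + lieFun (anchor ρ P a) f • b :=
  sectionBracket_leibniz F χ ρ P a b f

theorem anchorDefect_swap (a b : SmoothMap E M 𝔤 × OneForm E M) :
    anchorDefect F χ ρ P b a = -anchorDefect F χ ρ P a b := by
  rw [anchorDefect, anchorDefect, sectionBracketₗ_swap, lieField_swap, map_neg]
  abel

theorem anchorDefect_add (a b c : SmoothMap E M 𝔤 × OneForm E M) :
    anchorDefect F χ ρ P a (b + c) = anchorDefect F χ ρ P a b + anchorDefect F χ ρ P a c := by
  simp only [anchorDefect, map_add, lieField_add_right]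
  abel

/-- Both brackets satisfy the Leibniz rule with the same vector field r(a), so the terms that
differentiate f cancel. -/
theorem anchorDefect_smul (a b : SmoothMap E M 𝔤 × OneForm E M) (f : SmoothFun E M) :
    anchorDefect F χ ρ P a (f • b) = f • anchorDefect F χ ρ P a b := by
  simp only [anchorDefect, sectionBracketₗ_leibniz, map_add, map_smul, lieField_smul_right]
  module

/-- Skewness carries tensoriality from the second slot to the first, so each slot can be reduced to
generators in turn. -/
theorem eq_zero_of_swap_of_generators {F' : Type*} [NormedAddCommGroup F'] [NormedSpace ℝ F']
    {V : M → Type*} [TopologicalSpace (TotalSpace F' V)] [∀ x, TopologicalSpace (V x)]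
    [FiberBundle F' V] [∀ x, AddCommGroup (V x)] [∀ x, Module ℝ (V x)] [VectorBundle ℝ F' V]
    {T : SmoothMap E M 𝔤 × OneForm E M → SmoothMap E M 𝔤 × OneForm E M → Cₛ^∞⟮𝓘(ℝ, E); F', V⟯}
    (hswap : ∀ a b, T b a = -T a b)
    (hadd : ∀ a b c, T a (b + c) = T a b + T a c)
    (hsmul : ∀ a b (f : SmoothFun E M), T a (f • b) = f • T a b)
    (hcc : ∀ u v, T (constMap E M u, 0) (constMap E M v, 0) = 0)
    (hcd : ∀ v f, T (constMap E M v, 0) (0, extd f) = 0)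
    (hdd : ∀ f g, T (0, extd f) (0, extd g) = 0) (a b) : T a b = 0 := by
  have h0 : ∀ a b, T a b = 0 → T b a = 0 := fun a b h => by rw [hswap, h, neg_zero]
  have hc : ∀ v b, T (constMap E M v, 0) b = 0 := fun v =>
    eq_zero_of_const_of_extd (hadd _) (fun f b => hsmul _ b f) (hcc v) (hcd v)
  have hd : ∀ f b, T (0, extd f) b = 0 := fun f =>
    eq_zero_of_const_of_extd (hadd _) (fun f b => hsmul _ b f)
      (fun v => h0 _ _ (hc v _)) (hdd f)
  exact eq_zero_of_const_of_extd (hadd a) (fun f b => hsmul a b f)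
    (fun v => h0 _ _ (hc v _)) (fun f => h0 _ _ (hd f _)) b

theorem sectionBracketₗ_const_const (u v : 𝔤) : sectionBracketₗ F χ ρ P (constMap E M u, 0)
    (constMap E M v, 0) = (constMap E M ⁅u, v⁆, 0) :=
  (isQuasiPoissonBracket_sectionBracketₗ F χ ρ P).const_const u v

theorem pair_actionMap (u : SmoothMap E M 𝔤) (β : OneForm E M) (x : M) :
    pair β (actionMap ρ u) x = pull ρ x (β x) (u.1 x) := rfl

/-- The term β([ρ(v), π^♯(α)]) is rewritten through L_{ρ(v)} β, which assembles L_{ρ(v)} π.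
Vanishing of this expression is the first quasi-Poisson equation. -/
theorem pair_anchorDefect_const_form (v : 𝔤) (α β : OneForm E M) (x : M) :
    pair β (anchorDefect F χ ρ P (constMap E M v, 0) (0, α)) x =
      -F v ![pull ρ x (α x), pull ρ x (β x)] - lieBivector (ρ v) P α β x := by
  have hb := isQuasiPoissonBracket_sectionBracketₗ F χ ρ P
  have h1 : pair β (lieField (ρ v) (P.sharpForm α)) =
      lieFun (ρ v) (P.eval α β) - P.eval α (lieForm (ρ v) β) := by
    rw [Bivector.eval, Bivector.eval, pair_lieForm, sub_sub_cancel]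
  rw [anchorDefect, anchor_const, anchor_form, pair_sub_right, anchor_eq, pair_add_right, h1,
    hb.const_form_snd]
  have h2 := pair_actionMap (ρ := ρ)
    (sectionBracketₗ F χ ρ P (constMap E M v, 0) (0, α)).1 β x
  rw [hb.const_form_fst, map_neg, apply_contract₂] at h2
  change pair β (actionMap ρ _) x + P.eval (lieForm (ρ v) α) β x -
    (lieFun (ρ v) (P.eval α β) x - P.eval α (lieForm (ρ v) β) x) = _ -
    (lieFun (ρ v) (P.eval α β) x - P.eval (lieForm (ρ v) α) β x - P.eval α (lieForm (ρ v) β) x)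
  rw [h2]
  ring

/-- For equal arguments the two cyclic sums coincide; skewness puts the sum in the form in which it
appears in r[df, dg] - [r(df), r(dg)]. -/
theorem half_schouten_self (f g h : SmoothFun E M) (x : M) : (1 / 2 : ℝ) * schouten P P f g h x =
    (P.bracket f (P.bracket g h) - P.bracket (P.bracket f g) h -
      P.bracket g (P.bracket f h)) x := by
  have h1 : P.bracket g (P.bracket h f) = -P.bracket g (P.bracket f h) := by
    rw [P.bracket_swap f h, Bivector.bracket_eq, lieFun_neg]; rfl
  rw [schouten, h1, P.bracket_swap (P.bracket f g) h]
  change (1 / 2 : ℝ) * ((P.bracket f (P.bracket g h) x + -P.bracket g (P.bracket f h) x +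
    -P.bracket (P.bracket f g) h x) + (P.bracket f (P.bracket g h) x +
    -P.bracket g (P.bracket f h) x + -P.bracket (P.bracket f g) h x)) =
    P.bracket f (P.bracket g h) x - P.bracket (P.bracket f g) h x - P.bracket g (P.bracket f h) x
  ring

/-- The χ-term comes from the 𝔤-component of [df, dg]; the form component d{f, g} and the commutator
of Hamiltonian fields give the Jacobiator of the bracket of functions. -/
theorem lieFun_anchorDefect_extd_extd (f g h : SmoothFun E M) (x : M) :
    lieFun (anchorDefect F χ ρ P (0, extd f) (0, extd g)) h x =
      χ ![pull ρ x (extd f x), pull ρ x (extd g x), pull ρ x (extd h x)] -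
        (1 / 2 : ℝ) * schouten P P f g h x := by
  have hb := isQuasiPoissonBracket_sectionBracketₗ F χ ρ P
  rw [half_schouten_self, anchorDefect, anchor_form, anchor_form, lieFun_sub_left, anchor_eq,
    lieFun_add_left, lieFun_lieField, hb.form_form_snd, formBracket_extd]
  have h2 := pair_actionMap (ρ := ρ)
    (sectionBracketₗ F χ ρ P (0, extd f) (0, extd g)).1 (extd h) x
  rw [hb.form_form_fst, apply_contract₃] at h2
  change pair (extd h) (actionMap ρ _) x + P.bracket (P.bracket f g) h x -
    (P.bracket f (P.bracket g h) x - P.bracket g (P.bracket f h) x) = _ -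
    (P.bracket f (P.bracket g h) x - P.bracket (P.bracket f g) h x - P.bracket g (P.bracket f h) x)
  rw [h2]
  ring

theorem IsQuasiPoisson.anchorDefect_eq_zero (hρ : IsInfinitesimalAction ρ)
    (h : IsQuasiPoisson F χ ρ P) (a b : SmoothMap E M 𝔤 × OneForm E M) :
    anchorDefect F χ ρ P a b = 0 := by
  refine eq_zero_of_swap_of_generators anchorDefect_swap anchorDefect_add anchorDefect_smul
    (fun u v => ?_) (fun v f => ?_) (fun f g => ?_) a b
  · rw [anchorDefect, sectionBracketₗ_const_const, anchor_const, anchor_const, anchor_const, hρ,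
      sub_self]
  · refine vfield_ext fun g => ?_
    rw [lieFun_zero_left, ← pair_extd]
    ext x
    rw [pair_anchorDefect_const_form, h.lie_bivector, sub_self]
    rfl
  · refine vfield_ext fun k => ?_
    rw [lieFun_zero_left]
    ext x
    rw [lieFun_anchorDefect_extd_extd, h.schouten_self, sub_self]
    rfl

theorem isQuasiPoisson_of_anchorDefect (h : ∀ a b, anchorDefect F χ ρ P a b = 0) :
    IsQuasiPoisson F χ ρ P where
  lie_bivector v α β x := by
    have h1 := pair_anchorDefect_const_form (F := F) (χ := χ) (ρ := ρ) (P := P) v α β x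
    rw [h] at h1
    have h2 : pair β (0 : VField E M) x = 0 := map_zero (β x)
    linarith
  schouten_self f g k x := by
    have h1 := lieFun_anchorDefect_extd_extd (F := F) (χ := χ) (ρ := ρ) (P := P) f g k x
    rw [h, lieFun_zero_left] at h1
    have h2 : (0 : SmoothFun E M) x = 0 := rfl
    linarith

/-- The Jacobi identity forces the anchor to be a homomorphism. -/
theorem anchorDefect_eq_zero_of_jacobi
    (h : IsLieAlgebroid (anchor ρ P) (sectionBracketₗ F χ ρ P))
    (a b : SmoothMap E M 𝔤 × OneForm E M) : anchorDefect F χ ρ P a b = 0 := by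
  refine vfield_ext fun f => ?_
  rw [lieFun_zero_left]
  -- The third argument is df, taken with and without the factor f; subtracting f times the second
  -- identity leaves D(a, b)(f) df = 0.
  have h1 := h.jacobi a b (f • (0, extd f))
  have h2 := h.jacobi a b (0, extd f)
  simp only [h.leibniz, map_add] at h1
  have h3 := congrArg Prod.snd h1
  have h4 := congrArg Prod.snd h2
  simp only [Prod.snd_add, Prod.smul_snd] at h3 h4
  have h5 : lieFun (anchorDefect F χ ρ P a b) f • extd f = 0 := by
    rw [anchorDefect, lieFun_sub_left, lieFun_lieField]
    refine oneForm_ext fun X => ?_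
    have h6 := congrArg (fun γ => pair γ X) h3
    have h7 := congrArg (fun γ => pair γ X) h4
    simp only [pair_add_left, pair_smul_left] at h6 h7
    rw [pair_smul_left, pair_zero_left]
    rw [h7] at h6
    linear_combination (-1 : SmoothFun E M) * h6
  -- Pairing with D(a, b) itself gives the square of D(a, b)(f).
  have h6 := congrArg (fun γ => pair γ (anchorDefect F χ ρ P a b)) h5
  simp only [pair_smul_left, pair_extd, pair_zero_left] at h6
  ext x
  exact mul_self_eq_zero.1 (DFunLike.congr_fun h6 x)

end Anchor

/-! ### The semidirect product of vector fields with maps to an algebra. -/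

section MapBracket

variable {E : Type*} [NormedAddCommGroup E] [NormedSpace ℝ E]
  {M : Type*} [TopologicalSpace M] [ChartedSpace E M] [IsManifold 𝓘(ℝ, E) ∞ M]
  {W W' : Type*} [AddCommGroup W] [Module ℝ W] [FiniteDimensional ℝ W]
  [AddCommGroup W'] [Module ℝ W'] [FiniteDimensional ℝ W'] (B : W →ₗ[ℝ] W →ₗ[ℝ] W)

/-- The pointwise product of two maps to an algebra, corrected by their derivatives along two
vector fields. -/
def mapBracket (X Y : VField E M) (s t : SmoothMap E M W) : SmoothMap E M W :=
  bilin B s t + lieMap X t - lieMap Y s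

theorem mapBracket_swap (hB : ∀ s t : SmoothMap E M W, bilin B t s = -bilin B s t)
    (X Y : VField E M) (s t : SmoothMap E M W) :
    mapBracket B Y X t s = -mapBracket B X Y s t := by
  rw [mapBracket, mapBracket, hB s t]
  abel

theorem mapBracket_add (X Y Z : VField E M) (s t u : SmoothMap E M W) :
    mapBracket B X (Y + Z) s (t + u) = mapBracket B X Y s t + mapBracket B X Z s u := by
  simp only [mapBracket, bilin_add, lieMap_add, lieMap_add_left]
  abel

theorem mapBracket_smul (X Y : VField E M) (s t : SmoothMap E M W) (f : SmoothFun E M) :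
    mapBracket B X (f • Y) s (f • t) = f • mapBracket B X Y s t + lieFun X f • t := by
  simp only [mapBracket, bilin_smul, lieMap_smul, lieMap_smul_left]
  module

theorem postcomp_mapBracket (L : W →ₗ[ℝ] W') (X Y : VField E M) (s t : SmoothMap E M W) :
    postcomp L (mapBracket B X Y s t) =
      lieMap X (postcomp L t) - lieMap Y (postcomp L s) + postcomp L (bilin B s t) := by
  rw [mapBracket, sub_eq_add_neg, postcomp_add, postcomp_add, postcomp_neg, lieMap_postcomp,
    lieMap_postcomp]
  abel

theorem comp_mapBracket (μ : Module.Dual ℝ W) (X Y : VField E M) (s t : SmoothMap E M W) :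
    comp μ (mapBracket B X Y s t) =
      comp μ (bilin B s t) + lieFun X (comp μ t) - lieFun Y (comp μ s) := by
  rw [mapBracket, comp_sub, comp_add, comp_lieMap, comp_lieMap]

theorem mapBracket_constMap (X Y : VField E M) (v w : W) :
    mapBracket B X Y (constMap E M v) (constMap E M w) = constMap E M (B v w) := by
  rw [mapBracket, lieMap_const, lieMap_const, add_zero, sub_zero]
  rfl

omit [IsManifold 𝓘(ℝ, E) ∞ M] in
theorem bilin_add_left (v v' w : SmoothMap E M W) :
    bilin B (v + v') w = bilin B v w + bilin B v' w :=
  Subtype.ext (funext fun x => B.map_add₂ (v.1 x) (v'.1 x) (w.1 x))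

omit [IsManifold 𝓘(ℝ, E) ∞ M] in
theorem bilin_sub_left (v v' w : SmoothMap E M W) :
    bilin B (v - v') w = bilin B v w - bilin B v' w :=
  Subtype.ext (funext fun x => B.map_sub₂ (v.1 x) (v'.1 x) (w.1 x))

omit [IsManifold 𝓘(ℝ, E) ∞ M] in
theorem bilin_sub (v w w' : SmoothMap E M W) :
    bilin B v (w - w') = bilin B v w - bilin B v w' :=
  Subtype.ext (funext fun x => map_sub (B (v.1 x)) (w.1 x) (w'.1 x))

/-- The product B is a pointwise Lie bracket, each L_X is a derivation of it, and X ↦ L_X respects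
commutators: these are the ingredients of the Jacobi identity in a semidirect product. -/
theorem mapBracket_jacobi [FiniteDimensional ℝ E]
    (hB : ∀ s t : SmoothMap E M W, bilin B t s = -bilin B s t)
    (hJ : ∀ s t u, B s (B t u) = B (B s t) u + B t (B s u))
    (X Y Z : VField E M) (s t u : SmoothMap E M W) :
    mapBracket B X (lieField Y Z) s (mapBracket B Y Z t u) =
      mapBracket B (lieField X Y) Z (mapBracket B X Y s t) u +
      mapBracket B Y (lieField X Z) t (mapBracket B X Z s u) := by
  have h : bilin B s (bilin B t u) = bilin B (bilin B s t) u + bilin B t (bilin B s u) :=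
    Subtype.ext (funext fun x => hJ (s.1 x) (t.1 x) (u.1 x))
  simp only [mapBracket, bilin_add, bilin_sub, bilin_add_left, bilin_sub_left, lieMap_add,
    lieMap_sub, lieMap_lieField, lieMap_bilin, h]
  rw [hB t (lieMap Z s)]
  abel

end MapBracket

/-! ### Comparison with the double and tensoriality of the jacobiator. -/

section Jacobi

set_option linter.unusedSectionVars false

variable {E : Type*} [NormedAddCommGroup E] [NormedSpace ℝ E] [FiniteDimensional ℝ E]
  {M : Type*} [TopologicalSpace M] [ChartedSpace E M] [IsManifold 𝓘(ℝ, E) ∞ M] [T2Space M]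
  {𝔤 : Type*} [LieRing 𝔤] [LieAlgebra ℝ 𝔤] [FiniteDimensional ℝ 𝔤]
  {F : 𝔤 →ₗ[ℝ] (Module.Dual ℝ 𝔤) [⋀^Fin 2]→ₗ[ℝ] ℝ}
  {χ : (Module.Dual ℝ 𝔤) [⋀^Fin 3]→ₗ[ℝ] ℝ}
  {ρ : 𝔤 →ₗ[ℝ] VField E M} {P : Bivector E M}

theorem smoothMap_double_ext {s t : SmoothMap E M (𝔤 × Module.Dual ℝ 𝔤)}
    (h₁ : ∀ x, (s.1 x).1 = (t.1 x).1)
    (h₂ : ∀ w, comp (Module.Dual.eval ℝ 𝔤 w ∘ₗ LinearMap.snd ℝ _ _) s =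
      comp (Module.Dual.eval ℝ 𝔤 w ∘ₗ LinearMap.snd ℝ _ _) t) : s = t :=
  Subtype.ext (funext fun x => Prod.ext (h₁ x) (LinearMap.ext fun w => DFunLike.congr_fun (h₂ w) x))

theorem comp_snd_toDouble (w : 𝔤) (a : SmoothMap E M 𝔤 × OneForm E M) :
    comp (Module.Dual.eval ℝ 𝔤 w ∘ₗ LinearMap.snd ℝ _ _) (toDouble ρ a) = -pair a.2 (ρ w) := by
  ext x
  rw [comp_apply, toDouble_apply]
  rfl

theorem toDouble_fst (a : SmoothMap E M 𝔤 × OneForm E M) (x : M) :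
    ((toDouble ρ a).1 x).1 = a.1.1 x := by rw [toDouble_apply]

theorem postcomp_fst_toDouble (a : SmoothMap E M 𝔤 × OneForm E M) :
    postcomp (LinearMap.fst ℝ _ _) (toDouble ρ a) = a.1 :=
  Subtype.ext (funext fun x => toDouble_fst a x)

/-- In the 𝔤-component the comparison holds by construction of the bracket, whatever π is; only the
𝔤^*-component imposes conditions. -/
theorem sectionBracket_fst (a b : SmoothMap E M 𝔤 × OneForm E M) (x : M) :
    ((sectionBracketₗ F χ ρ P a b).1.1 x) =
      ((mapBracket (doubleₗ F χ) (anchor ρ P a) (anchor ρ P b) (toDouble ρ a) (toDouble ρ b)).1 x).1 := by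
  have h : (sectionBracketₗ F χ ρ P a b).1 = postcomp (LinearMap.fst ℝ _ _)
      (mapBracket (doubleₗ F χ) (anchor ρ P a) (anchor ρ P b) (toDouble ρ a) (toDouble ρ b)) := by
    rw [postcomp_mapBracket, postcomp_fst_toDouble, postcomp_fst_toDouble]
    rfl
  rw [h]
  rfl

theorem toDouble_neg (a : SmoothMap E M 𝔤 × OneForm E M) : toDouble ρ (-a) = -toDouble ρ a := by
  refine Subtype.ext (funext fun x => ?_)
  change (toDouble ρ (-a)).1 x = -(toDouble ρ a).1 x
  rw [toDouble_apply, toDouble_apply]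
  rfl

/-- Both sides are skew and obey the same Leibniz rule, so generators suffice. The pair (v, α) needs
that ρ is an action; the pair (α, β) needs L_{ρ(w)} π = -ρ(F(w)), which produces F^*(ρ^*α, ρ^*β). -/
theorem toDouble_sectionBracketₗ (hρ : IsInfinitesimalAction ρ) (h : IsQuasiPoisson F χ ρ P)
    (a b : SmoothMap E M 𝔤 × OneForm E M) : toDouble ρ (sectionBracketₗ F χ ρ P a b) =
      mapBracket (doubleₗ F χ) (anchor ρ P a) (anchor ρ P b) (toDouble ρ a) (toDouble ρ b) := by
  have hb := isQuasiPoissonBracket_sectionBracketₗ F χ ρ P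
  have hfst : ∀ a b x, ((toDouble ρ (sectionBracketₗ F χ ρ P a b)).1 x).1 =
      ((mapBracket (doubleₗ F χ) (anchor ρ P a) (anchor ρ P b) (toDouble ρ a) (toDouble ρ b)).1 x).1 := fun a b x => by
    rw [toDouble_fst, sectionBracket_fst]
  have hswap : ∀ a b, toDouble ρ (sectionBracketₗ F χ ρ P a b) =
      mapBracket (doubleₗ F χ) (anchor ρ P a) (anchor ρ P b) (toDouble ρ a) (toDouble ρ b) →
      toDouble ρ (sectionBracketₗ F χ ρ P b a) =
      mapBracket (doubleₗ F χ) (anchor ρ P b) (anchor ρ P a) (toDouble ρ b) (toDouble ρ a) := fun a b e => by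
    rw [sectionBracketₗ_swap, toDouble_neg, e]
    exact (mapBracket_swap _ (bilin_double_swap F χ) _ _ _ _).symm
  have key : ∀ a, (∀ v, toDouble ρ (sectionBracketₗ F χ ρ P a (constMap E M v, 0)) =
      mapBracket (doubleₗ F χ) (anchor ρ P a) (anchor ρ P (constMap E M v, 0)) (toDouble ρ a)
        (toDouble ρ (constMap E M v, 0))) →
      (∀ α, toDouble ρ (sectionBracketₗ F χ ρ P a (0, α)) =
      mapBracket (doubleₗ F χ) (anchor ρ P a) (anchor ρ P (0, α)) (toDouble ρ a) (toDouble ρ (0, α))) →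
      ∀ b, toDouble ρ (sectionBracketₗ F χ ρ P a b) =
      mapBracket (doubleₗ F χ) (anchor ρ P a) (anchor ρ P b) (toDouble ρ a) (toDouble ρ b) := fun a h1 h2 b => by
    refine section_induction (p := fun b => toDouble ρ (sectionBracketₗ F χ ρ P a b) =
      mapBracket (doubleₗ F χ) (anchor ρ P a) (anchor ρ P b) (toDouble ρ a) (toDouble ρ b)) ?_ ?_ h1 h2 b
    · intro b c hb hc
      rw [map_add, toDouble_add, hb, hc, map_add, toDouble_add]
      exact (mapBracket_add _ _ _ _ _ _ _).symm
    · intro f b hb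
      rw [sectionBracketₗ_leibniz, toDouble_add, toDouble_smul, toDouble_smul, hb, map_smul, toDouble_smul]
      exact (mapBracket_smul _ _ _ _ _ _).symm
  have hcc : ∀ u v, toDouble ρ (sectionBracketₗ F χ ρ P (constMap E M u, 0) (constMap E M v, 0)) =
      mapBracket (doubleₗ F χ) (anchor ρ P (constMap E M u, 0)) (anchor ρ P (constMap E M v, 0))
        (toDouble ρ (constMap E M u, 0))
        (toDouble ρ (constMap E M v, 0)) := fun u v => by
    rw [sectionBracketₗ_const_const, toDouble_const, toDouble_const, toDouble_const,
      mapBracket_constMap]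
    exact Subtype.ext (funext fun x => (doubleBracket_const_const F χ u v).symm)
  have hcf : ∀ v α, toDouble ρ (sectionBracketₗ F χ ρ P (constMap E M v, 0) (0, α)) =
      mapBracket (doubleₗ F χ) (anchor ρ P (constMap E M v, 0)) (anchor ρ P (0, α)) (toDouble ρ (constMap E M v, 0))
        (toDouble ρ (0, α)) := fun v α => by
    refine smoothMap_double_ext (hfst _ _) fun w => ?_
    rw [comp_snd_toDouble, comp_mapBracket,
      comp_snd_toDouble, comp_snd_toDouble, hb.const_form_snd, pair_lieForm, anchor_const,
      pair_zero_left, neg_zero, lieFun_zero, sub_zero, lieFun_neg, ← hρ, neg_sub, sub_eq_add_neg]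
    congr 1
    ext x
    rw [comp_apply, toDouble_const]
    change pair α (ρ ⁅v, w⁆) x = (doubleBracket F χ (v, 0) ((toDouble ρ (0, α)).1 x)).2 w
    rw [toDouble_form_apply, doubleBracket_const_form]
    exact (neg_neg _).symm
  have hff : ∀ α β, toDouble ρ (sectionBracketₗ F χ ρ P (0, α) (0, β)) =
      mapBracket (doubleₗ F χ) (anchor ρ P (0, α)) (anchor ρ P (0, β))
        (toDouble ρ (0, α)) (toDouble ρ (0, β)) := fun α β => by
    refine smoothMap_double_ext (hfst _ _) fun w => ?_
    rw [comp_snd_toDouble, comp_mapBracket,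
      comp_snd_toDouble, comp_snd_toDouble, hb.form_form_snd, formBracket, pair_sub_left,
      pair_sub_left, pair_lieForm, pair_lieForm, anchor_form, anchor_form, lieFun_neg, lieFun_neg,
      pair_extd]
    -- The two minus signs of `toDouble` cancel in the bilinear F^*, leaving F(w)(ρ^*α, ρ^*β).
    have h1 : comp (Module.Dual.eval ℝ 𝔤 w ∘ₗ LinearMap.snd ℝ _ _)
        (bilin (doubleₗ F χ) (toDouble ρ (0, α)) (toDouble ρ (0, β))) =
        -lieBivector (ρ w) P α β := by
      ext x
      rw [comp_apply]
      change (doubleBracket F χ ((toDouble ρ (0, α)).1 x) ((toDouble ρ (0, β)).1 x)).2 w =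
        -lieBivector (ρ w) P α β x
      rw [toDouble_form_apply, toDouble_form_apply, doubleBracket_form_form, h.lie_bivector]
      change F w ![-pull ρ x (α x), -pull ρ x (β x)] = - -F w ![pull ρ x (α x), pull ρ x (β x)]
      rw [neg_neg, ← neg_one_smul ℝ (pull ρ x (α x)), ← neg_one_smul ℝ (pull ρ x (β x)),
        map_vec2_smul, map_vec2_swap, map_vec2_smul, map_vec2_swap (F w) (pull ρ x (α x))]
      ring
    have h2 : P.eval (lieForm (ρ w) α) β =
        lieFun (ρ w) (P.eval α β) + pair α (lieField (ρ w) (P.sharpForm β)) := by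
      have e1 : P.eval (lieForm (ρ w) α) β = -pair (lieForm (ρ w) α) (P.sharpForm β) :=
        P.pair_sharpForm_swap _ _
      have e2 : pair α (P.sharpForm β) = -P.eval α β := P.pair_sharpForm_swap _ _
      rw [e1, pair_lieForm, e2, lieFun_neg]
      abel
    have h3 : P.eval α (lieForm (ρ w) β) =
        lieFun (ρ w) (P.eval α β) - pair β (lieField (ρ w) (P.sharpForm α)) :=
      pair_lieForm _ _ _
    have h4 : ∀ γ X, pair γ (lieField X (ρ w)) = -pair γ (lieField (ρ w) X) := fun γ X => by
      rw [lieField_swap]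
      ext x
      exact map_neg (γ x) _
    rw [h1, lieBivector, h2, h3, h4, h4]
    abel
  have hc : ∀ v b, _ := fun v => key (constMap E M v, 0) (hcc v) (hcf v)
  have hf : ∀ α b, _ := fun α => key (0, α) (fun v => hswap _ _ (hc v _)) (hff α)
  exact key a (fun v => hswap _ _ (hc v a)) (fun α => hswap _ _ (hf α a)) b

variable (F χ ρ P) in
/-- The failure of the Jacobi identity. -/
def jacobiator (a b c : SmoothMap E M 𝔤 × OneForm E M) : SmoothMap E M 𝔤 × OneForm E M :=
  sectionBracketₗ F χ ρ P a (sectionBracketₗ F χ ρ P b c) -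
    sectionBracketₗ F χ ρ P (sectionBracketₗ F χ ρ P a b) c -
    sectionBracketₗ F χ ρ P b (sectionBracketₗ F χ ρ P a c)

theorem sectionBracketₗ_neg (a b : SmoothMap E M 𝔤 × OneForm E M) :
    sectionBracketₗ F χ ρ P a (-b) = -sectionBracketₗ F χ ρ P a b :=
  (sectionBracketₗ F χ ρ P a).map_neg b

theorem sectionBracketₗ_neg_left (a b : SmoothMap E M 𝔤 × OneForm E M) :
    sectionBracketₗ F χ ρ P (-a) b = -sectionBracketₗ F χ ρ P a b :=
  (sectionBracketₗ F χ ρ P).map_neg₂ a b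

theorem jacobiator_swap₁₂ (a b c : SmoothMap E M 𝔤 × OneForm E M) :
    jacobiator F χ ρ P b a c = -jacobiator F χ ρ P a b c := by
  rw [jacobiator, jacobiator, sectionBracketₗ_swap a b, sectionBracketₗ_neg_left]
  abel

theorem jacobiator_swap₂₃ (a b c : SmoothMap E M 𝔤 × OneForm E M) :
    jacobiator F χ ρ P a c b = -jacobiator F χ ρ P a b c := by
  rw [jacobiator, jacobiator, sectionBracketₗ_swap b c, sectionBracketₗ_neg,
    sectionBracketₗ_swap (F := F) (χ := χ) (ρ := ρ) (P := P) b (sectionBracketₗ F χ ρ P a c),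
    sectionBracketₗ_swap (F := F) (χ := χ) (ρ := ρ) (P := P) (sectionBracketₗ F χ ρ P a b) c]
  abel

theorem jacobiator_add (a b c d : SmoothMap E M 𝔤 × OneForm E M) :
    jacobiator F χ ρ P a b (c + d) = jacobiator F χ ρ P a b c + jacobiator F χ ρ P a b d := by
  simp only [jacobiator, map_add]
  abel

theorem anchor_bracket (h : ∀ a b, anchorDefect F χ ρ P a b = 0)
    (a b : SmoothMap E M 𝔤 × OneForm E M) :
    anchor ρ P (sectionBracketₗ F χ ρ P a b) = lieField (anchor ρ P a) (anchor ρ P b) :=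
  sub_eq_zero.1 (h a b)

theorem section_smul_sub (f : SmoothFun E M) (a b : SmoothMap E M 𝔤 × OneForm E M) :
    f • (a - b) = f • a - f • b :=
  Prod.ext (smul_sub f a.1 b.1) (ContMDiffSection.ext fun x => smul_sub (f x) (a.2 x) (b.2 x))

theorem section_sub_smul (f g : SmoothFun E M) (a : SmoothMap E M 𝔤 × OneForm E M) :
    (f - g) • a = f • a - g • a :=
  Prod.ext (sub_smul f g a.1) (ContMDiffSection.ext fun x => sub_smul (f x) (g x) (a.2 x))

/-- The terms that differentiate f twice combine to ([r(a), r(b)] - r[a, b])(f) c, which vanishes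
with the anchor defect; the mixed first-order terms cancel in pairs. -/
theorem jacobiator_smul (h : ∀ a b, anchorDefect F χ ρ P a b = 0)
    (a b c : SmoothMap E M 𝔤 × OneForm E M) (f : SmoothFun E M) :
    jacobiator F χ ρ P a b (f • c) = f • jacobiator F χ ρ P a b c := by
  simp only [jacobiator, sectionBracketₗ_leibniz, map_add, anchor_bracket h, lieFun_lieField,
    section_smul_sub, section_sub_smul]
  abel

end Jacobi

/-! ### Differentiating pointwise multilinear expressions. -/

section ProductRules

variable {E : Type*} [NormedAddCommGroup E] [NormedSpace ℝ E]
  {M : Type*} [TopologicalSpace M] [ChartedSpace E M] [IsManifold 𝓘(ℝ, E) ∞ M]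
  {W₁ W₂ W₃ W₄ : Type*} [AddCommGroup W₁] [Module ℝ W₁] [FiniteDimensional ℝ W₁]
  [AddCommGroup W₂] [Module ℝ W₂] [FiniteDimensional ℝ W₂]
  [AddCommGroup W₃] [Module ℝ W₃] [FiniteDimensional ℝ W₃]
  [AddCommGroup W₄] [Module ℝ W₄] [FiniteDimensional ℝ W₄]

/-- Used, with the trilinear version below, to differentiate the quasi-Poisson equations along an
arbitrary vector field. -/
theorem lieFun_of_eq_bilin (B : W₁ →ₗ[ℝ] W₂ →ₗ[ℝ] ℝ) {f : SmoothFun E M} {s : SmoothMap E M W₁}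
    {t : SmoothMap E M W₂} (hf : ∀ x, f x = B (s.1 x) (t.1 x)) (X : VField E M) (x : M) :
    lieFun X f x = B ((lieMap X s).1 x) (t.1 x) + B (s.1 x) ((lieMap X t).1 x) := by
  have h : f = comp LinearMap.id (bilin B s t) := by
    ext x
    exact hf x
  rw [h, ← comp_lieMap, lieMap_bilin]
  rfl

theorem lieFun_of_eq_trilin (C : W₁ →ₗ[ℝ] W₂ →ₗ[ℝ] W₃) (B : W₃ →ₗ[ℝ] W₄ →ₗ[ℝ] ℝ)
    {f : SmoothFun E M} {s : SmoothMap E M W₁} {t : SmoothMap E M W₂} {u : SmoothMap E M W₄}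
    (hf : ∀ x, f x = B (C (s.1 x) (t.1 x)) (u.1 x)) (X : VField E M) (x : M) :
    lieFun X f x = B (C ((lieMap X s).1 x) (t.1 x)) (u.1 x) +
      B (C (s.1 x) ((lieMap X t).1 x)) (u.1 x) + B (C (s.1 x) (t.1 x)) ((lieMap X u).1 x) := by
  rw [lieFun_of_eq_bilin B (s := bilin C s t) (t := u) hf, lieMap_bilin]
  change B (C ((lieMap X s).1 x) (t.1 x) + C (s.1 x) ((lieMap X t).1 x)) (u.1 x) + _ = _
  rw [map_add, LinearMap.add_apply]
  rfl

end ProductRules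

/-! ### The Jacobi identity and the equivalence. -/

section JacobiIdentity

set_option linter.unusedSectionVars false

variable {E : Type*} [NormedAddCommGroup E] [NormedSpace ℝ E] [FiniteDimensional ℝ E]
  {M : Type*} [TopologicalSpace M] [ChartedSpace E M] [IsManifold 𝓘(ℝ, E) ∞ M] [T2Space M]
  {𝔤 : Type*} [LieRing 𝔤] [LieAlgebra ℝ 𝔤] [FiniteDimensional ℝ 𝔤]
  {F : 𝔤 →ₗ[ℝ] (Module.Dual ℝ 𝔤) [⋀^Fin 2]→ₗ[ℝ] ℝ}
  {χ : (Module.Dual ℝ 𝔤) [⋀^Fin 3]→ₗ[ℝ] ℝ}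
  {ρ : 𝔤 →ₗ[ℝ] VField E M} {P : Bivector E M}

/-- For constant w both sides are X(ρ(w) g), since L_{ρ(w)} dg = d(ρ(w) g); both are linear over
functions in w. -/
theorem pair_actForm_extd (w : SmoothMap E M 𝔤) (g : SmoothFun E M) (X : VField E M) (x : M) :
    pair (actForm ρ w (extd g)) X x = (lieMap X (pullMap ρ (extd g))).1 x (w.1 x) := by
  have h1 : ∀ v, (lieMap X (pullMap ρ (extd g))).1 x v = lieFun X (lieFun (ρ v) g) x := fun v => by
    have h := comp_lieMap X (pullMap ρ (extd g)) (Module.Dual.eval ℝ 𝔤 v)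
    rw [comp_eval_pullMap] at h
    exact DFunLike.congr_fun h x
  conv_rhs => rw [← (Module.finBasis ℝ 𝔤).sum_repr (w.1 x), map_sum]
  rw [actForm, pair_sum_left, smoothFun_sum_apply]
  refine Finset.sum_congr rfl fun i _ => ?_
  rw [map_smul, h1, pair_smul_left, lieForm_extd, pair_extd]
  rfl

theorem actForm_zero_left (β : OneForm E M) : actForm ρ (0 : SmoothMap E M 𝔤) β = 0 := by
  simpa using actForm_add_left ρ 0 0 β

theorem actForm_zero (u : SmoothMap E M 𝔤) : actForm ρ u (0 : OneForm E M) = 0 := by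
  simpa using actForm_add ρ u 0 0

theorem formBracket_zero_left (α : OneForm E M) : formBracket P 0 α = 0 := by
  simpa using formBracket_add_left P 0 0 α

theorem sectionBracketₗ_snd (a b : SmoothMap E M 𝔤 × OneForm E M) :
    (sectionBracketₗ F χ ρ P a b).2 =
      actForm ρ a.1 b.2 - actForm ρ b.1 a.2 + formBracket P a.2 b.2 := rfl

theorem sectionBracketₗ_const_snd (v : 𝔤) (b : SmoothMap E M 𝔤 × OneForm E M) :
    (sectionBracketₗ F χ ρ P (constMap E M v, 0) b).2 = lieForm (ρ v) b.2 := by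
  rw [sectionBracketₗ_snd, actForm_const, actForm_zero, formBracket_zero_left, sub_zero, add_zero]

theorem sectionBracketₗ_form_snd (α : OneForm E M) (b : SmoothMap E M 𝔤 × OneForm E M) :
    (sectionBracketₗ F χ ρ P (0, α) b).2 = formBracket P α b.2 - actForm ρ b.1 α := by
  rw [sectionBracketₗ_snd, actForm_zero_left]
  abel

theorem sectionBracketₗ_snd_form (a : SmoothMap E M 𝔤 × OneForm E M) (α : OneForm E M) :
    (sectionBracketₗ F χ ρ P a (0, α)).2 = formBracket P a.2 α + actForm ρ a.1 α := by
  rw [sectionBracketₗ_snd, actForm_zero_left]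
  abel

/-- The pair (r, `toDouble`) preserves brackets into the semidirect product, where Jacobi holds, and
the 𝔤-component of a section can be read off from `toDouble`. -/
theorem jacobiator_fst (hFχ : IsLieQuasiBialgebra F χ) (hρ : IsInfinitesimalAction ρ)
    (h : IsQuasiPoisson F χ ρ P) (a b c : SmoothMap E M 𝔤 × OneForm E M) :
    (jacobiator F χ ρ P a b c).1 = 0 := by
  have hr := anchor_bracket (h.anchorDefect_eq_zero hρ)
  have ht := toDouble_sectionBracketₗ hρ h
  have key := mapBracket_jacobi (doubleₗ F χ) (bilin_double_swap (E := E) (M := M) F χ) hFχ.jacobi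
    (anchor ρ P a) (anchor ρ P b) (anchor ρ P c) (toDouble ρ a) (toDouble ρ b) (toDouble ρ c)
  rw [← hr, ← hr, ← hr, ← ht, ← ht, ← ht, ← ht, ← ht, ← ht] at key
  refine Subtype.ext (funext fun x => ?_)
  have h1 := congrArg Prod.fst (congrFun (congrArg Subtype.val key) x)
  change ((toDouble ρ _).1 x).1 = ((toDouble ρ _).1 x).1 + ((toDouble ρ _).1 x).1 at h1
  rw [toDouble_fst, toDouble_fst, toDouble_fst] at h1
  change (sectionBracketₗ F χ ρ P a _).1.1 x - (sectionBracketₗ F χ ρ P _ c).1.1 x -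
    (sectionBracketₗ F χ ρ P b _).1.1 x = 0
  rw [h1]
  abel

theorem jacobiator_snd_const_const_const (u v w : 𝔤) :
    (jacobiator F χ ρ P (constMap E M u, 0) (constMap E M v, 0) (constMap E M w, 0)).2 = 0 := by
  simp only [jacobiator, sectionBracketₗ_const_const, Prod.snd_sub, sub_zero]

theorem jacobiator_snd_const_const_extd (hρ : IsInfinitesimalAction ρ) (u v : 𝔤)
    (f : SmoothFun E M) :
    (jacobiator F χ ρ P (constMap E M u, 0) (constMap E M v, 0) (0, extd f)).2 = 0 := by
  simp only [jacobiator, sectionBracketₗ_const_const, Prod.snd_sub, sectionBracketₗ_const_snd,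
    lieForm_extd, hρ u v, lieFun_lieField, extd_sub]
  abel

/-- Evaluated on X, this is the X-derivative of (L_{ρ(v)} π)(df, dg) = -F(v)(ρ^*df, ρ^*dg): the
derivatives of ρ^*df and ρ^*dg are the action terms of the nested brackets. -/
theorem jacobiator_snd_const_extd_extd (h : IsQuasiPoisson F χ ρ P) (v : 𝔤)
    (f g : SmoothFun E M) :
    (jacobiator F χ ρ P (constMap E M v, 0) (0, extd f) (0, extd g)).2 = 0 := by
  have hb := isQuasiPoissonBracket_sectionBracketₗ F χ ρ P
  refine oneForm_ext fun X => ?_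
  have h0 : lieFun X (lieBivector (ρ v) P (extd f) (extd g)) =
      lieFun X (lieFun (ρ v) (P.bracket f g)) - lieFun X (P.bracket (lieFun (ρ v) f) g) -
        lieFun X (P.bracket f (lieFun (ρ v) g)) := by
    rw [lieBivector, lieForm_extd, lieForm_extd, lieFun_sub, lieFun_sub]
    rfl
  rw [jacobiator, Prod.snd_sub, Prod.snd_sub, sectionBracketₗ_const_snd, hb.form_form_snd,
    sectionBracketₗ_snd_form, sectionBracketₗ_form_snd, hb.const_form_snd, hb.const_form_snd]
  simp only [formBracket_extd, lieForm_extd, pair_sub_left, pair_add_left, pair_extd,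
    pair_zero_left]
  ext x
  have h1 := DFunLike.congr_fun h0 x
  have h2 := lieFun_of_eq_bilin (Module.Dual.eval ℝ 𝔤 ∘ₗ (-contract₂ₗ F v))
    (f := lieBivector (ρ v) P (extd f) (extd g)) (s := pullMap ρ (extd f))
    (t := pullMap ρ (extd g)) (fun y => by
      rw [h.lie_bivector, ← apply_contract₂]
      exact (map_neg (pull ρ y (extd g y)) _).symm) X x
  have h3 := pair_actForm_extd (ρ := ρ)
    (sectionBracketₗ F χ ρ P (constMap E M v, 0) (0, extd f)).1 g X x
  have h4 := pair_actForm_extd (ρ := ρ)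
    (sectionBracketₗ F χ ρ P (constMap E M v, 0) (0, extd g)).1 f X x
  rw [hb.const_form_fst, map_neg] at h3 h4
  change _ = pull ρ x (extd g x) (-contract₂ (F v) ((lieMap X (pullMap ρ (extd f))).1 x)) +
    (lieMap X (pullMap ρ (extd g))).1 x (-contract₂ (F v) (pull ρ x (extd f x))) at h2
  rw [map_neg, map_neg, apply_contract₂, map_vec2_swap] at h2
  rw [apply_contract₂] at h4
  change lieFun X _ x = lieFun X _ x - lieFun X _ x - lieFun X _ x at h1
  change lieFun X _ x - (lieFun X _ x + pair _ X x) - (lieFun X _ x - pair _ X x) = 0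
  rw [h3, h4]
  linarith

/-- Evaluated on X, this is the X-derivative of the Schouten equation on (df, dg, dk); the three
terms in which χ has a differentiated argument are the action terms of the nested brackets. -/
theorem jacobiator_snd_extd_extd_extd (h : IsQuasiPoisson F χ ρ P) (f g k : SmoothFun E M) :
    (jacobiator F χ ρ P (0, extd f) (0, extd g) (0, extd k)).2 = 0 := by
  have hb := isQuasiPoissonBracket_sectionBracketₗ F χ ρ P
  refine oneForm_ext fun X => ?_
  have h0 : lieFun X (P.bracket f (P.bracket g k) - P.bracket (P.bracket f g) k -
      P.bracket g (P.bracket f k)) = lieFun X (P.bracket f (P.bracket g k)) -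
      lieFun X (P.bracket (P.bracket f g) k) - lieFun X (P.bracket g (P.bracket f k)) := by
    rw [lieFun_sub, lieFun_sub]
  simp only [jacobiator, Prod.snd_sub, sectionBracketₗ_snd_form,
    sectionBracketₗ_form_snd, hb.form_form_snd, formBracket_extd, pair_sub_left,
    pair_add_left, pair_extd, pair_zero_left]
  ext x
  have h1 := DFunLike.congr_fun h0 x
  have h2 := lieFun_of_eq_trilin (contract₃ₗ χ) (Module.Dual.eval ℝ 𝔤)
    (f := P.bracket f (P.bracket g k) - P.bracket (P.bracket f g) k -
      P.bracket g (P.bracket f k)) (s := pullMap ρ (extd f))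
    (t := pullMap ρ (extd g)) (u := pullMap ρ (extd k)) (fun y => by
      rw [← half_schouten_self, h.schouten_self, ← apply_contract₃]
      rfl) X x
  have h3 := pair_actForm_extd (ρ := ρ)
    (sectionBracketₗ F χ ρ P (0, extd g) (0, extd k)).1 f X x
  have h4 := pair_actForm_extd (ρ := ρ)
    (sectionBracketₗ F χ ρ P (0, extd f) (0, extd g)).1 k X x
  have h5 := pair_actForm_extd (ρ := ρ)
    (sectionBracketₗ F χ ρ P (0, extd f) (0, extd k)).1 g X x
  rw [hb.form_form_fst] at h3 h4 h5
  change _ = pull ρ x (extd k x) (contract₃ χ ((lieMap X (pullMap ρ (extd f))).1 x)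
      (pull ρ x (extd g x))) +
    pull ρ x (extd k x) (contract₃ χ (pull ρ x (extd f x)) ((lieMap X (pullMap ρ (extd g))).1 x)) +
    (lieMap X (pullMap ρ (extd k))).1 x (contract₃ χ (pull ρ x (extd f x)) (pull ρ x (extd g x)))
    at h2
  -- Permutations of the arguments of χ bring the differentiated one to the last place, matching
  -- `h3` and `h5`.
  rw [apply_contract₃, apply_contract₃, ← map_vec3_rotate χ _ (pull ρ x (extd g x)),
    ← map_vec3_rotate χ (pull ρ x (extd f x)) _ (pull ρ x (extd k x)),
    map_vec3_swap χ (pull ρ x (extd k x)) _ (pull ρ x (extd f x))] at h2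
  rw [apply_contract₃] at h3 h5
  change lieFun X _ x = lieFun X _ x - lieFun X _ x - lieFun X _ x at h1
  change lieFun X _ x - pair _ X x - (lieFun X _ x + pair _ X x) -
    (lieFun X _ x - pair _ X x) = 0
  rw [h3, h4, h5]
  have h6 := map_vec3_rotate χ (pull ρ x (extd f x)) (pull ρ x (extd k x))
    ((lieMap X (pullMap ρ (extd g))).1 x)
  linarith

theorem eq_zero_of_swap_of_generators₃ {F' : Type*} [NormedAddCommGroup F'] [NormedSpace ℝ F']
    {V : M → Type*} [TopologicalSpace (TotalSpace F' V)] [∀ x, TopologicalSpace (V x)]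
    [FiberBundle F' V] [∀ x, AddCommGroup (V x)] [∀ x, Module ℝ (V x)] [VectorBundle ℝ F' V]
    {T : SmoothMap E M 𝔤 × OneForm E M → SmoothMap E M 𝔤 × OneForm E M →
      SmoothMap E M 𝔤 × OneForm E M → Cₛ^∞⟮𝓘(ℝ, E); F', V⟯}
    (hswap : ∀ a b c, T b a c = -T a b c) (hswap' : ∀ a b c, T a c b = -T a b c)
    (hadd : ∀ a b c d, T a b (c + d) = T a b c + T a b d)
    (hsmul : ∀ a b c (f : SmoothFun E M), T a b (f • c) = f • T a b c)
    (hccc : ∀ u v w, T (constMap E M u, 0) (constMap E M v, 0) (constMap E M w, 0) = 0)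
    (hccd : ∀ u v f, T (constMap E M u, 0) (constMap E M v, 0) (0, extd f) = 0)
    (hcdd : ∀ v f g, T (constMap E M v, 0) (0, extd f) (0, extd g) = 0)
    (hddd : ∀ f g h, T (0, extd f) (0, extd g) (0, extd h) = 0) (a b c) : T a b c = 0 := by
  have h0 : ∀ a b c, T a b c = 0 → T b a c = 0 := fun a b c h => by rw [hswap, h, neg_zero]
  have h0' : ∀ a b c, T a b c = 0 → T a c b = 0 := fun a b c h => by rw [hswap', h, neg_zero]
  have hc : ∀ v b c, T (constMap E M v, 0) b c = 0 := fun v =>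
    eq_zero_of_swap_of_generators (fun b c => hswap' _ b c) (hadd _) (hsmul _) (hccc v) (hccd v)
      (hcdd v)
  have hd : ∀ f b c, T (0, extd f) b c = 0 := fun f =>
    eq_zero_of_swap_of_generators (fun b c => hswap' _ b c) (hadd _) (hsmul _)
      (fun u v => h0 _ _ _ (hc u _ _)) (fun v g => h0 _ _ _ (hc v _ _)) (hddd f)
  -- Two swaps move the generator from the last slot to the first, where vanishing is already known.
  exact eq_zero_of_const_of_extd (hadd a b) (fun f c => hsmul a b c f)
    (fun v => h0' _ _ _ (h0 _ _ _ (hc v a b))) (fun f => h0' _ _ _ (h0 _ _ _ (hd f a b))) c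

theorem isLieAlgebroid_iff (hFχ : IsLieQuasiBialgebra F χ) (hρ : IsInfinitesimalAction ρ) :
    IsLieAlgebroid (anchor ρ P) (sectionBracketₗ F χ ρ P) ↔ IsQuasiPoisson F χ ρ P := by
  have hb := isQuasiPoissonBracket_sectionBracketₗ F χ ρ P
  refine ⟨fun h => isQuasiPoisson_of_anchorDefect (anchorDefect_eq_zero_of_jacobi h), fun h => ?_⟩
  refine ⟨hb.skew, fun a b c => ?_, hb.leibniz⟩
  have h1 : jacobiator F χ ρ P a b c = 0 := by
    refine Prod.ext (jacobiator_fst hFχ hρ h a b c) ?_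
    refine eq_zero_of_swap_of_generators₃ (T := fun a b c => (jacobiator F χ ρ P a b c).2)
      (fun a b c => congrArg Prod.snd (jacobiator_swap₁₂ a b c))
      (fun a b c => congrArg Prod.snd (jacobiator_swap₂₃ a b c))
      (fun a b c d => congrArg Prod.snd (jacobiator_add a b c d))
      (fun a b c f => congrArg Prod.snd (jacobiator_smul (h.anchorDefect_eq_zero hρ) a b c f))
      jacobiator_snd_const_const_const (jacobiator_snd_const_const_extd hρ)
      (jacobiator_snd_const_extd_extd h) (jacobiator_snd_extd_extd_extd h) a b c
  rw [jacobiator, sub_sub, sub_eq_zero] at h1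
  exact h1

end JacobiIdentity

/-! ### The distribution in a chart as the range of an involutive frame. -/

section LocalFrame

open Set Metric VectorField

set_option linter.unusedSectionVars false

variable {E : Type*} [NormedAddCommGroup E] [NormedSpace ℝ E] [FiniteDimensional ℝ E]
  {M : Type*} [TopologicalSpace M] [ChartedSpace E M] [IsManifold 𝓘(ℝ, E) ∞ M] [T2Space M]
  {𝔤 : Type*} [LieRing 𝔤] [LieAlgebra ℝ 𝔤] [FiniteDimensional ℝ 𝔤]
  {F : 𝔤 →ₗ[ℝ] (Module.Dual ℝ 𝔤) [⋀^Fin 2]→ₗ[ℝ] ℝ}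
  {χ : (Module.Dual ℝ 𝔤) [⋀^Fin 3]→ₗ[ℝ] ℝ}
  {ρ : 𝔤 →ₗ[ℝ] VField E M} {P : Bivector E M}

theorem chartVec_add (x₀ : M) (X Y : VField E M) (z : E) :
    chartVec x₀ (X + Y) z = chartVec x₀ X z + chartVec x₀ Y z :=
  map_add (mfderiv 𝓘(ℝ, E) 𝓘(ℝ, E) (extChartAt 𝓘(ℝ, E) x₀).symm z).inverse _ _

theorem chartVec_smul (x₀ : M) (c : ℝ) (X : VField E M) (z : E) :
    chartVec x₀ (c • X) z = c • chartVec x₀ X z :=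
  map_smul (mfderiv 𝓘(ℝ, E) 𝓘(ℝ, E) (extChartAt 𝓘(ℝ, E) x₀).symm z).inverse c _

theorem anchor_apply (a : SmoothMap E M 𝔤 × OneForm E M) (x : M) :
    anchor ρ P a x = ρ (a.1.1 x) x + P.sharp x (a.2 x) := rfl

theorem anchor_real_smul (c : ℝ) (a : SmoothMap E M 𝔤 × OneForm E M) :
    anchor ρ P (c • a) = c • anchor ρ P a :=
  (anchor ρ P).map_smul (constFun c) a

variable (E 𝔤) in
/-- The model space of the fibres of `𝔤 ⊕ T^*M`. -/
def FibreModel : Type _ := (Fin (Module.finrank ℝ 𝔤) → ℝ) × (E →L[ℝ] ℝ)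

instance : NormedAddCommGroup (FibreModel E 𝔤) :=
  inferInstanceAs (NormedAddCommGroup ((Fin (Module.finrank ℝ 𝔤) → ℝ) × (E →L[ℝ] ℝ)))

instance : NormedSpace ℝ (FibreModel E 𝔤) :=
  inferInstanceAs (NormedSpace ℝ ((Fin (Module.finrank ℝ 𝔤) → ℝ) × (E →L[ℝ] ℝ)))

instance : FiniteDimensional ℝ (FibreModel E 𝔤) :=
  inferInstanceAs (FiniteDimensional ℝ ((Fin (Module.finrank ℝ 𝔤) → ℝ) × (E →L[ℝ] ℝ)))

theorem bumpCoord_add (x₀ : M) (l l' : E →L[ℝ] ℝ) :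
    bumpCoord x₀ (l + l') = bumpCoord x₀ l + bumpCoord x₀ l' := by
  ext x
  exact smul_add _ (l _) (l' _)

theorem bumpCoord_smul (x₀ : M) (c : ℝ) (l : E →L[ℝ] ℝ) :
    bumpCoord x₀ (c • l) = constFun c * bumpCoord x₀ l := by
  ext x
  exact mul_left_comm _ c _

theorem extd_constFun_mul (c : ℝ) (f : SmoothFun E M) : extd (constFun c * f) = c • extd f := by
  refine oneForm_ext fun X => ?_
  rw [pair_extd, lieFun_mul, lieFun_const, zero_mul, add_zero]
  rfl

/-- Sections of `𝔤 ⊕ T^*M` that form a frame near a point: constant maps to `𝔤` and differentials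
of coordinates. -/
def frameSection (x₀ : M) (a : FibreModel E 𝔤) : SmoothMap E M 𝔤 × OneForm E M :=
  (constMap E M ((Module.finBasis ℝ 𝔤).equivFun.symm a.1), extd (bumpCoord x₀ a.2))

theorem frameSection_add (x₀ : M) (a b : FibreModel E 𝔤) :
    frameSection x₀ (a + b) = frameSection x₀ a + frameSection x₀ b := by
  refine Prod.ext (Subtype.ext (funext fun x => ?_)) ?_
  · exact map_add (Module.finBasis ℝ 𝔤).equivFun.symm a.1 b.1
  · change extd (bumpCoord x₀ (a.2 + b.2)) = _
    rw [bumpCoord_add, extd_add]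
    rfl

theorem frameSection_smul (x₀ : M) (c : ℝ) (a : FibreModel E 𝔤) :
    frameSection x₀ (c • a) = c • frameSection x₀ a := by
  refine Prod.ext (Subtype.ext (funext fun x => ?_)) ?_
  · exact map_smul (Module.finBasis ℝ 𝔤).equivFun.symm c a.1
  · change extd (bumpCoord x₀ (c • a.2)) = _
    rw [bumpCoord_smul, extd_constFun_mul]
    rfl

variable (ρ P) in
/-- The anchors of the local frame, in coordinates. -/
def frame (x₀ : M) (z : E) : FibreModel E 𝔤 →L[ℝ] E :=
  LinearMap.toContinuousLinearMap
    { toFun := fun a => chartVec x₀ (anchor ρ P (frameSection x₀ a)) z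
      map_add' := fun a b => by rw [frameSection_add, map_add, chartVec_add]
      map_smul' := fun c a => by
        rw [frameSection_smul, anchor_real_smul, chartVec_smul, RingHom.id_apply] }

theorem frame_apply (x₀ : M) (z : E) (a : FibreModel E 𝔤) :
    frame ρ P x₀ z a = chartVec x₀ (anchor ρ P (frameSection x₀ a)) z := rfl

variable (E) in
/-- The coordinates of the points at which `frameSection` is a frame. -/
def frameDomain (x₀ : M) : Set E :=
  (extChartAt 𝓘(ℝ, E) x₀).target ∩ (extChartAt 𝓘(ℝ, E) x₀).symm ⁻¹' coordDomain E x₀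

theorem isOpen_frameDomain (x₀ : M) : IsOpen (frameDomain E x₀) :=
  (continuousOn_extChartAt_symm x₀).isOpen_inter_preimage (isOpen_extChartAt_target x₀)
    (isOpen_coordDomain x₀)

theorem mem_frameDomain (x₀ : M) : extChartAt 𝓘(ℝ, E) x₀ x₀ ∈ frameDomain E x₀ :=
  ⟨mem_extChartAt_target x₀, by
    rw [mem_preimage, extChartAt_to_inv]
    exact mem_coordDomain x₀⟩

theorem contDiffOn_frame (x₀ : M) : ContDiffOn ℝ ∞ (frame ρ P x₀) (frameDomain E x₀) :=
  contDiffOn_clm_apply.2 fun a _ hz =>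
    (contDiffAt_chartVec (anchor ρ P (frameSection x₀ a)) hz.1).contDiffWithinAt

/-- The coordinates of a covector. -/
def cotangentCoord (x₀ y : M) (α : Cotangent E M y) : E →L[ℝ] ℝ :=
  (show E →L[ℝ] ℝ from α).comp
    (show E →L[ℝ] E from (mfderiv 𝓘(ℝ, E) 𝓘(ℝ, E) (extChartAt 𝓘(ℝ, E) x₀) y).inverse)

/-- The components of a section of `𝔤 ⊕ T^*M` at a point with respect to the local frame. -/
def components (x₀ y : M) (a : SmoothMap E M 𝔤 × OneForm E M) : FibreModel E 𝔤 :=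
  ((Module.finBasis ℝ 𝔤).equivFun (a.1.1 y),
    cotangentCoord x₀ y (a.2 y))

theorem components_add (x₀ y : M) (a b : SmoothMap E M 𝔤 × OneForm E M) :
    components x₀ y (a + b) = components x₀ y a + components x₀ y b :=
  Prod.ext (map_add (Module.finBasis ℝ 𝔤).equivFun (a.1.1 y) (b.1.1 y)) rfl

theorem components_smul (x₀ y : M) (c : ℝ) (a : SmoothMap E M 𝔤 × OneForm E M) :
    components x₀ y (c • a) = c • components x₀ y a :=
  Prod.ext (map_smul (Module.finBasis ℝ 𝔤).equivFun c (a.1.1 y)) rfl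

theorem frameSection_snd_apply {x₀ y : M} (hy : y ∈ coordDomain E x₀) (α : Cotangent E M y)
    (v : Fin (Module.finrank ℝ 𝔤) → ℝ) :
    (frameSection (𝔤 := 𝔤) x₀ (v, cotangentCoord x₀ y α)).2 y = α := by
  refine ContinuousLinearMap.ext fun w => (extd_bumpCoord hy _ w).trans ?_
  exact congrArg α ((isInvertible_mfderiv_extChartAt hy.1).inverse_apply_self w)

/-- The frame section has the same value at y as the given section, and the anchor depends only on
that value. -/
theorem anchor_frameSection_components {x₀ y : M} (hy : y ∈ coordDomain E x₀)
    (a : SmoothMap E M 𝔤 × OneForm E M) :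
    anchor ρ P (frameSection x₀ (components x₀ y a)) y = anchor ρ P a y := by
  rw [anchor_apply, anchor_apply, components, frameSection_snd_apply hy]
  congr 2
  exact congrArg ρ ((Module.finBasis ℝ 𝔤).equivFun.symm_apply_apply (a.1.1 y))

variable (F χ ρ P) in
/-- The structure functions of the local frame. -/
def structureFun (x₀ : M) (z : E) : FibreModel E 𝔤 →L[ℝ] FibreModel E 𝔤 →L[ℝ] FibreModel E 𝔤 :=
  LinearMap.toContinuousBilinearMap
    (LinearMap.mk₂ ℝ (fun a b => components x₀ ((extChartAt 𝓘(ℝ, E) x₀).symm z)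
      (sectionBracketₗ F χ ρ P (frameSection x₀ a) (frameSection x₀ b)))
    (fun a a' b => by rw [frameSection_add, LinearMap.map_add₂, components_add])
    (fun c a b => by rw [frameSection_smul, LinearMap.map_smul₂, components_smul])
    (fun a b b' => by rw [frameSection_add, map_add, components_add])
    (fun c a b => by rw [frameSection_smul, LinearMap.map_smul, components_smul]))

theorem structureFun_apply (x₀ : M) (z : E) (a b : FibreModel E 𝔤) :
    structureFun F χ ρ P x₀ z a b = components x₀ ((extChartAt 𝓘(ℝ, E) x₀).symm z)
      (sectionBracketₗ F χ ρ P (frameSection x₀ a) (frameSection x₀ b)) := rfl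

theorem continuousOn_components (x₀ : M) (a : SmoothMap E M 𝔤 × OneForm E M) :
    ContinuousOn (fun z => components x₀ ((extChartAt 𝓘(ℝ, E) x₀).symm z) a)
      (extChartAt 𝓘(ℝ, E) x₀).target := by
  have : CompleteSpace E := FiniteDimensional.complete ℝ E
  refine ContinuousOn.prodMk (continuousOn_pi.2 fun i => ?_) (continuousOn_clm_apply.2 fun v => ?_)
  · exact (a.1.2 ((Module.finBasis ℝ 𝔤).coord i)).continuous.comp_continuousOn
      (continuousOn_extChartAt_symm x₀)
  · intro z hz
    refine ContinuousAt.continuousWithinAt ?_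
    set y := (extChartAt 𝓘(ℝ, E) x₀).symm z
    have hy : y ∈ (extChartAt 𝓘(ℝ, E) x₀).source := (extChartAt 𝓘(ℝ, E) x₀).map_target hz
    -- The covector component on v is the one-form evaluated on the coordinate field of v, which is
    -- smooth near y.
    let V : Π w : E, TangentSpace 𝓘(ℝ, E) w := fun _ => v
    have hv : CMDiffAt ∞ (T% V) (extChartAt 𝓘(ℝ, E) x₀ y) :=
      contMDiffAt_vectorSpace_iff_contDiffAt.2 contDiffAt_const
    have hφ : ContMDiffAt 𝓘(ℝ, E) 𝓘(ℝ, E) ∞ (extChartAt 𝓘(ℝ, E) x₀) y :=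
      contMDiffAt_extChartAt' (by simpa using hy)
    have hY := ContMDiffAt.mpullback_vectorField_preimage (m := ∞) (n := ∞) hv hφ
      (isInvertible_mfderiv_extChartAt hy) (by simp)
    have h := (contMDiffAt_eval (a.2.contMDiff y) hY).continuousAt
    exact ContinuousAt.comp (f := (extChartAt 𝓘(ℝ, E) x₀).symm) h
      ((contMDiffAt_extChartAt_symm hz).continuousAt)

theorem continuousOn_clm_of_apply₂ {X A : Type*} [TopologicalSpace X] [NormedAddCommGroup A]
    [NormedSpace ℝ A] [FiniteDimensional ℝ A] {f : X → A →L[ℝ] A →L[ℝ] A} {s : Set X}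
    (h : ∀ a b, ContinuousOn (fun x => f x a b) s) : ContinuousOn f s :=
  continuousOn_clm_apply.2 fun a => continuousOn_clm_apply.2 (h a)

theorem continuousOn_structureFun (x₀ : M) :
    ContinuousOn (structureFun F χ ρ P x₀) (frameDomain E x₀) :=
  continuousOn_clm_of_apply₂ fun _ _ =>
    (continuousOn_components x₀ _).mono inter_subset_left

/-- The left side is the bracket of two frame fields in the chart. Since the anchor preserves
brackets, it is the anchor of a section, expanded in the frame at the point. -/
theorem fderiv_frame_sub (h : ∀ a b, anchorDefect F χ ρ P a b = 0) (x₀ : M) {z : E}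
    (hz : z ∈ frameDomain E x₀) (a b : FibreModel E 𝔤) :
    fderiv ℝ (frame ρ P x₀) z (frame ρ P x₀ z a) b -
      fderiv ℝ (frame ρ P x₀) z (frame ρ P x₀ z b) a =
        frame ρ P x₀ z (structureFun F χ ρ P x₀ z a b) := by
  have hd : DifferentiableAt ℝ (frame ρ P x₀) z :=
    ((contDiffOn_frame x₀).contDiffAt ((isOpen_frameDomain x₀).mem_nhds hz)).differentiableAt
      (by simp)
  have h1 : ∀ (a : FibreModel E 𝔤) (w : E), fderiv ℝ (frame ρ P x₀) z w a =
      fderiv ℝ (chartVec x₀ (anchor ρ P (frameSection x₀ a))) z w := fun a w => by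
    have h2 := (hd.hasFDerivAt.clm_apply (hasFDerivAt_const a z)).fderiv
    have h3 : fderiv ℝ (chartVec x₀ (anchor ρ P (frameSection x₀ a))) z w = _ :=
      DFunLike.congr_fun h2 w
    rw [h3]
    simp
  rw [h1, h1, frame_apply, frame_apply, ← chartVec_lieField _ _ hz.1, ← anchor_bracket h,
    frame_apply, structureFun_apply, chartVec_eq_mfderiv _ hz.1, chartVec_eq_mfderiv _ hz.1,
    anchor_frameSection_components hz.2]

/-- On the frame domain the frame sections fill each fibre of 𝔤 ⊕ T^*M, so their anchors fill the
distribution. -/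
theorem map_range_frame (x₀ : M) {z : E} (hz : z ∈ frameDomain E x₀) :
    (LinearMap.range (frame ρ P x₀ z).toLinearMap).map
      (mfderiv 𝓘(ℝ, E) 𝓘(ℝ, E) (extChartAt 𝓘(ℝ, E) x₀).symm z).toLinearMap =
      distribution ρ P ((extChartAt 𝓘(ℝ, E) x₀).symm z) := by
  have h1 : ∀ a, mfderiv 𝓘(ℝ, E) 𝓘(ℝ, E) (extChartAt 𝓘(ℝ, E) x₀).symm z (frame ρ P x₀ z a) =
      anchor ρ P (frameSection x₀ a) ((extChartAt 𝓘(ℝ, E) x₀).symm z) := fun a =>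
    (isInvertible_mfderiv_extChartAt_symm hz.1).self_apply_inverse _
  ext w
  constructor
  · rintro ⟨_, ⟨a, rfl⟩, rfl⟩
    exact ⟨_, _, h1 a⟩
  · rintro ⟨v, α, rfl⟩
    refine ⟨_, ⟨((Module.finBasis ℝ 𝔤).equivFun v,
      cotangentCoord x₀ ((extChartAt 𝓘(ℝ, E) x₀).symm z) α), rfl⟩, (h1 _).trans ?_⟩
    rw [anchor_apply, frameSection_snd_apply hz.2]
    congr 2
    exact congrArg ρ ((Module.finBasis ℝ 𝔤).equivFun.symm_apply_apply v)

end LocalFrame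

/-! ### Integral manifolds of the distribution. -/

section Integrability

open Set Metric OpenPartialHomeomorph

set_option linter.unusedSectionVars false

variable {E : Type*} [NormedAddCommGroup E] [NormedSpace ℝ E] [FiniteDimensional ℝ E]

/-- A linear map splits over its range. -/
theorem exists_range_splitting {A : Type*} [NormedAddCommGroup A] [NormedSpace ℝ A]
    [FiniteDimensional ℝ A] (L : A →L[ℝ] E) :
    ∃ (k : ℕ) (s : EuclideanSpace ℝ (Fin k) →L[ℝ] A) (p : E →L[ℝ] EuclideanSpace ℝ (Fin k)),
      (∀ v, p (L (s v)) = v) ∧ ∀ a, L (s (p (L a))) = L a := by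
  let D := LinearMap.range L.toLinearMap
  let i : EuclideanSpace ℝ (Fin (Module.finrank ℝ D)) ≃ₗ[ℝ] D :=
    LinearEquiv.ofFinrankEq _ _ (by simp)
  obtain ⟨g, hg⟩ := L.toLinearMap.rangeRestrict.exists_rightInverse_of_surjective
    L.toLinearMap.range_rangeRestrict
  obtain ⟨q, hq⟩ := D.subtype.exists_leftInverse_of_injective D.ker_subtype
  have hg' : ∀ d : D, L (g d) = d := fun d => congrArg Subtype.val (DFunLike.congr_fun hg d)
  have hq' : ∀ d : D, q d = d := fun d => DFunLike.congr_fun hq d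
  refine ⟨_, LinearMap.toContinuousLinearMap (g ∘ₗ i.toLinearMap),
    LinearMap.toContinuousLinearMap (i.symm.toLinearMap ∘ₗ q), fun v => ?_, fun a => ?_⟩
  · change i.symm (q (L (g (i v)))) = v
    rw [hg', hq', i.symm_apply_apply]
  · change L (g (i (i.symm (q (L a))))) = L a
    have h : q (L a) = ⟨L a, a, rfl⟩ := hq' ⟨L a, a, rfl⟩
    rw [h, i.apply_symm_apply, hg']

/-- The chain rule for the smooth inverse gives injectivity; equality of dimensions gives the rest.
-/
theorem bijective_fderiv_univBall {V : Type*} [NormedAddCommGroup V] [InnerProductSpace ℝ V]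
    [FiniteDimensional ℝ V] {r : ℝ} (hr : 0 < r) (y : V) :
    Function.Bijective (fderiv ℝ (univBall (0 : V) r) y) := by
  have hmem : univBall (0 : V) r y ∈ ball (0 : V) r := by
    have := (univBall (0 : V) r).map_source (x := y) (by simp)
    rwa [univBall_target _ hr] at this
  have h1 : DifferentiableAt ℝ (univBall (0 : V) r) y :=
    (contDiff_univBall (n := 1)).differentiable (by simp) y
  have h2 : DifferentiableAt ℝ (univBall (0 : V) r).symm (univBall (0 : V) r y) :=
    ((contDiffOn_univBall_symm (n := 1)).contDiffAt (isOpen_ball.mem_nhds hmem)).differentiableAt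
      (by simp)
  have h3 : (univBall (0 : V) r).symm ∘ univBall (0 : V) r = id :=
    funext fun x => (univBall (0 : V) r).left_inv (by simp)
  have h4 := fderiv_comp y h2 h1
  rw [h3, fderiv_id] at h4
  have hinj : Function.Injective (fderiv ℝ (univBall (0 : V) r) y) := fun u v huv => by
    have hu := DFunLike.congr_fun h4 u
    have hv := DFunLike.congr_fun h4 v
    simp only [ContinuousLinearMap.comp_apply, ContinuousLinearMap.id_apply] at hu hv
    rw [hu, hv, huv]
  exact ⟨hinj, (LinearMap.injective_iff_surjective
    (f := (fderiv ℝ (univBall (0 : V) r) y).toLinearMap)).1 hinj⟩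

variable {M : Type*} [TopologicalSpace M] [ChartedSpace E M] [IsManifold 𝓘(ℝ, E) ∞ M] [T2Space M]
  {𝔤 : Type*} [LieRing 𝔤] [LieAlgebra ℝ 𝔤] [FiniteDimensional ℝ 𝔤]
  {F : 𝔤 →ₗ[ℝ] (Module.Dual ℝ 𝔤) [⋀^Fin 2]→ₗ[ℝ] ℝ}
  {χ : (Module.Dual ℝ 𝔤) [⋀^Fin 3]→ₗ[ℝ] ℝ}
  {ρ : 𝔤 →ₗ[ℝ] VField E M} {P : Bivector E M}

/-- A local leaf is all that is required. The frame is split at the base point, the resulting leaf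
is carried to M by the inverse chart, and the range of its differential is the distribution. -/
theorem isIntegrable_distribution (h : ∀ a b, anchorDefect F χ ρ P a b = 0) :
    IsIntegrable (distribution ρ P) := by
  intro x₀
  obtain ⟨k, s, p, hps, hsp⟩ := exists_range_splitting
    (frame ρ P x₀ (extChartAt 𝓘(ℝ, E) x₀ x₀))
  obtain ⟨N, X, Y, e, hN, hz₀, hNU, hY₀, hframe⟩ := exists_isSplitFrame (isOpen_frameDomain x₀)
    (mem_frameDomain x₀) (contDiffOn_frame x₀) (continuousOn_structureFun x₀)
    (fun z hz a b => fderiv_frame_sub h x₀ hz a b) hps hsp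
  obtain ⟨r, hr, f, hf0, hf, hfinj, hleaf⟩ := hframe.exists_leaf hN hz₀ hY₀
  let V := EuclideanSpace ℝ (Fin k)
  -- The ball is reparametrized by all of Euclidean space, which serves as a connected manifold with
  -- its standard structure.
  let g : V → V := univBall (0 : V) r
  have hg : ContDiff ℝ ∞ g := contDiff_univBall
  have hgmem : ∀ y, g y ∈ ball (0 : V) r := fun y => by
    have := (univBall (0 : V) r).map_source (x := y) (by simp)
    rwa [univBall_target _ hr] at this
  have hdom : ∀ y, f (g y) ∈ frameDomain E x₀ := fun y => hNU (hleaf _ (hgmem y)).1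
  let ι : V → M := fun y => (extChartAt 𝓘(ℝ, E) x₀).symm (f (g y))
  have hfg : ContDiff ℝ ∞ (f ∘ g) := contDiffOn_univ.1 (hf.comp hg.contDiffOn fun y _ => hgmem y)
  have hι : ContMDiff 𝓘(ℝ, V) 𝓘(ℝ, E) ∞ ι := fun y =>
    (contMDiffAt_extChartAt_symm (hdom y).1).comp y hfg.contMDiff.contMDiffAt
  refine ⟨k, V, inferInstance, inferInstance, ι, inferInstance, inferInstance, inferInstance,
    inferInstance, hι, fun y y' hyy' => ?_, ⟨0, ?_⟩, fun y => ?_⟩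
  · have h1 := (extChartAt 𝓘(ℝ, E) x₀).symm.injOn (hdom y).1 (hdom y').1 hyy'
    exact (univBall (0 : V) r).injOn (by simp) (by simp) (hfinj (hgmem y) (hgmem y') h1)
  · change (extChartAt 𝓘(ℝ, E) x₀).symm (f (univBall (0 : V) r 0)) = x₀
    rw [univBall_apply_zero, hf0, extChartAt_to_inv]
  · obtain ⟨L, hL, hLinj, hLrange⟩ := (hleaf _ (hgmem y)).2
    have hbij := bijective_fderiv_univBall hr y
    have h1 : HasFDerivAt (f ∘ g) (L ∘L fderiv ℝ g y) y :=
      hL.comp y (hg.differentiable (by simp) y).hasFDerivAt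
    have h2 := mfderiv_comp y ((contMDiffAt_extChartAt_symm (hdom y).1).mdifferentiableAt (by simp))
      h1.differentiableAt.mdifferentiableAt
    rw [mfderiv_eq_fderiv, h1.fderiv] at h2
    have h3 : ∀ v : V, mfderiv 𝓘(ℝ, V) 𝓘(ℝ, E) ι y v = mfderiv 𝓘(ℝ, E) 𝓘(ℝ, E)
        (extChartAt 𝓘(ℝ, E) x₀).symm (f (g y)) (L (fderiv ℝ g y v)) := fun v =>
      DFunLike.congr_fun h2 v
    refine ⟨fun u v huv => ?_, ?_⟩
    · have huv' := (h3 u).symm.trans (huv.trans (h3 v))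
      exact hbij.1 (hLinj ((isInvertible_mfderiv_extChartAt_symm (hdom y).1).injective huv'))
    · rw [← map_range_frame x₀ (hdom y), ← hLrange]
      ext w
      constructor
      · rintro ⟨v, rfl⟩
        exact ⟨_, ⟨_, rfl⟩, (h3 v).symm⟩
      · rintro ⟨_, ⟨v, rfl⟩, rfl⟩
        obtain ⟨v', rfl⟩ := hbij.2 v
        exact ⟨v', h3 v'⟩

end Integrability

end QuasiPoisson

end

theorem theorem5p1
    {E : Type*} [NormedAddCommGroup E] [NormedSpace ℝ E] [FiniteDimensional ℝ E]
    {M : Type*} [TopologicalSpace M] [ChartedSpace E M] [IsManifold 𝓘(ℝ, E) ∞ M]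
    [T2Space M] [SecondCountableTopology M]
    {𝔤 : Type*} [LieRing 𝔤] [LieAlgebra ℝ 𝔤] [FiniteDimensional ℝ 𝔤]
    (F : 𝔤 →ₗ[ℝ] (Module.Dual ℝ 𝔤) [⋀^Fin 2]→ₗ[ℝ] ℝ)
    (χ : (Module.Dual ℝ 𝔤) [⋀^Fin 3]→ₗ[ℝ] ℝ)
    (hFχ : IsLieQuasiBialgebra F χ)
    (ρ : 𝔤 →ₗ[ℝ] VField E M) (hρ : IsInfinitesimalAction ρ)
    (P : Bivector E M) :
    ∃ br : (SmoothMap E M 𝔤 × OneForm E M) →ₗ[ℝ] (SmoothMap E M 𝔤 × OneForm E M) →ₗ[ℝ]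
        (SmoothMap E M 𝔤 × OneForm E M),
      (IsQuasiPoissonBracket F χ ρ P br ∧
        ∀ br', IsQuasiPoissonBracket F χ ρ P br' → br' = br) ∧
      (IsLieAlgebroid (anchor ρ P) br ↔ IsQuasiPoisson F χ ρ P) ∧
      (IsQuasiPoisson F χ ρ P → IsIntegrable (distribution ρ P)) := by
  have hb := isQuasiPoissonBracket_sectionBracketₗ F χ ρ P
  exact ⟨sectionBracketₗ F χ ρ P, ⟨hb, fun _ hbr => hb.unique hbr⟩, isLieAlgebroid_iff hFχ hρ,
    fun h => isIntegrable_distribution (h.anchorDefect_eq_zero hρ)⟩
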